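/- Fix integers $N$ and $n\ge 3$, put $q=N(N+1)/2$, and let $P_m$ be the set of symmetric positive definite $m\times m$ real matrices, $\|\cdot\|$ the Frobenius norm, $d_{LE}(A,B)=\|\log A-\log B\|$ for $A,B\in P_N$, and $\widetilde X\in\mathbb R^q$ the vector of the diagonal entries of $\log X$ and of $\sqrt2$ times the entries above the diagonal. Write $X\sim \mathrm{LN}(M,\Sigma)$ (with $M\in P_N$, $\Sigma\in P_q$) if $X$ is $P_N$-valued and $\widetilde X\sim N(\widetilde M,\Sigma)$. Let $(M_i,\Sigma_i)_{i\ge1}$ be a sequence in $P_N\times P_q$ and let $X_{ij}\sim\mathrm{LN}(M_i,\Sigma_i)$, $i\ge 1$, $1\le j\le n$, be independent. Put $$\bar X_i=\exp\Big(n^{-1}\sum_{j=1}^n\log X_{ij}\Big),\qquad S_i=\sum_{j=1}^n\big(\widetilde X_{ij}-\widetilde{\bar X_i}\big)\big(\widetilde X_{ij}-\widetilde{\bar X_i}\big)^T .$$ For hyperparameters $\lambda>0$, $\mu\in P_N$, $\Psi\in P_q$, $\nu>q+1$ consider the estimators $$\widehat M_i^{\lambda,\mu}=\exp\Big(\frac{n\log\bar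 X_i+\lambda\log\mu}{\lambda+n}\Big),\qquad \widehat\Sigma_i^{\Psi,\nu}=\frac{\Psi+S_i}{\nu+n-q-2},$$ the loss $L_p=p^{-1}\sum_{i=1}^p d_{LE}^2(\widehat M_i,M_i)+p^{-1}\sum_{i=1}^p\|\widehat\Sigma_i-\Sigma_i\|^2$, the risk $R_p=E\,L_p$, and $$\mathrm{SURE}_p(\lambda,\Psi,\nu,\mu)=p^{-1}\sum_{i=1}^p\Big\{(\lambda+n)^{-2}\Big[\tfrac{n-\lambda^2/n}{n-1}\operatorname{tr}S_i+\lambda^2d_{LE}^2(\bar X_i,\mu)\Big]+(\nu+n-q-2)^{-2}\Big[\tfrac{n-3+(\nu-q-1)^2}{(n+1)(n-2)}\operatorname{tr}(S_i^2)+\tfrac{(n-1)^2-(\nu-q-1)^2}{(n-1)(n+1)(n-2)}(\operatorname{tr}S_i)^2-2\tfrac{\nu-q-1}{n-1}\operatorname{tr}(\Psi S_i)+\operatorname{tr}(\Psi^2)\Big]\Big\}.$$ Assume (i) $\limsup_{p\to\infty}p^{-1}\sum_{i=1}^p(\operatorname{tr}\Sigma_i)^4<\infty$; (ii) $\limsup_{p\to\infty}p^{-1}\sum_{i=1}^p\widetilde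 M_i^T\Sigma_i\widetilde M_i<\infty$; (iii) $\limsup_{p\to\infty}p^{-1}\sum_{i=1}^p\|\log M_i\|^{2+\delta}<\infty$ for some $\delta>0$. Let $\hat\theta_p=(\hat\lambda_p,\hat\mu_p,\hat\Psi_p,\hat\nu_p)$, $p\ge1$, be random hyperparameters (measurable) that almost surely minimize $\mathrm{SURE}_p$ up to $\varepsilon_p$, where $\varepsilon_p\to0$ is deterministic ($\varepsilon_p=0$ for exact minimizers); the minimization is, for all $p$, either over all hyperparameters $\lambda>0$, $\nu>q+1$, $\mu\in P_N$, $\Psi\in P_q$, or, for all $p$, over those among them with $\|\Psi\|\le\max_{i\le p}\|S_i\|$ and $\|\log\mu\|\le\max_{i\le p}\|\log\bar X_i\|$. Let $(\widehat{\boldsymbol M}^{\mathrm{SURE}},\widehat{\boldsymbol\Sigma}^{\mathrm{SURE}})$ be the estimators with $\hat\theta_p$ plugged in. Then, for every fixed $\lambda>0$, $\mu\in P_N$, $\Psi\in P_q$, $\nu>q+1$, the losses of both estimators are integrable for all $p\ge1$, and $$\limsup_{p\to\infty}\Big[R_p\big(\widehat{\boldsymbol M}^{\mathrm{SURE}},\widehat{\boldsymbol\Sigma}^{\mathrm{SURE}}\big)-R_p\big(\widehat{\boldsymbol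 M}^{\lambda,\mu},\widehat{\boldsymbol\Sigma}^{\Psi,\nu}\big)\Big]\le0 .$$ -/

import Mathlib

open MeasureTheory ProbabilityTheory Filter Topology Matrix

noncomputable section

namespace LogNormalSure

/-! ### Symmetric positive definite matrices and the Log-Euclidean distance -/

/-- The index set of the coordinates of a symmetric `N × N` matrix: the pairs `i ≤ j`. -/
abbrev Idx (N : ℕ) : Type := {ij : Fin N × Fin N // ij.1 ≤ ij.2}

/-- The dimension `q = N (N + 1) / 2` of the space of symmetric `N × N` matrices. -/
def q (N : ℕ) : ℕ := N * (N + 1) / 2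

/-- `q N` is the number of coordinates. -/
theorem card_idx (N : ℕ) : Fintype.card (Idx N) = q N := by
  have h : Fintype.card (Idx N) = ∑ j : Fin N, ((j : ℕ) + 1) := by
    rw [Fintype.card_subtype, Finset.card_filter, Fintype.sum_prod_type_right]
    refine Finset.sum_congr rfl fun j _ => ?_
    simp only [← Finset.card_filter]
    rw [show (Finset.univ.filter fun i : Fin N => i ≤ j) = Finset.Iic j by ext; simp]
    simp
  have h2 : ∀ k : ℕ, (∑ j ∈ Finset.range k, (j + 1)) * 2 = k * (k + 1) := by
    intro k
    induction k with
    | zero => simp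
    | succ k ih => rw [Finset.sum_range_succ, add_mul, ih]; ring
  have h3 := h2 N
  rw [h, Fin.sum_univ_eq_sum_range (fun j => j + 1) N]
  unfold q
  omega

/-- Matrices carry the product (that is, Borel) sigma-algebra of their entries. -/
instance instMeasurableSpaceMatrix {ι κ : Type*} : MeasurableSpace (Matrix ι κ ℝ) :=
  inferInstanceAs (MeasurableSpace (ι → κ → ℝ))

/-- The Frobenius norm. -/
def frob {ι : Type*} [Fintype ι] (A : Matrix ι ι ℝ) : ℝ := √(∑ i, ∑ j, A i j ^ 2)

/-- The matrix logarithm of a symmetric matrix, `U diag(log dₖ) Uᵀ` for `A = U diag(dₖ) Uᵀ`. It is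
applied only to positive definite matrices. -/
def logm {N : ℕ} (A : Matrix (Fin N) (Fin N) ℝ) : Matrix (Fin N) (Fin N) ℝ := cfc Real.log A

/-- The Log-Euclidean distance. -/
def dLE {N : ℕ} (A B : Matrix (Fin N) (Fin N) ℝ) : ℝ := frob (logm A - logm B)

/-- The isometry `vec` from symmetric matrices (with the Frobenius norm) to Euclidean space:
diagonal entries, and off-diagonal entries times `√2`. -/
def symVec {N : ℕ} (Y : Matrix (Fin N) (Fin N) ℝ) : EuclideanSpace ℝ (Idx N) :=
  WithLp.toLp 2 fun ij => if ij.1.1 = ij.1.2 then Y ij.1.1 ij.1.2 else √2 * Y ij.1.1 ij.1.2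

/-- `X̃ = vec (log X)`. -/
def tilde {N : ℕ} (A : Matrix (Fin N) (Fin N) ℝ) : EuclideanSpace ℝ (Idx N) := symVec (logm A)

/-- The Log-Normal distribution `LN(M, Sig)`: `X` is a random element of the positive definite
matrices and `X̃` has the Gaussian distribution with mean `M̃` and covariance matrix `Sig`. -/
structure IsLogNormal {Ω : Type*} [MeasurableSpace Ω] {N : ℕ}
    (X : Ω → Matrix (Fin N) (Fin N) ℝ) (M : Matrix (Fin N) (Fin N) ℝ)
    (Sig : Matrix (Idx N) (Idx N) ℝ) (P : Measure Ω) : Prop where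
  measurable : Measurable X
  posDef : ∀ ω, (X ω).PosDef
  hasLaw : HasLaw (fun ω => tilde (X ω)) (multivariateGaussian (tilde M) Sig) P

/-! ### Sample statistics

A sample is a family `x i j` with `i = 0, 1, 2, …` and `j = 0, …, n - 1`. -/

/-- The sample Fréchet mean `X̄ᵢ = exp (n⁻¹ ∑ⱼ log Xᵢⱼ)`. -/
def xbar {N n : ℕ} (x : ℕ → Fin n → Matrix (Fin N) (Fin N) ℝ) (i : ℕ) :
    Matrix (Fin N) (Fin N) ℝ :=
  NormedSpace.exp ((n : ℝ)⁻¹ • ∑ j, logm (x i j))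

/-- The scatter matrix `Sᵢ = ∑ⱼ (X̃ᵢⱼ - tilde X̄ᵢ) (X̃ᵢⱼ - tilde X̄ᵢ)ᵀ`. -/
def scatter {N n : ℕ} (x : ℕ → Fin n → Matrix (Fin N) (Fin N) ℝ) (i : ℕ) :
    Matrix (Idx N) (Idx N) ℝ :=
  ∑ j, vecMulVec (tilde (x i j) - tilde (xbar x i)).ofLp (tilde (x i j) - tilde (xbar x i)).ofLp

/-! ### Hyperparameters, estimators, loss and Stein's unbiased risk estimate -/

/-- A hyperparameter vector `(λ, μ, Ψ, ν)`. -/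
@[ext]
structure Hyper (N : ℕ) where
  lam : ℝ
  mu : Matrix (Fin N) (Fin N) ℝ
  Psi : Matrix (Idx N) (Idx N) ℝ
  nu : ℝ

/-- The hyperparameters of the class of estimators: `λ > 0`, `ν > q + 1`, and `μ`, `Ψ` positive
definite. -/
def admissible (N : ℕ) : Set (Hyper N) :=
  {θ | 0 < θ.lam ∧ θ.mu.PosDef ∧ θ.Psi.PosDef ∧ (q N : ℝ) + 1 < θ.nu}

/-- The admissible hyperparameters with `‖Ψ‖ ≤ max_{i < p} ‖Sᵢ‖` and
`‖log μ‖ ≤ max_{i < p} ‖log X̄ᵢ‖`. -/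
def constrained {N n : ℕ} (p : ℕ) (x : ℕ → Fin n → Matrix (Fin N) (Fin N) ℝ) : Set (Hyper N) :=
  {θ | θ ∈ admissible N ∧ frob θ.Psi ≤ ⨆ i : Fin p, frob (scatter x i) ∧
    frob (logm θ.mu) ≤ ⨆ i : Fin p, frob (logm (xbar x i))}

/-- The estimator `exp ((n log X̄ᵢ + λ log μ) / (λ + n))` of `Mᵢ`. -/
def estM {N n : ℕ} (x : ℕ → Fin n → Matrix (Fin N) (Fin N) ℝ) (θ : Hyper N) (i : ℕ) :
    Matrix (Fin N) (Fin N) ℝ :=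
  NormedSpace.exp ((θ.lam + n)⁻¹ • ((n : ℝ) • logm (xbar x i) + θ.lam • logm θ.mu))

/-- The estimator `(Ψ + Sᵢ) / (ν + n - q - 2)` of `Σᵢ`. -/
def estSig {N n : ℕ} (x : ℕ → Fin n → Matrix (Fin N) (Fin N) ℝ) (θ : Hyper N) (i : ℕ) :
    Matrix (Idx N) (Idx N) ℝ :=
  (θ.nu + n - q N - 2)⁻¹ • (θ.Psi + scatter x i)

/-- The loss `p⁻¹ ∑ d²(M̂ᵢ, Mᵢ) + p⁻¹ ∑ ‖Σ̂ᵢ - Σᵢ‖²` over the first `p` populations. -/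
def loss {N : ℕ} (p : ℕ) (Mhat : ℕ → Matrix (Fin N) (Fin N) ℝ)
    (Sighat : ℕ → Matrix (Idx N) (Idx N) ℝ) (M : ℕ → Matrix (Fin N) (Fin N) ℝ)
    (Sig : ℕ → Matrix (Idx N) (Idx N) ℝ) : ℝ :=
  (p : ℝ)⁻¹ * ∑ i ∈ Finset.range p, dLE (Mhat i) (M i) ^ 2 +
    (p : ℝ)⁻¹ * ∑ i ∈ Finset.range p, frob (Sighat i - Sig i) ^ 2

/-- Stein's unbiased risk estimate `SURE(λ, Ψ, ν, μ)` from the first `p` populations. -/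
def sure {N n : ℕ} (p : ℕ) (x : ℕ → Fin n → Matrix (Fin N) (Fin N) ℝ) (θ : Hyper N) : ℝ :=
  (p : ℝ)⁻¹ * ∑ i ∈ Finset.range p,
    (((θ.lam + n) ^ 2)⁻¹ *
        ((n - θ.lam ^ 2 / n) / (n - 1) * (scatter x i).trace +
          θ.lam ^ 2 * dLE (xbar x i) θ.mu ^ 2) +
      ((θ.nu + n - q N - 2) ^ 2)⁻¹ *
        ((n - 3 + (θ.nu - q N - 1) ^ 2) / ((n + 1) * (n - 2)) * (scatter x i ^ 2).trace +
          (((n : ℝ) - 1) ^ 2 - (θ.nu - q N - 1) ^ 2) / ((n - 1) * (n + 1) * (n - 2)) *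
            (scatter x i).trace ^ 2 -
          2 * ((θ.nu - q N - 1) / (n - 1)) * (θ.Psi * scatter x i).trace +
          (θ.Psi ^ 2).trace))

/-- `θ` minimizes `SURE` over `K` up to `ε`; for `ε = 0` it is an exact minimizer. -/
def IsSureMin {N n : ℕ} (p : ℕ) (x : ℕ → Fin n → Matrix (Fin N) (Fin N) ℝ) (K : Set (Hyper N))
    (ε : ℝ) (θ : Hyper N) : Prop :=
  θ ∈ K ∧ ∀ θ' ∈ K, sure p x θ ≤ sure p x θ' + ε

/-- The loss of the estimators with the (possibly random) hyperparameters `θ`, as a random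
variable. -/
def lossOf {Ω : Type*} {N n : ℕ} (p : ℕ) (X : ℕ → Fin n → Ω → Matrix (Fin N) (Fin N) ℝ)
    (θ : Ω → Hyper N) (M : ℕ → Matrix (Fin N) (Fin N) ℝ)
    (Sig : ℕ → Matrix (Idx N) (Idx N) ℝ) (ω : Ω) : ℝ :=
  loss p (estM (fun i j => X i j ω) (θ ω)) (estSig (fun i j => X i j ω) (θ ω)) M Sig

/-- The risk: the expected loss. -/
def risk {Ω : Type*} [MeasurableSpace Ω] {N n : ℕ} (P : Measure Ω) (p : ℕ)
    (X : ℕ → Fin n → Ω → Matrix (Fin N) (Fin N) ℝ) (θ : Ω → Hyper N)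
    (M : ℕ → Matrix (Fin N) (Fin N) ℝ) (Sig : ℕ → Matrix (Idx N) (Idx N) ℝ) : ℝ :=
  ∫ ω, lossOf p X θ M Sig ω ∂P

/-- Random hyperparameters: each of the four components is measurable. -/
def MeasurableHyper {Ω : Type*} [MeasurableSpace Ω] {N : ℕ} (θ : Ω → Hyper N) : Prop :=
  Measurable (fun ω => (θ ω).lam) ∧ Measurable (fun ω => (θ ω).mu) ∧
    Measurable (fun ω => (θ ω).Psi) ∧ Measurable (fun ω => (θ ω).nu)

end LogNormalSure

end

/-!
In the coordinates `X ↦ vec (log X)` the data are independent Gaussian samples, the Log-Euclidean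
distance is the Euclidean one, and both estimators are linear shrinkage estimators
`(1 - a) y + a u` and `(1 - b) t + g`, where `y` is the sample mean, `t` the unbiased estimate of the covariance
matrix, `a, b ∈ [0, 1]`, and `u`, `g` are free shrinkage targets. The loss and `SURE` then are
averages over the populations of quadratic expressions in `(a, u, b, g)` (`loss_eq`, `sure_eq`),
and their difference is a combination of seven averages of independent centered terms, with
coefficients that are bounded, except for `a u` and `g` (`abs_loss_sub_sure_le`). That the terms
are centered is the unbiasedness of `SURE`, which for the covariance part rests on the second
moments of a scatter matrix, hence on the fourth moments of a Gaussian vector. Their variances are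
bounded by `momentSize`, whose averages are bounded by the assumptions, so that the sum of the
squares of the seven averages has expectation `O(1 / p)`
(`IsGaussianArray.integral_arrayNoise_le`).

To control the random targets, a near-minimizer of `SURE` is compared with the one that has
`u = 0` and half the `g`, which is also available in the constrained problem. As `SURE` is quadratic in
the targets, this bounds `‖a u‖² + ‖g‖²` by the squared norms of the averages of `y` and `t`
(`target_bound`), which are bounded in mean. Hence no uniform law of large numbers is needed: by
`x z ≤ (h x² + z² / h) / 2` with `h = √p`, the loss and `SURE` of the near-minimizer differ by
`O(p ^ (-1/2))` in mean (`loss_le_of_isSureMin`, `integral_excess_le`).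

In the constrained problem the competitor `θ` need not be allowed. Contracting `log μ` to the ball
of radius `max ‖log X̄ᵢ‖` does not increase `SURE`, because the ball contains the average of the
`log X̄ᵢ`. Contracting `Ψ` is necessary only on the event that all the scatter matrices are
smaller than `‖Ψ‖`, and costs at most a multiple of the average scatter matrix on that event
(`exists_constrained_sure_le`). The expectation of the latter tends to zero
(`IsGaussianArray.tendsto_integral_truncScatter`): a scatter matrix that is large in mean exceeds
`‖Ψ‖` with a probability that is bounded below, and by independence this then has to happen for
one of the populations.
-/

noncomputable section

namespace LogNormalSure

open scoped RealInnerProductSpace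

/-! ### Averages, losses and risk estimates in Hilbert spaces -/

/-- The average of the first `p` terms of a sequence of vectors. -/
def avg {V : Type*} [AddCommGroup V] [Module ℝ V] (p : ℕ) (f : ℕ → V) : V :=
  (p : ℝ)⁻¹ • ∑ i ∈ Finset.range p, f i

section avg

variable {V : Type*} [AddCommGroup V] [Module ℝ V]

theorem avg_add (p : ℕ) (f g : ℕ → V) : avg p (fun i => f i + g i) = avg p f + avg p g := by
  simp [avg, Finset.sum_add_distrib]

theorem avg_sub (p : ℕ) (f g : ℕ → V) : avg p (fun i => f i - g i) = avg p f - avg p g := by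
  simp [avg, smul_sub]

theorem avg_smul (p : ℕ) (c : ℝ) (f : ℕ → V) : avg p (fun i => c • f i) = c • avg p f := by
  simp only [avg, ← Finset.smul_sum]; rw [smul_comm]

theorem avg_mul (p : ℕ) (c : ℝ) (f : ℕ → ℝ) : avg p (fun i => c * f i) = c * avg p f :=
  avg_smul p c f

theorem avg_const {p : ℕ} (hp : 0 < p) (v : V) : avg p (fun _ => v) = v := by
  have : (p : ℝ) ≠ 0 := by positivity
  simp only [avg, Finset.sum_const, Finset.card_range, ← Nat.cast_smul_eq_nsmul ℝ, smul_smul]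
  rw [inv_mul_cancel₀ this, one_smul]

theorem avg_mono {p : ℕ} {f g : ℕ → ℝ} (h : ∀ i, f i ≤ g i) : avg p f ≤ avg p g := by
  simp only [avg]
  gcongr with i _
  exact h i

theorem avg_nonneg {p : ℕ} {f : ℕ → ℝ} (h : ∀ i, 0 ≤ f i) : 0 ≤ avg p f := by
  simp only [avg]
  exact smul_nonneg (by positivity) (Finset.sum_nonneg fun i _ => h i)

variable {E : Type*} [NormedAddCommGroup E] [InnerProductSpace ℝ E]

theorem inner_avg (p : ℕ) (u : E) (f : ℕ → E) : ⟪u, avg p f⟫ = avg p (fun i => ⟪u, f i⟫) := by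
  simp [avg, inner_smul_right, inner_sum]

theorem norm_avg_le (p : ℕ) (f : ℕ → E) : ‖avg p f‖ ≤ avg p (fun i => ‖f i‖) := by
  simp only [avg, norm_smul, norm_inv, RCLike.norm_natCast, smul_eq_mul]
  gcongr
  exact norm_sum_le _ _

theorem norm_avg_sq_le (p : ℕ) (f : ℕ → E) : ‖avg p f‖ ^ 2 ≤ avg p (fun i => ‖f i‖ ^ 2) := by
  rcases Nat.eq_zero_or_pos p with rfl | hp
  · simp [avg]
  have h : 0 ≤ avg p (fun i => ‖f i - avg p f‖ ^ 2) := avg_nonneg fun i => by positivity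
  have e : ∀ i, ‖f i - avg p f‖ ^ 2 = ‖f i‖ ^ 2 - 2 * ⟪avg p f, f i⟫ + ‖avg p f‖ ^ 2 := fun i => by
    rw [norm_sub_sq_real, real_inner_comm]
  simp only [e, avg_add, avg_sub, avg_mul, avg_const hp, ← inner_avg, real_inner_self_eq_norm_sq] at h
  linarith

end avg

section Hilbert

variable {E F : Type*} [NormedAddCommGroup E] [InnerProductSpace ℝ E]
  [NormedAddCommGroup F] [InnerProductSpace ℝ F]

/-- The loss of one population, for the linear shrinkage estimators `(1 - a) y + a u` of the mean
`m` and `(1 - b) t + g` of the (flattened) covariance `σ`. -/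
def lossTerm (a : ℝ) (u : E) (b : ℝ) (g : F) (y m : E) (t σ : F) : ℝ :=
  ‖(1 - a) • y + a • u - m‖ ^ 2 + ‖(1 - b) • t + g - σ‖ ^ 2

/-- The unbiased estimate of the expectation of `lossTerm`. The numbers `τ`, `V`, `W` are to be
unbiased estimates of `E ‖y - m‖²`, `E ‖t - σ‖²` and `‖σ‖²`. -/
def sureTerm (a : ℝ) (u : E) (b : ℝ) (g : F) (y : E) (t : F) (τ V W : ℝ) : ℝ :=
  ((1 - 2 * a) * τ + a ^ 2 * ‖y - u‖ ^ 2) +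
    (‖g‖ ^ 2 - 2 * b * ⟪g, t⟫ + (1 - b) ^ 2 * V + b ^ 2 * W)

theorem norm_smul_add_sq_le {c : ℝ} (hc : c ∈ Set.Icc (0 : ℝ) 1) (v w : E) :
    ‖(1 - c) • v + w‖ ^ 2 ≤ 2 * ‖v‖ ^ 2 + 2 * ‖w‖ ^ 2 := by
  have h1 : ‖(1 - c) • v + w‖ ≤ ‖v‖ + ‖w‖ := by
    refine (norm_add_le _ _).trans (add_le_add_left ?_ _)
    rw [norm_smul, Real.norm_of_nonneg (by linarith [hc.2])]
    exact mul_le_of_le_one_left (norm_nonneg _) (by linarith [hc.1])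
  nlinarith [norm_nonneg ((1 - c) • v + w), norm_nonneg v, norm_nonneg w, sq_nonneg (‖v‖ - ‖w‖)]

theorem lossTerm_le {a b : ℝ} (ha : a ∈ Set.Icc (0 : ℝ) 1) (hb : b ∈ Set.Icc (0 : ℝ) 1)
    (u : E) (g : F) (y m : E) (t σ : F) :
    lossTerm a u b g y m t σ ≤
      2 * ‖y‖ ^ 2 + 2 * ‖a • u - m‖ ^ 2 + (2 * ‖t‖ ^ 2 + 2 * ‖g - σ‖ ^ 2) := by
  rw [lossTerm, add_sub_assoc, add_sub_assoc]
  exact add_le_add (norm_smul_add_sq_le ha _ _) (norm_smul_add_sq_le hb _ _)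

variable (y m : ℕ → E) (t σ : ℕ → F) (τ V W : ℕ → ℝ)

/-- The sum of the squares of the seven averaged noise terms of which the difference between the
loss and its unbiased estimate is composed. -/
def noiseSq (p : ℕ) : ℝ :=
  avg p (fun i => ‖y i - m i‖ ^ 2 - τ i) ^ 2 + avg p (fun i => ⟪y i - m i, y i⟫ - τ i) ^ 2 +
    ‖avg p (fun i => y i - m i)‖ ^ 2 + ‖avg p (fun i => t i - σ i)‖ ^ 2 +
    avg p (fun i => ‖t i‖ ^ 2 - V i - ‖σ i‖ ^ 2) ^ 2 +
    avg p (fun i => ⟪t i, σ i⟫ - ‖σ i‖ ^ 2) ^ 2 + avg p (fun i => W i - ‖σ i‖ ^ 2) ^ 2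

theorem lossTerm_sub_sureTerm (a : ℝ) (u : E) (b : ℝ) (g : F) (y m : E) (t σ : F) (τ V W : ℝ) :
    lossTerm a u b g y m t σ - sureTerm a u b g y t τ V W =
      (‖y - m‖ ^ 2 - τ) - 2 * a * (⟪y - m, y⟫ - τ) + 2 * ⟪a • u, y - m⟫ + 2 * ⟪g, t - σ⟫ +
        (1 - b) ^ 2 * (‖t‖ ^ 2 - V - ‖σ‖ ^ 2) - 2 * (1 - b) * (⟪t, σ⟫ - ‖σ‖ ^ 2) -
        b ^ 2 * (W - ‖σ‖ ^ 2) := by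
  simp only [lossTerm, sureTerm, ← real_inner_self_eq_norm_sq, inner_add_left, inner_add_right,
    inner_sub_left, inner_sub_right, real_inner_smul_left, real_inner_smul_right]
  rw [real_inner_comm u y, real_inner_comm m y, real_inner_comm m u, real_inner_comm g t,
    real_inner_comm σ t, real_inner_comm σ g]
  ring

/-- Up to the bounded factors `a`, `b`, the loss and its unbiased estimate differ by averages of
centered terms, and only the shrinkage targets `a u` and `g` enter with unbounded factors. -/
theorem abs_loss_sub_sure_le {p : ℕ} {a : ℝ} (u : E) {b : ℝ} (g : F) {h : ℝ} (hh : 0 < h)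
    (ha : a ∈ Set.Icc (0 : ℝ) 1) (hb : b ∈ Set.Icc (0 : ℝ) 1) :
    |avg p (fun i => lossTerm a u b g (y i) (m i) (t i) (σ i)) -
      avg p (fun i => sureTerm a u b g (y i) (t i) (τ i) (V i) (W i))| ≤
      h * noiseSq y m t σ τ V W p + h⁻¹ * (4 + ‖a • u‖ ^ 2 + ‖g‖ ^ 2) := by
  rw [← avg_sub]
  simp only [lossTerm_sub_sureTerm, avg_sub (V := ℝ), avg_add, avg_mul, ← inner_avg]
  rw [noiseSq]
  simp only [avg_sub (V := ℝ)]
  generalize avg p (fun i => ‖y i - m i‖ ^ 2) - avg p τ = z0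
  generalize avg p (fun i => ⟪y i - m i, y i⟫) - avg p τ = z1
  generalize avg p (fun i => ‖t i‖ ^ 2) - avg p V - avg p (fun i => ‖σ i‖ ^ 2) = c0
  generalize avg p (fun i => ⟪t i, σ i⟫) - avg p (fun i => ‖σ i‖ ^ 2) = c1
  generalize avg p W - avg p (fun i => ‖σ i‖ ^ 2) = c2
  generalize avg p (fun i => y i - m i) = w
  generalize avg p (fun i => t i - σ i) = v
  have amgm : ∀ x z : ℝ, 2 * |x * z| ≤ h * x ^ 2 + h⁻¹ * z ^ 2 := fun x z => by
    have h1 : 0 ≤ h⁻¹ * (h * |x| - |z|) ^ 2 := by positivity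
    have h2 : h⁻¹ * (h * |x| - |z|) ^ 2 = h * |x| ^ 2 + h⁻¹ * |z| ^ 2 - 2 * (|x| * |z|) := by
      field_simp
      ring
    rw [abs_mul]
    rw [h2, sq_abs, sq_abs] at h1
    linarith
  have coef : ∀ c x : ℝ, |c| ≤ 1 → |c * x| ≤ |x| := fun c x hc => by
    rw [abs_mul]; exact mul_le_of_le_one_left (abs_nonneg _) hc
  have ha1 : |a| ≤ 1 := abs_le.2 ⟨by linarith [ha.1], ha.2⟩
  have hb1 : |1 - b| ≤ 1 := abs_le.2 ⟨by linarith [hb.2], by linarith [hb.1]⟩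
  have hb2 : |(1 - b) ^ 2| ≤ 1 := by rw [abs_pow]; exact pow_le_one₀ (abs_nonneg _) hb1
  have hb3 : |b ^ 2| ≤ 1 := by
    rw [abs_pow]; exact pow_le_one₀ (abs_nonneg _) (abs_le.2 ⟨by linarith [hb.1], hb.2⟩)
  have e0 := amgm z0 1
  have e1 := amgm z1 1
  have e2 := amgm c0 1
  have e3 := amgm c1 1
  have e4 := amgm c2 1
  have e5 := amgm ‖w‖ ‖a • u‖
  have e6 := amgm ‖v‖ ‖g‖
  rw [abs_of_nonneg (by positivity)] at e5 e6
  simp only [mul_one, one_pow] at e0 e1 e2 e3 e4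
  have f1 := coef a z1 ha1
  have f2 := coef _ c0 hb2
  have f3 := coef _ c1 hb1
  have f4 := coef _ c2 hb3
  have f5 := abs_real_inner_le_norm (a • u) w
  have f6 := abs_real_inner_le_norm g v
  rw [abs_le] at f1 f2 f3 f4 f5 f6
  have z0' := abs_le.1 (le_refl |z0|)
  have hpos : 0 < h⁻¹ := by positivity
  have q0 : 0 ≤ h * z0 ^ 2 := by positivity
  have q2 : 0 ≤ h * c0 ^ 2 := by positivity
  have q4 : 0 ≤ h * c2 ^ 2 := by positivity
  rw [abs_le]
  constructor <;> nlinarith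

/-- The effect on the risk estimate of rescaling the shrinkage targets. -/
theorem sure_scale {p : ℕ} (hp : 0 < p) (a : ℝ) (u : E) (b : ℝ) (g : F) (r s : ℝ) :
    avg p (fun i => sureTerm a (r • u) b (s • g) (y i) (t i) (τ i) (V i) (W i)) =
      avg p (fun i => sureTerm a u b g (y i) (t i) (τ i) (V i) (W i)) +
        (a ^ 2 * ((r ^ 2 - 1) * ‖u‖ ^ 2 + 2 * (1 - r) * ⟪u, avg p y⟫) +
          ((s ^ 2 - 1) * ‖g‖ ^ 2 + 2 * b * (1 - s) * ⟪g, avg p t⟫)) := by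
  rw [← sub_eq_iff_eq_add', ← avg_sub]
  have e : ∀ i, sureTerm a (r • u) b (s • g) (y i) (t i) (τ i) (V i) (W i) -
      sureTerm a u b g (y i) (t i) (τ i) (V i) (W i) =
      a ^ 2 * ((r ^ 2 - 1) * ‖u‖ ^ 2) + a ^ 2 * (2 * (1 - r)) * ⟪u, y i⟫ +
        ((s ^ 2 - 1) * ‖g‖ ^ 2 + 2 * b * (1 - s) * ⟪g, t i⟫) := fun i => by
    simp only [sureTerm, ← real_inner_self_eq_norm_sq, inner_sub_left, inner_sub_right,
      real_inner_smul_left, real_inner_smul_right]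
    rw [real_inner_comm u (y i)]
    ring
  simp only [e, avg_add, avg_mul, avg_const hp, ← inner_avg]
  ring

/-- The shrinkage targets of a near-minimizer of the risk estimate are controlled by the averages
of the data: otherwise setting `u = 0` and halving `g` would be a substantial improvement. -/
theorem target_bound {p : ℕ} (hp : 0 < p) {a : ℝ} {u : E} {b : ℝ} {g : F} {ε : ℝ}
    (ha : a ∈ Set.Icc (0 : ℝ) 1) (hb : b ∈ Set.Icc (0 : ℝ) 1)
    (hmin : avg p (fun i => sureTerm a u b g (y i) (t i) (τ i) (V i) (W i)) ≤
      avg p (fun i => sureTerm a ((0 : ℝ) • u) b ((1 / 2 : ℝ) • g) (y i) (t i) (τ i) (V i) (W i))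
        + ε) :
    ‖a • u‖ ^ 2 + ‖g‖ ^ 2 ≤ 4 * ‖avg p y‖ ^ 2 + 2 * ‖avg p t‖ ^ 2 + 2 * ε := by
  rw [sure_scale y t τ V W hp] at hmin
  have f1 := real_inner_le_norm (a • u) (avg p y)
  have f2 := real_inner_le_norm g (avg p t)
  have e1 : a ^ 2 * ⟪u, avg p y⟫ = a * ⟪a • u, avg p y⟫ := by rw [real_inner_smul_left]; ring
  have e2 : ‖a • u‖ ^ 2 = a ^ 2 * ‖u‖ ^ 2 := by rw [norm_smul, mul_pow, Real.norm_eq_abs, sq_abs]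
  have g1 : a * ⟪a • u, avg p y⟫ ≤ ‖a • u‖ * ‖avg p y‖ := by
    refine (mul_le_mul_of_nonneg_left f1 ha.1).trans ?_
    exact mul_le_of_le_one_left (by positivity) ha.2
  have g2 : b * ⟪g, avg p t⟫ ≤ ‖g‖ * ‖avg p t‖ := by
    refine (mul_le_mul_of_nonneg_left f2 hb.1).trans ?_
    exact mul_le_of_le_one_left (by positivity) hb.2
  nlinarith [sq_nonneg (‖a • u‖ - 2 * ‖avg p y‖), sq_nonneg (‖g‖ - 2 * ‖avg p t‖)]

/-- Projecting `u` to a ball around `0` that contains the average of the data does not increase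
the risk estimate, and contracting `g` can increase it only in proportion to the average `t`. -/
theorem sure_contract_le {p : ℕ} (hp : 0 < p) (a : ℝ) (u : E) {b : ℝ} (g : F) {r s R : ℝ}
    (hb : b ∈ Set.Icc (0 : ℝ) 1) (hr : r ∈ Set.Icc (0 : ℝ) 1) (hs : s ∈ Set.Icc (0 : ℝ) 1)
    (hy : ‖avg p y‖ ≤ R) (hrR : r = 1 ∨ r * ‖u‖ = R) :
    avg p (fun i => sureTerm a (r • u) b (s • g) (y i) (t i) (τ i) (V i) (W i)) ≤
      avg p (fun i => sureTerm a u b g (y i) (t i) (τ i) (V i) (W i)) +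
        2 * (1 - s) * (‖g‖ * ‖avg p t‖) := by
  rw [sure_scale y t τ V W hp]
  have h1 : (r ^ 2 - 1) * ‖u‖ ^ 2 + 2 * (1 - r) * ⟪u, avg p y⟫ ≤ 0 := by
    rcases hrR with rfl | h
    · simp
    have f1 : ⟪u, avg p y⟫ ≤ ‖u‖ * (r * ‖u‖) := by
      rw [h]
      exact (real_inner_le_norm _ _).trans (by gcongr)
    have h2 : 2 * (1 - r) * ⟪u, avg p y⟫ ≤ 2 * (1 - r) * (‖u‖ * (r * ‖u‖)) :=
      mul_le_mul_of_nonneg_left f1 (by linarith [hr.2])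
    nlinarith [mul_nonneg (sq_nonneg (1 - r)) (sq_nonneg ‖u‖)]
  have h2 : b * ⟪g, avg p t⟫ ≤ ‖g‖ * ‖avg p t‖ := by
    refine (mul_le_mul_of_nonneg_left (real_inner_le_norm _ _) hb.1).trans ?_
    exact mul_le_of_le_one_left (by positivity) hb.2
  have h3 : (s ^ 2 - 1) * ‖g‖ ^ 2 ≤ 0 :=
    mul_nonpos_of_nonpos_of_nonneg (by nlinarith [hs.1, hs.2]) (by positivity)
  have h4 := mul_le_mul_of_nonneg_left h2 (by linarith [hs.2] : 0 ≤ 2 * (1 - s))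
  have h5 := mul_nonpos_of_nonneg_of_nonpos (sq_nonneg a) h1
  linarith

end Hilbert

/-! ### The vector forms of symmetric matrices and of covariance matrices -/

section vec

variable {N : ℕ}

theorem symVec_add (A B : Matrix (Fin N) (Fin N) ℝ) : symVec (A + B) = symVec A + symVec B := by
  ext ij
  simp only [symVec, Matrix.add_apply, PiLp.add_apply]
  split_ifs <;> ring

theorem symVec_smul (c : ℝ) (A : Matrix (Fin N) (Fin N) ℝ) : symVec (c • A) = c • symVec A := by
  ext ij
  simp only [symVec, Matrix.smul_apply, PiLp.smul_apply, smul_eq_mul]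
  split_ifs <;> ring

theorem symVec_sub (A B : Matrix (Fin N) (Fin N) ℝ) : symVec (A - B) = symVec A - symVec B := by
  rw [sub_eq_add_neg, ← neg_one_smul ℝ B, symVec_add, symVec_smul, neg_one_smul, ← sub_eq_add_neg]

theorem symVec_sum {κ : Type*} (s : Finset κ) (f : κ → Matrix (Fin N) (Fin N) ℝ) :
    symVec (∑ j ∈ s, f j) = ∑ j ∈ s, symVec (f j) := by
  classical
  induction s using Finset.induction_on with
  | empty =>
    have := symVec_smul (0 : ℝ) (0 : Matrix (Fin N) (Fin N) ℝ)
    simpa using this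
  | insert j s hj ih => rw [Finset.sum_insert hj, Finset.sum_insert hj, symVec_add, ih]

/-- `symVec` is an isometry on symmetric matrices. -/
theorem norm_symVec {A : Matrix (Fin N) (Fin N) ℝ} (hA : A.IsHermitian) : ‖symVec A‖ = frob A := by
  rw [EuclideanSpace.norm_eq, frob]
  congr 1
  have hs : ∀ i j, A j i = A i j := fun i j => by simpa using hA.apply i j
  have e : ∀ ij : Idx N, ‖symVec A ij‖ ^ 2 =
      if ij.1.1 = ij.1.2 then A ij.1.1 ij.1.2 ^ 2 else 2 * A ij.1.1 ij.1.2 ^ 2 := fun ij => by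
    rw [Real.norm_eq_abs, sq_abs]
    simp only [symVec]
    split_ifs
    · rfl
    · rw [mul_pow, Real.sq_sqrt (by norm_num)]
  simp only [e]
  -- the entries above and below the diagonal contribute equally
  have tri : ∀ i j : Fin N, A i j ^ 2 = (if i ≤ j then if i = j then A i j ^ 2 else A i j ^ 2 else 0) +
      (if j ≤ i then if j = i then 0 else A j i ^ 2 else 0) := fun i j => by
    rcases lt_trichotomy i j with h | rfl | h
    · rw [if_pos h.le, if_neg h.ne, if_neg h.not_ge, add_zero]
    · simp
    · rw [if_neg h.not_ge, if_pos h.le, if_neg h.ne, zero_add, hs i j]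
  have e2 : ∑ i, ∑ j, A i j ^ 2 = ∑ i, ∑ j, (if i ≤ j then
      (if i = j then A i j ^ 2 else 2 * A i j ^ 2) else 0) := by
    rw [Finset.sum_congr rfl fun i _ => Finset.sum_congr rfl fun j _ => tri i j]
    simp_rw [Finset.sum_add_distrib]
    rw [Finset.sum_comm (f := fun i j => if j ≤ i then if j = i then 0 else A j i ^ 2 else 0)]
    simp_rw [← Finset.sum_add_distrib]
    refine Finset.sum_congr rfl fun i _ => Finset.sum_congr rfl fun j _ => ?_
    split_ifs <;> ring
  rw [e2, ← Fintype.sum_prod_type']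
  rw [← Finset.sum_filter]
  exact (Finset.sum_subtype _ (by simp) (fun ij : Fin N × Fin N =>
    if ij.1 = ij.2 then A ij.1 ij.2 ^ 2 else 2 * A ij.1 ij.2 ^ 2)).symm

variable {ι : Type*}

/-- The entries of a matrix as a vector of Euclidean space. -/
def flat (A : Matrix ι ι ℝ) : EuclideanSpace ℝ (ι × ι) := WithLp.toLp 2 fun ab => A ab.1 ab.2

@[simp]
theorem flat_apply (A : Matrix ι ι ℝ) (ab : ι × ι) : flat A ab = A ab.1 ab.2 := rfl

theorem flat_add (A B : Matrix ι ι ℝ) : flat (A + B) = flat A + flat B := rfl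

theorem flat_sub (A B : Matrix ι ι ℝ) : flat (A - B) = flat A - flat B := rfl

theorem flat_smul (c : ℝ) (A : Matrix ι ι ℝ) : flat (c • A) = c • flat A := rfl

variable [Fintype ι]

theorem norm_flat (A : Matrix ι ι ℝ) : ‖flat A‖ = frob A := by
  rw [EuclideanSpace.norm_eq, frob, ← Fintype.sum_prod_type']
  simp

theorem frob_nonneg (A : Matrix ι ι ℝ) : 0 ≤ frob A := Real.sqrt_nonneg _

theorem inner_flat {A : Matrix ι ι ℝ} (hA : A.IsHermitian) (B : Matrix ι ι ℝ) :
    ⟪flat A, flat B⟫ = (A * B).trace := by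
  rw [PiLp.inner_apply, Fintype.sum_prod_type, Matrix.trace, Finset.sum_comm]
  refine Finset.sum_congr rfl fun b _ => ?_
  rw [Matrix.diag_apply, Matrix.mul_apply]
  refine Finset.sum_congr rfl fun a _ => ?_
  have : A b a = A a b := by simpa using hA.apply a b
  simp [this, mul_comm]

theorem norm_flat_sq [DecidableEq ι] {A : Matrix ι ι ℝ} (hA : A.IsHermitian) :
    ‖flat A‖ ^ 2 = (A ^ 2).trace := by
  rw [← real_inner_self_eq_norm_sq, inner_flat hA, pow_two]

end vec

/-! ### The matrix logarithm -/

section log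

variable {N : ℕ}

theorem isHermitian_logm (A : Matrix (Fin N) (Fin N) ℝ) : (logm A).IsHermitian :=
  cfc_predicate Real.log A

theorem isHermitian_smul {κ : Type*} {A : Matrix κ κ ℝ} (hA : A.IsHermitian) (c : ℝ) :
    (c • A).IsHermitian := by
  rw [Matrix.IsHermitian, Matrix.conjTranspose_smul, hA.eq, star_trivial]

theorem isHermitian_sum {κ : Type*} {s : Finset κ} {f : κ → Matrix (Fin N) (Fin N) ℝ}
    (h : ∀ j, (f j).IsHermitian) : (∑ j ∈ s, f j).IsHermitian := by
  rw [Matrix.IsHermitian, Matrix.conjTranspose_sum]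
  exact Finset.sum_congr rfl fun j _ => (h j).eq

open scoped Matrix.Norms.L2Operator MatrixOrder in
theorem logm_exp {A : Matrix (Fin N) (Fin N) ℝ} (hA : A.IsHermitian) :
    logm (NormedSpace.exp A) = A :=
  CFC.log_exp A hA

open scoped Matrix.Norms.L2Operator MatrixOrder in
theorem posDef_exp {A : Matrix (Fin N) (Fin N) ℝ} (hA : A.IsHermitian) :
    (NormedSpace.exp A).PosDef := by
  have h1 : 0 ≤ NormedSpace.exp A := IsSelfAdjoint.exp_nonneg hA
  have h2 : IsUnit (NormedSpace.exp A) := Matrix.isUnit_exp A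
  rw [Matrix.nonneg_iff_posSemidef] at h1
  exact h1.posDef_iff_isUnit.2 h2

theorem frob_logm (A : Matrix (Fin N) (Fin N) ℝ) : frob (logm A) = ‖tilde A‖ :=
  (norm_symVec (isHermitian_logm A)).symm

theorem dLE_eq (A B : Matrix (Fin N) (Fin N) ℝ) : dLE A B = ‖tilde A - tilde B‖ := by
  rw [dLE, tilde, tilde, ← symVec_sub, norm_symVec ((isHermitian_logm A).sub (isHermitian_logm B))]

instance instBorelSpaceMatrix {κ : Type*} [Countable κ] : BorelSpace (Matrix κ κ ℝ) :=
  inferInstanceAs (BorelSpace (κ → κ → ℝ))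

open Classical in
/-- A measurable function that agrees with `tilde` on positive definite matrices. -/
def tildeM (A : Matrix (Fin N) (Fin N) ℝ) : EuclideanSpace ℝ (Idx N) :=
  symVec ({A : Matrix (Fin N) (Fin N) ℝ | IsSelfAdjoint A ∧ IsUnit A}.piecewise logm 0 A)

theorem tildeM_of_posDef {A : Matrix (Fin N) (Fin N) ℝ} (hA : A.PosDef) : tildeM A = tilde A := by
  have h : A ∈ {A : Matrix (Fin N) (Fin N) ℝ | IsSelfAdjoint A ∧ IsUnit A} := ⟨hA.1, hA.isUnit⟩
  classical
  rw [tildeM, tilde, Set.piecewise_eq_of_mem _ _ _ h]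

theorem continuous_symVec : Continuous (symVec (N := N)) := by
  unfold symVec
  refine (PiLp.continuous_toLp 2 _).comp (continuous_pi fun ij => ?_)
  split_ifs <;> fun_prop

open scoped Matrix.Norms.L2Operator in
theorem continuousOn_logm : ContinuousOn (logm (N := N)) {A | IsSelfAdjoint A ∧ IsUnit A} :=
  CFC.continuousOn_log

theorem measurable_tildeM : Measurable (tildeM (N := N)) := by
  classical
  have hT : MeasurableSet {A : Matrix (Fin N) (Fin N) ℝ | IsSelfAdjoint A ∧ IsUnit A} := by
    refine MeasurableSet.inter (isClosed_eq (by fun_prop) (by fun_prop)).measurableSet ?_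
    have h : {A : Matrix (Fin N) (Fin N) ℝ | IsUnit A} = {A | A.det ≠ 0} := by
      ext A
      rw [Set.mem_ofPred_eq, Set.mem_ofPred_eq, Matrix.isUnit_iff_isUnit_det, isUnit_iff_ne_zero]
    change MeasurableSet {A : Matrix (Fin N) (Fin N) ℝ | IsUnit A}
    rw [h]
    exact (isOpen_ne_fun (by fun_prop) (by fun_prop)).measurableSet
  unfold tildeM
  refine continuous_symVec.measurable.comp ?_
  convert ContinuousOn.measurable_piecewise continuousOn_logm continuousOn_const hT (g := 0) using 1

end log

/-! ### Moments of Gaussian variables -/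

section moments

variable {Ω : Type*} [MeasurableSpace Ω] {P : Measure Ω}

/-- All absolute moments of a real random variable are finite. -/
def HasAllMoments (f : Ω → ℝ) (P : Measure Ω) : Prop := ∀ r : ℕ, MemLp f r P

namespace HasAllMoments

variable {f g : Ω → ℝ}

theorem memLp_two (hf : HasAllMoments f P) : MemLp f 2 P := hf 2

theorem integrable (hf : HasAllMoments f P) : Integrable f P := by
  have := hf 1
  rwa [Nat.cast_one, memLp_one_iff_integrable] at this

theorem add (hf : HasAllMoments f P) (hg : HasAllMoments g P) :
    HasAllMoments (fun ω => f ω + g ω) P := fun r => (hf r).add (hg r)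

theorem sub (hf : HasAllMoments f P) (hg : HasAllMoments g P) :
    HasAllMoments (fun ω => f ω - g ω) P := fun r => (hf r).sub (hg r)

theorem const [IsFiniteMeasure P] (c : ℝ) : HasAllMoments (fun _ : Ω => c) P :=
  fun _ => memLp_const c

theorem mul (hf : HasAllMoments f P) (hg : HasAllMoments g P) :
    HasAllMoments (fun ω => f ω * g ω) P := fun r => by
  have : ENNReal.HolderTriple ((2 * r : ℕ) : ENNReal) ((2 * r : ℕ) : ENNReal) (r : ENNReal) := by
    refine ⟨?_⟩
    push_cast
    rw [ENNReal.mul_inv (by simp) (by simp), ← add_mul, ENNReal.inv_two_add_inv_two, one_mul]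
  exact (hg (2 * r)).mul' (hf (2 * r))

theorem const_mul (hf : HasAllMoments f P) (c : ℝ) : HasAllMoments (fun ω => c * f ω) P :=
  fun r => (hf r).const_mul c

theorem sum {κ : Type*} {s : Finset κ} {f : κ → Ω → ℝ} (h : ∀ j, HasAllMoments (f j) P) :
    HasAllMoments (fun ω => ∑ j ∈ s, f j ω) P := fun r => memLp_finsetSum s fun j _ => h j r

theorem pow [IsFiniteMeasure P] (hf : HasAllMoments f P) (k : ℕ) :
    HasAllMoments (fun ω => f ω ^ k) P := by
  induction k with
  | zero => simpa using const 1
  | succ k ih => simpa only [pow_succ] using ih.mul hf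

end HasAllMoments

theorem hasAllMoments_of_hasGaussianLaw {f : Ω → ℝ} (h : HasGaussianLaw f P) :
    HasAllMoments f P := fun r => h.memLp (by simp)

/-- The even moments of a centered normal variable scale with the variance. -/
theorem integral_even_pow_gaussianReal (v : NNReal) (r : ℕ) :
    ∫ x, x ^ (2 * r) ∂gaussianReal 0 v = (v : ℝ) ^ r * ∫ x, x ^ (2 * r) ∂gaussianReal 0 1 := by
  have h := gaussianReal_map_const_mul (μ := 0) (v := 1) (√v)
  have hv : (NNReal.mk (√(v : ℝ) ^ 2) (sq_nonneg _)) * 1 = v := by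
    ext; simp
  rw [mul_zero, hv] at h
  rw [← h, integral_map (by fun_prop) (by fun_prop), ← integral_const_mul]
  congr 1 with x
  rw [mul_pow, pow_mul, Real.sq_sqrt v.coe_nonneg]

theorem integral_sq_gaussianReal : ∫ x, x ^ 2 ∂gaussianReal 0 1 = 1 := by
  have h : Var[fun x ↦ x; gaussianReal 0 1] = 1 := by simp
  rw [variance_of_integral_eq_zero (by fun_prop) (by simp)] at h
  exact h

theorem integral_fourth_gaussianReal : ∫ x, x ^ 4 ∂gaussianReal 0 1 = 3 := by
  -- the sum of two independent standard normal variables is normal with variance `2`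
  let Q : Measure (ℝ × ℝ) := (gaussianReal 0 1).prod (gaussianReal 0 1)
  have h1 : HasLaw (fun z : ℝ × ℝ => z.1) (gaussianReal 0 1) Q := ⟨by fun_prop, by simp [Q]⟩
  have h2 : HasLaw (fun z : ℝ × ℝ => z.2) (gaussianReal 0 1) Q := ⟨by fun_prop, by simp [Q]⟩
  have hi : IndepFun (fun z : ℝ × ℝ => z.1) (fun z : ℝ × ℝ => z.2) Q :=
    indepFun_prod (X := id) (Y := id) measurable_id measurable_id
  have m1 : HasAllMoments (fun z : ℝ × ℝ => z.1) Q :=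
    hasAllMoments_of_hasGaussianLaw h1.hasGaussianLaw
  have m2 : HasAllMoments (fun z : ℝ × ℝ => z.2) Q :=
    hasAllMoments_of_hasGaussianLaw h2.hasGaussianLaw
  have h3 : Q.map (fun z => z.1 + z.2) = gaussianReal 0 2 := by
    have := gaussianReal_add_gaussianReal_of_indepFun hi h1.map_eq h2.map_eq
    rw [add_zero, one_add_one_eq_two] at this
    exact this
  have p1 : ∀ r, ∫ z, z.1 ^ r ∂Q = ∫ x, x ^ r ∂gaussianReal 0 1 := fun r =>
    h1.integral_comp (f := fun x => x ^ r) (by fun_prop)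
  have p2 : ∀ r, ∫ z, z.2 ^ r ∂Q = ∫ x, x ^ r ∂gaussianReal 0 1 := fun r =>
    h2.integral_comp (f := fun x => x ^ r) (by fun_prop)
  have p3 : ∀ r s, ∫ z, z.1 ^ r * z.2 ^ s ∂Q =
      (∫ x, x ^ r ∂gaussianReal 0 1) * ∫ x, x ^ s ∂gaussianReal 0 1 := fun r s =>
    integral_prod_mul (fun x : ℝ => x ^ r) (fun x : ℝ => x ^ s)
  have h4 := integral_even_pow_gaussianReal 2 2
  rw [← h3, integral_map (by fun_prop) (by fun_prop)] at h4
  have e : ∀ z : ℝ × ℝ, (z.1 + z.2) ^ (2 * 2) = z.1 ^ 4 + 4 * (z.1 ^ 3 * z.2 ^ 1) +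
      6 * (z.1 ^ 2 * z.2 ^ 2) + 4 * (z.1 ^ 1 * z.2 ^ 3) + z.2 ^ 4 := fun z => by ring
  simp only [e] at h4
  have i1 := (m1.pow 4)
  have i2 := ((m1.pow 3).mul (m2.pow 1)).const_mul 4
  have i3 := ((m1.pow 2).mul (m2.pow 2)).const_mul 6
  have i4 := ((m1.pow 1).mul (m2.pow 3)).const_mul 4
  rw [integral_add (((i1.add i2).add i3).add i4).integrable (m2.pow 4).integrable,
    integral_add ((i1.add i2).add i3).integrable i4.integrable,
    integral_add (i1.add i2).integrable i3.integrable,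
    integral_add i1.integrable i2.integrable, integral_const_mul, integral_const_mul,
    integral_const_mul, p1, p2, p3, p3, p3, integral_sq_gaussianReal] at h4
  simp only [pow_one, integral_id_gaussianReal] at h4
  norm_num at h4
  linarith

/-- The even moments of a centered Gaussian variable, in terms of its second moment. -/
theorem integral_even_pow_of_hasGaussianLaw {f : Ω → ℝ} (h : HasGaussianLaw f P)
    (h0 : ∫ ω, f ω ∂P = 0) (r : ℕ) :
    ∫ ω, f ω ^ (2 * r) ∂P = (∫ ω, f ω ^ 2 ∂P) ^ r * ∫ x, x ^ (2 * r) ∂gaussianReal 0 1 := by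
  have hm := h.map_eq_gaussianReal
  rw [h0, variance_of_integral_eq_zero h.aemeasurable h0] at hm
  have e := integral_map (μ := P) (φ := f) (f := fun x => x ^ (2 * r)) h.aemeasurable (by fun_prop)
  rw [← e, hm, integral_even_pow_gaussianReal, Real.coe_toNNReal]
  exact integral_nonneg fun ω => sq_nonneg _

/-- **Isserlis' theorem** for four centered linear functions of a Gaussian vector. -/
theorem integral_mul_four {F : Type*} [NormedAddCommGroup F] [NormedSpace ℝ F] [MeasurableSpace F]
    [BorelSpace F] {G : Ω → F} (hG : HasGaussianLaw G P) (L : Fin 4 → F →L[ℝ] ℝ)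
    (h0 : ∀ i, ∫ ω, L i (G ω) ∂P = 0) :
    ∫ ω, (L 0 (G ω) * L 1 (G ω)) * (L 2 (G ω) * L 3 (G ω)) ∂P =
      (∫ ω, L 0 (G ω) * L 1 (G ω) ∂P) * (∫ ω, L 2 (G ω) * L 3 (G ω) ∂P) +
      (∫ ω, L 0 (G ω) * L 2 (G ω) ∂P) * (∫ ω, L 1 (G ω) * L 3 (G ω) ∂P) +
      (∫ ω, L 0 (G ω) * L 3 (G ω) ∂P) * (∫ ω, L 1 (G ω) * L 2 (G ω) ∂P) := by
  have hm : ∀ i, HasAllMoments (fun ω => L i (G ω)) P := fun i =>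
    hasAllMoments_of_hasGaussianLaw (hG.map_fun (L i))
  have hmm : ∀ i j, Integrable (fun ω => L i (G ω) * L j (G ω)) P := fun i j =>
    ((hm i).mul (hm j)).integrable
  -- linear combinations of the four variables
  let K : (Fin 4 → ℝ) → F →L[ℝ] ℝ := fun c => ∑ i, c i • L i
  have hK : ∀ c ω, K c (G ω) = ∑ i, c i * L i (G ω) := fun c ω => by
    simp [K]
  have hK0 : ∀ c, ∫ ω, K c (G ω) ∂P = 0 := fun c => by
    simp only [hK]
    rw [integral_finsetSum _ fun i _ => ((hm i).const_mul _).integrable]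
    simp [integral_const_mul, h0]
  have hK2 : ∀ c, ∫ ω, K c (G ω) ^ 2 ∂P =
      ∑ i, ∑ j, c i * c j * ∫ ω, L i (G ω) * L j (G ω) ∂P := fun c => by
    have e : ∀ ω, K c (G ω) ^ 2 = ∑ i, ∑ j, c i * c j * (L i (G ω) * L j (G ω)) := fun ω => by
      rw [hK, pow_two, Finset.sum_mul_sum]
      exact Finset.sum_congr rfl fun i _ => Finset.sum_congr rfl fun j _ => by ring
    simp only [e]
    rw [integral_finsetSum _ fun i _ => integrable_finsetSum _ fun j _ => (hmm i j).const_mul _]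
    refine Finset.sum_congr rfl fun i _ => ?_
    rw [integral_finsetSum _ fun j _ => (hmm i j).const_mul _]
    simp only [integral_const_mul]
  have hK4 : ∀ c, ∫ ω, K c (G ω) ^ 4 ∂P = 3 * (∫ ω, K c (G ω) ^ 2 ∂P) ^ 2 := fun c => by
    rw [integral_even_pow_of_hasGaussianLaw (hG.map_fun (K c)) (hK0 c) 2,
      integral_fourth_gaussianReal, mul_comm]
  have hKm : ∀ c, HasAllMoments (fun ω => K c (G ω) ^ 4) P := fun c => by
    have := (hG.map_fun (K c)).isProbabilityMeasure
    exact (hasAllMoments_of_hasGaussianLaw (hG.map_fun (K c))).pow 4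
  -- polarization
  have pol : ∀ ω, (L 0 (G ω) * L 1 (G ω)) * (L 2 (G ω) * L 3 (G ω)) = (1 / 192) *
      (K ![1, 1, 1, 1] (G ω) ^ 4 - K ![1, 1, 1, -1] (G ω) ^ 4 - K ![1, 1, -1, 1] (G ω) ^ 4
        - K ![1, -1, 1, 1] (G ω) ^ 4 + K ![1, 1, -1, -1] (G ω) ^ 4 + K ![1, -1, 1, -1] (G ω) ^ 4
        + K ![1, -1, -1, 1] (G ω) ^ 4 - K ![1, -1, -1, -1] (G ω) ^ 4) := fun ω => by
    simp only [hK, Fin.sum_univ_four]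
    simp
    ring
  simp only [pol]
  rw [integral_const_mul]
  have i2 := (hKm ![1, 1, 1, 1]).sub (hKm ![1, 1, 1, -1])
  have i3 := i2.sub (hKm ![1, 1, -1, 1])
  have i4 := i3.sub (hKm ![1, -1, 1, 1])
  have i5 := i4.add (hKm ![1, 1, -1, -1])
  have i6 := i5.add (hKm ![1, -1, 1, -1])
  have i7 := i6.add (hKm ![1, -1, -1, 1])
  rw [integral_sub i7.integrable (hKm _).integrable,
    integral_add i6.integrable (hKm _).integrable, integral_add i5.integrable (hKm _).integrable,
    integral_add i4.integrable (hKm _).integrable, integral_sub i3.integrable (hKm _).integrable,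
    integral_sub i2.integrable (hKm _).integrable,
    integral_sub (hKm _).integrable (hKm _).integrable]
  simp only [hK4, hK2, Fin.sum_univ_four]
  have sy : ∀ i j, ∫ ω, L i (G ω) * L j (G ω) ∂P = ∫ ω, L j (G ω) * L i (G ω) ∂P := fun i j => by
    simp only [mul_comm]
  rw [sy 1 0, sy 2 0, sy 3 0, sy 2 1, sy 3 1, sy 3 2]
  simp
  ring

end moments

/-! ### Mean and scatter matrix of a Gaussian sample -/

section sample

variable {ι : Type*} {n : ℕ}

/-- The mean of a sample of vectors. -/
def sampleMean (y : Fin n → EuclideanSpace ℝ ι) : EuclideanSpace ℝ ι := (n : ℝ)⁻¹ • ∑ j, y j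

/-- The scatter matrix `∑ⱼ (yⱼ - ȳ) (yⱼ - ȳ)ᵀ` of a sample of vectors. -/
def sampleScatter (y : Fin n → EuclideanSpace ℝ ι) : Matrix ι ι ℝ :=
  ∑ j, vecMulVec (y j - sampleMean y).ofLp (y j - sampleMean y).ofLp

theorem sampleMean_apply (y : Fin n → EuclideanSpace ℝ ι) (a : ι) :
    sampleMean y a = (n : ℝ)⁻¹ * ∑ j, y j a := by
  simp [sampleMean]

theorem sampleScatter_apply (y : Fin n → EuclideanSpace ℝ ι) (a b : ι) :
    sampleScatter y a b = ∑ j, (y j a - sampleMean y a) * (y j b - sampleMean y b) := by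
  simp [sampleScatter, Matrix.sum_apply, vecMulVec_apply]

theorem sampleMean_sub_apply (hn : 0 < n) (y : Fin n → EuclideanSpace ℝ ι)
    (m : EuclideanSpace ℝ ι) (a : ι) :
    sampleMean y a - m a = (n : ℝ)⁻¹ * ∑ l, (y l a - m a) := by
  have hn' : (n : ℝ) ≠ 0 := by positivity
  rw [sampleMean_apply, Finset.sum_sub_distrib, Finset.sum_const, Finset.card_univ, Fintype.card_fin,
    nsmul_eq_mul]
  field_simp

theorem isHermitian_sampleScatter (y : Fin n → EuclideanSpace ℝ ι) :
    (sampleScatter y).IsHermitian := by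
  ext a b
  simp only [Matrix.conjTranspose_apply, star_trivial, sampleScatter_apply, mul_comm]

variable [Fintype ι]

theorem trace_sampleScatter (y : Fin n → EuclideanSpace ℝ ι) :
    (sampleScatter y).trace = ∑ j, ‖y j - sampleMean y‖ ^ 2 := by
  simp only [Matrix.trace, Matrix.diag_apply, sampleScatter_apply, EuclideanSpace.real_norm_sq_eq,
    PiLp.sub_apply]
  rw [Finset.sum_comm]
  simp only [pow_two]

theorem trace_sampleScatter_nonneg (y : Fin n → EuclideanSpace ℝ ι) :
    0 ≤ (sampleScatter y).trace := by
  rw [trace_sampleScatter]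
  positivity

theorem norm_flat_vecMulVec (v : EuclideanSpace ℝ ι) : ‖flat (vecMulVec v.ofLp v.ofLp)‖ = ‖v‖ ^ 2 := by
  rw [← sq_eq_sq₀ (norm_nonneg _) (by positivity), EuclideanSpace.real_norm_sq_eq,
    EuclideanSpace.real_norm_sq_eq, Fintype.sum_prod_type, pow_two, Finset.sum_mul_sum]
  refine Finset.sum_congr rfl fun a _ => Finset.sum_congr rfl fun b _ => ?_
  simp [vecMulVec_apply]
  ring

theorem norm_flat_sampleScatter_le (y : Fin n → EuclideanSpace ℝ ι) :
    ‖flat (sampleScatter y)‖ ≤ (sampleScatter y).trace := by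
  have e : flat (sampleScatter y) = ∑ j, flat (vecMulVec (y j - sampleMean y).ofLp
      (y j - sampleMean y).ofLp) := by
    ext ab
    simp [sampleScatter, Matrix.sum_apply]
  rw [e, trace_sampleScatter]
  refine (norm_sum_le _ _).trans (Finset.sum_le_sum fun j _ => ?_)
  rw [norm_flat_vecMulVec]

/-- The sum of squared deviations from `m` splits into the one from the sample mean and the
contribution of the deviation of the sample mean. -/
theorem scatter_add_mean_sq (hn : 0 < n) (y : Fin n → EuclideanSpace ℝ ι)
    (m : EuclideanSpace ℝ ι) :
    (sampleScatter y).trace + n * ‖sampleMean y - m‖ ^ 2 = ∑ j, ‖y j - m‖ ^ 2 := by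
  have hn' : (n : ℝ) ≠ 0 := by positivity
  have e : ∀ j, ‖y j - m‖ ^ 2 = ‖y j - sampleMean y‖ ^ 2 +
      2 * ⟪y j - sampleMean y, sampleMean y - m⟫ + ‖sampleMean y - m‖ ^ 2 := fun j => by
    rw [← norm_add_sq_real, sub_add_sub_cancel]
  have z : ∑ j, (y j - sampleMean y) = 0 := by
    rw [Finset.sum_sub_distrib, Finset.sum_const, Finset.card_univ, Fintype.card_fin,
      ← Nat.cast_smul_eq_nsmul ℝ, sampleMean, smul_smul, mul_inv_cancel₀ hn', one_smul, sub_self]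
  simp only [e, Finset.sum_add_distrib, ← Finset.mul_sum, ← sum_inner, z, trace_sampleScatter]
  simp

end sample

section gaussian

variable {Ω : Type*} [MeasurableSpace Ω] {P : Measure Ω} {ι : Type*} [Fintype ι] [DecidableEq ι]
  {n : ℕ}

/-- A sample of size `n` from the Gaussian distribution `N(m, Σ)`. -/
structure IsGaussianSample (Y : Fin n → Ω → EuclideanSpace ℝ ι) (m : EuclideanSpace ℝ ι)
    (Sig : Matrix ι ι ℝ) (P : Measure Ω) : Prop where
  posSemidef : Sig.PosSemidef
  hasLaw : ∀ j, HasLaw (Y j) (multivariateGaussian m Sig) P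
  indep : iIndepFun Y P

namespace IsGaussianSample

variable {Y : Fin n → Ω → EuclideanSpace ℝ ι} {m : EuclideanSpace ℝ ι} {Sig : Matrix ι ι ℝ}
  (hY : IsGaussianSample Y m Sig P)

include hY

theorem isProbabilityMeasure : IsProbabilityMeasure P := hY.indep.isProbabilityMeasure

theorem hasGaussianLaw : HasGaussianLaw (fun ω j => Y j ω) P :=
  hY.indep.hasGaussianLaw fun j => (hY.hasLaw j).hasGaussianLaw

theorem allMoments_coord (j : Fin n) (a : ι) : HasAllMoments (fun ω => Y j ω a) P :=
  hasAllMoments_of_hasGaussianLaw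
    ((hY.hasLaw j).hasGaussianLaw.map_fun (EuclideanSpace.proj (𝕜 := ℝ) a))

theorem integral_coord (j : Fin n) (a : ι) : ∫ ω, Y j ω a ∂P = m a := by
  have h := (measurePreserving_eval_multivariateGaussian (μ := m) hY.posSemidef (i := a)).fun_comp_hasLaw
    (hY.hasLaw j)
  rw [h.integral_eq, integral_id_gaussianReal]

theorem allMoments_dev (j : Fin n) (a : ι) : HasAllMoments (fun ω => Y j ω a - m a) P := by
  have := hY.isProbabilityMeasure
  exact (hY.allMoments_coord j a).sub (.const _)

theorem integral_dev (j : Fin n) (a : ι) : ∫ ω, (Y j ω a - m a) ∂P = 0 := by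
  have := hY.isProbabilityMeasure
  rw [integral_sub (hY.allMoments_coord j a).integrable (integrable_const _), hY.integral_coord]
  simp

theorem integral_dev_mul_dev (j l : Fin n) (a b : ι) :
    ∫ ω, (Y j ω a - m a) * (Y l ω b - m b) ∂P = if j = l then Sig a b else 0 := by
  have hc : ∫ ω, (Y j ω a - m a) * (Y l ω b - m b) ∂P =
      cov[fun ω => Y j ω a, fun ω => Y l ω b; P] := by
    simp only [covariance, hY.integral_coord]
  rw [hc]
  split_ifs with h
  · subst h
    rw [(hY.hasLaw j).covariance_fun_comp (f := fun x => x a) (g := fun x => x b)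
      (by fun_prop) (by fun_prop), covariance_eval_multivariateGaussian hY.posSemidef]
  · have := hY.isProbabilityMeasure
    have hi : IndepFun (fun ω => Y j ω a) (fun ω => Y l ω b) P :=
      (hY.indep.indepFun h).comp (φ := fun x : EuclideanSpace ℝ ι => x a)
        (ψ := fun x : EuclideanSpace ℝ ι => x b) (by fun_prop) (by fun_prop)
    exact hi.covariance_eq_zero (hY.allMoments_coord j a).memLp_two
      (hY.allMoments_coord l b).memLp_two

theorem allMoments_mean_dev (hn : 0 < n) (a : ι) :
    HasAllMoments (fun ω => sampleMean (fun j => Y j ω) a - m a) P := by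
  simp only [sampleMean_sub_apply hn]
  exact (HasAllMoments.sum fun l => hY.allMoments_dev l a).const_mul _

theorem integral_mean_dev (hn : 0 < n) (a : ι) :
    ∫ ω, (sampleMean (fun j => Y j ω) a - m a) ∂P = 0 := by
  simp only [sampleMean_sub_apply hn]
  rw [integral_const_mul, integral_finsetSum _ fun l _ => (hY.allMoments_dev l a).integrable]
  simp [hY.integral_dev]

theorem integral_dev_mul_mean_dev (hn : 0 < n) (j : Fin n) (a b : ι) :
    ∫ ω, (Y j ω a - m a) * (sampleMean (fun j => Y j ω) b - m b) ∂P = (n : ℝ)⁻¹ * Sig a b := by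
  simp only [sampleMean_sub_apply hn, mul_left_comm _ (n : ℝ)⁻¹, Finset.mul_sum]
  rw [integral_finsetSum _ fun l _ =>
    (((hY.allMoments_dev j a).mul (hY.allMoments_dev l b)).const_mul _).integrable]
  simp [integral_const_mul, hY.integral_dev_mul_dev]

theorem integral_mean_dev_mul_mean_dev (hn : 0 < n) (a b : ι) :
    ∫ ω, (sampleMean (fun j => Y j ω) a - m a) * (sampleMean (fun j => Y j ω) b - m b) ∂P =
      (n : ℝ)⁻¹ * Sig a b := by
  have hn' : (n : ℝ) ≠ 0 := by positivity
  have e : ∀ ω, (sampleMean (fun j => Y j ω) a - m a) * (sampleMean (fun j => Y j ω) b - m b) =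
      ∑ l, (n : ℝ)⁻¹ * ((Y l ω a - m a) * (sampleMean (fun j => Y j ω) b - m b)) := fun ω => by
    rw [← Finset.mul_sum, ← Finset.sum_mul, ← mul_assoc, ← sampleMean_sub_apply hn]
  simp only [e]
  rw [integral_finsetSum _ fun l _ =>
    (((hY.allMoments_dev l a).mul (hY.allMoments_mean_dev hn b)).const_mul _).integrable]
  simp only [integral_const_mul, hY.integral_dev_mul_mean_dev hn, Finset.sum_const,
    Finset.card_univ, Fintype.card_fin, nsmul_eq_mul]
  field_simp

theorem allMoments_res (hn : 0 < n) (j : Fin n) (a : ι) :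
    HasAllMoments (fun ω => Y j ω a - sampleMean (fun j => Y j ω) a) P := by
  have e : ∀ ω, Y j ω a - sampleMean (fun j => Y j ω) a =
      (Y j ω a - m a) - (sampleMean (fun j => Y j ω) a - m a) := fun ω => by ring
  simp only [e]
  exact (hY.allMoments_dev j a).sub (hY.allMoments_mean_dev hn a)

theorem integral_res (hn : 0 < n) (j : Fin n) (a : ι) :
    ∫ ω, (Y j ω a - sampleMean (fun j => Y j ω) a) ∂P = 0 := by
  have e : ∀ ω, Y j ω a - sampleMean (fun j => Y j ω) a =
      (Y j ω a - m a) - (sampleMean (fun j => Y j ω) a - m a) := fun ω => by ring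
  simp only [e]
  rw [integral_sub (hY.allMoments_dev j a).integrable (hY.allMoments_mean_dev hn a).integrable,
    hY.integral_dev, hY.integral_mean_dev hn, sub_zero]

/-- The residuals have the covariances of a Gaussian sample projected to the orthogonal complement
of the constant vectors. -/
theorem integral_res_mul_res (hn : 0 < n) (j l : Fin n) (a b : ι) :
    ∫ ω, (Y j ω a - sampleMean (fun j => Y j ω) a) * (Y l ω b - sampleMean (fun j => Y j ω) b) ∂P =
      ((if j = l then 1 else 0) - (n : ℝ)⁻¹) * Sig a b := by
  have e : ∀ ω, (Y j ω a - sampleMean (fun j => Y j ω) a) *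
        (Y l ω b - sampleMean (fun j => Y j ω) b) =
      (Y j ω a - m a) * (Y l ω b - m b)
        - (Y j ω a - m a) * (sampleMean (fun j => Y j ω) b - m b)
        - (Y l ω b - m b) * (sampleMean (fun j => Y j ω) a - m a)
        + (sampleMean (fun j => Y j ω) a - m a) * (sampleMean (fun j => Y j ω) b - m b) :=
    fun ω => by ring
  simp only [e]
  have i1 := (hY.allMoments_dev j a).mul (hY.allMoments_dev l b)
  have i2 := (hY.allMoments_dev j a).mul (hY.allMoments_mean_dev hn b)
  have i3 := (hY.allMoments_dev l b).mul (hY.allMoments_mean_dev hn a)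
  have i4 := (hY.allMoments_mean_dev hn a).mul (hY.allMoments_mean_dev hn b)
  rw [integral_add ((i1.sub i2).sub i3).integrable i4.integrable,
    integral_sub (i1.sub i2).integrable i3.integrable, integral_sub i1.integrable i2.integrable,
    hY.integral_dev_mul_dev, hY.integral_dev_mul_mean_dev hn, hY.integral_dev_mul_mean_dev hn,
    hY.integral_mean_dev_mul_mean_dev hn]
  have hs : Sig b a = Sig a b := by simpa using hY.posSemidef.1.apply a b
  rw [hs]
  split_ifs <;> ring

theorem allMoments_scatter (hn : 0 < n) (a b : ι) :
    HasAllMoments (fun ω => sampleScatter (fun j => Y j ω) a b) P := by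
  simp only [sampleScatter_apply]
  exact HasAllMoments.sum fun j => (hY.allMoments_res hn j a).mul (hY.allMoments_res hn j b)

theorem integral_scatter (hn : 0 < n) (a b : ι) :
    ∫ ω, sampleScatter (fun j => Y j ω) a b ∂P = (n - 1) * Sig a b := by
  have hn' : (n : ℝ) ≠ 0 := by positivity
  simp only [sampleScatter_apply]
  rw [integral_finsetSum _ fun j _ =>
    ((hY.allMoments_res hn j a).mul (hY.allMoments_res hn j b)).integrable]
  simp only [hY.integral_res_mul_res hn, if_true, Finset.sum_const, Finset.card_univ,
    Fintype.card_fin, nsmul_eq_mul]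
  field_simp

/-- The second moments of the entries of the Wishart matrix `S`. -/
theorem integral_scatter_mul_scatter (hn : 0 < n) (a b c d : ι) :
    ∫ ω, sampleScatter (fun j => Y j ω) a b * sampleScatter (fun j => Y j ω) c d ∂P =
      (n - 1) ^ 2 * (Sig a b * Sig c d) + (n - 1) * (Sig a c * Sig b d + Sig a d * Sig b c) := by
  have hn' : (n : ℝ) ≠ 0 := by positivity
  let R : Fin n → ι → (Fin n → EuclideanSpace ℝ ι) →L[ℝ] ℝ := fun j a =>
    (EuclideanSpace.proj (𝕜 := ℝ) a).comp (ContinuousLinearMap.proj (R := ℝ) j) - (n : ℝ)⁻¹ • ∑ l,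
      (EuclideanSpace.proj (𝕜 := ℝ) a).comp (ContinuousLinearMap.proj (R := ℝ) l)
  have hR : ∀ j a (y : Fin n → EuclideanSpace ℝ ι), R j a y = y j a - sampleMean y a :=
    fun j a y => by
      simp [R, sampleMean_apply]
  have key : ∀ j l : Fin n, ∫ ω, ((Y j ω a - sampleMean (fun j => Y j ω) a) *
        (Y j ω b - sampleMean (fun j => Y j ω) b)) *
      ((Y l ω c - sampleMean (fun j => Y j ω) c) * (Y l ω d - sampleMean (fun j => Y j ω) d)) ∂P =
      (1 - (n : ℝ)⁻¹) ^ 2 * (Sig a b * Sig c d) + ((if j = l then 1 else 0) - (n : ℝ)⁻¹) ^ 2 *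
        (Sig a c * Sig b d + Sig a d * Sig b c) := fun j l => by
    have h := integral_mul_four hY.hasGaussianLaw ![R j a, R j b, R l c, R l d] (fun i => by
      fin_cases i <;> simp [hR, hY.integral_res hn])
    simp only [Matrix.cons_val, hR, hY.integral_res_mul_res hn, if_true] at h
    rw [h]
    ring
  have e : ∀ ω, sampleScatter (fun j => Y j ω) a b * sampleScatter (fun j => Y j ω) c d =
      ∑ j, ∑ l, ((Y j ω a - sampleMean (fun j => Y j ω) a) *
        (Y j ω b - sampleMean (fun j => Y j ω) b)) *
      ((Y l ω c - sampleMean (fun j => Y j ω) c) *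
        (Y l ω d - sampleMean (fun j => Y j ω) d)) := fun ω => by
    rw [sampleScatter_apply, sampleScatter_apply, Finset.sum_mul_sum]
  have hm : ∀ j l : Fin n, HasAllMoments (fun ω => ((Y j ω a - sampleMean (fun j => Y j ω) a) *
        (Y j ω b - sampleMean (fun j => Y j ω) b)) *
      ((Y l ω c - sampleMean (fun j => Y j ω) c) *
        (Y l ω d - sampleMean (fun j => Y j ω) d))) P := fun j l =>
    ((hY.allMoments_res hn j a).mul (hY.allMoments_res hn j b)).mul
      ((hY.allMoments_res hn l c).mul (hY.allMoments_res hn l d))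
  simp only [e]
  rw [integral_finsetSum _ fun j _ => (HasAllMoments.sum fun l => hm j l).integrable]
  have e2 : ∀ j, ∫ ω, ∑ l, ((Y j ω a - sampleMean (fun j => Y j ω) a) *
        (Y j ω b - sampleMean (fun j => Y j ω) b)) *
      ((Y l ω c - sampleMean (fun j => Y j ω) c) *
        (Y l ω d - sampleMean (fun j => Y j ω) d)) ∂P =
      n * ((1 - (n : ℝ)⁻¹) ^ 2 * (Sig a b * Sig c d)) + (1 - (n : ℝ)⁻¹) *
        (Sig a c * Sig b d + Sig a d * Sig b c) := fun j => by
    rw [integral_finsetSum _ fun l _ => (hm j l).integrable]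
    simp only [key, Finset.sum_add_distrib, ← Finset.sum_mul]
    have e3 : ∀ l : Fin n, ((if j = l then (1 : ℝ) else 0) - (n : ℝ)⁻¹) ^ 2 =
        (if j = l then 1 - 2 * (n : ℝ)⁻¹ else 0) + ((n : ℝ)⁻¹) ^ 2 := fun l => by
      split_ifs <;> ring
    simp only [e3, Finset.sum_add_distrib, Finset.sum_ite_eq, Finset.mem_univ, if_true,
      Finset.sum_const, Finset.card_univ, Fintype.card_fin, nsmul_eq_mul]
    field_simp
    ring
  simp only [e2, Finset.sum_const, Finset.card_univ, Fintype.card_fin, nsmul_eq_mul]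
  field_simp

end IsGaussianSample

end gaussian

/-! ### Unbiased estimates from a Gaussian sample -/

section estimates

variable {ι : Type*} [Fintype ι]

/-- The unbiased estimate of `E ‖ȳ - m‖²` from the scatter matrix of a sample of size `n`. -/
def meanVarEst (n : ℕ) (S : Matrix ι ι ℝ) : ℝ := S.trace / (n * (n - 1))

/-- The unbiased estimate of the covariance matrix, as a vector. -/
def covEst (n : ℕ) (S : Matrix ι ι ℝ) : EuclideanSpace ℝ (ι × ι) := ((n : ℝ) - 1)⁻¹ • flat S

/-- The unbiased estimate of the squared error of `covEst`. -/
def covRiskEst (n : ℕ) (S : Matrix ι ι ℝ) : ℝ :=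
  ((n - 3) / (n - 1) ^ 2 * ‖flat S‖ ^ 2 + S.trace ^ 2 / (n - 1)) / ((n + 1) * (n - 2))

/-- The unbiased estimate of the squared norm of the covariance matrix. -/
def covSqEst (n : ℕ) (S : Matrix ι ι ℝ) : ℝ :=
  (‖flat S‖ ^ 2 - S.trace ^ 2 / (n - 1)) / ((n + 1) * (n - 2))

end estimates

section noise

variable {Ω : Type*} [MeasurableSpace Ω] {P : Measure Ω} {ι : Type*} [Fintype ι] {n : ℕ}

/-- A centered random variable with moments of all orders and second moment at most `B`. -/
structure IsNoise (f : Ω → ℝ) (B : ℝ) (P : Measure Ω) : Prop where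
  allMoments : HasAllMoments f P
  integral_eq_zero : ∫ ω, f ω ∂P = 0
  integral_sq_le : ∫ ω, f ω ^ 2 ∂P ≤ B

/-- The quantity in terms of which all second moments of one population are bounded. -/
def momentSize (m : EuclideanSpace ℝ ι) (Sig : Matrix ι ι ℝ) : ℝ :=
  1 + Sig.trace ^ 4 + m.ofLp ⬝ᵥ (Sig *ᵥ m.ofLp) + ‖m‖ ^ 2

/-- The constant in the bound for the fourth moment of the sum of squared deviations. -/
def devConst (n : ℕ) (ι : Type*) [Fintype ι] : ℝ :=
  (n * Fintype.card ι) ^ 4 * ∫ x, x ^ 8 ∂gaussianReal 0 1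

theorem devConst_nonneg : 0 ≤ devConst n ι := by
  have : 0 ≤ ∫ x, x ^ 8 ∂gaussianReal 0 1 := integral_nonneg fun x => by positivity
  unfold devConst
  positivity

/-- The constant in the bounds for second moments of one population. -/
def noiseConst (n : ℕ) (ι : Type*) [Fintype ι] : ℝ := 24 * (devConst n ι + 1) + 2

theorem noiseConst_nonneg : 0 ≤ noiseConst n ι := by
  have := devConst_nonneg (n := n) (ι := ι)
  unfold noiseConst
  positivity

theorem norm_sq_sampleMean_sub_le (hn : 3 ≤ n) (y : Fin n → EuclideanSpace ℝ ι)
    (m : EuclideanSpace ℝ ι) : ‖sampleMean y - m‖ ^ 2 ≤ ∑ j, ‖y j - m‖ ^ 2 := by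
  rw [← scatter_add_mean_sq (by omega) y m]
  have h1 := trace_sampleScatter_nonneg y
  have h2 : (3 : ℝ) ≤ n := by exact_mod_cast hn
  nlinarith [sq_nonneg ‖sampleMean y - m‖]

theorem trace_sampleScatter_le (hn : 3 ≤ n) (y : Fin n → EuclideanSpace ℝ ι)
    (m : EuclideanSpace ℝ ι) : (sampleScatter y).trace ≤ ∑ j, ‖y j - m‖ ^ 2 := by
  rw [← scatter_add_mean_sq (by omega) y m]
  have : 0 ≤ n * ‖sampleMean y - m‖ ^ 2 := by positivity
  linarith

theorem norm_flat_sq_eq_sum (A : Matrix ι ι ℝ) : ‖flat A‖ ^ 2 = ∑ a, ∑ b, A a b * A a b := by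
  rw [EuclideanSpace.real_norm_sq_eq, Fintype.sum_prod_type]
  simp only [flat_apply, pow_two]

theorem norm_covEst_le_trace (hn : 3 ≤ n) (y : Fin n → EuclideanSpace ℝ ι) :
    ‖covEst n (sampleScatter y)‖ ≤ (sampleScatter y).trace := by
  have hn' : (3 : ℝ) ≤ n := by exact_mod_cast hn
  have h4 : ((n : ℝ) - 1)⁻¹ ≤ 1 := inv_le_one_of_one_le₀ (by linarith)
  have h5 : 0 ≤ ((n : ℝ) - 1)⁻¹ := inv_nonneg.2 (by linarith)
  rw [covEst, norm_smul, Real.norm_eq_abs, abs_of_nonneg h5]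
  exact (mul_le_of_le_one_left (norm_nonneg _) h4).trans (norm_flat_sampleScatter_le _)

theorem norm_covEst_le (hn : 3 ≤ n) (y : Fin n → EuclideanSpace ℝ ι)
    (m : EuclideanSpace ℝ ι) : ‖covEst n (sampleScatter y)‖ ≤ ∑ j, ‖y j - m‖ ^ 2 :=
  (norm_covEst_le_trace hn y).trans (trace_sampleScatter_le hn y m)

namespace IsGaussianSample

variable [DecidableEq ι] {Y : Fin n → Ω → EuclideanSpace ℝ ι} {m : EuclideanSpace ℝ ι}
  {Sig : Matrix ι ι ℝ} (hY : IsGaussianSample Y m Sig P)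

include hY

theorem quadForm_nonneg : 0 ≤ m.ofLp ⬝ᵥ (Sig *ᵥ m.ofLp) := by
  simpa using hY.posSemidef.dotProduct_mulVec_nonneg m.ofLp

theorem one_add_trace_le : 1 + Sig.trace ^ 4 + ‖m‖ ^ 2 ≤ momentSize m Sig := by
  have := hY.quadForm_nonneg
  unfold momentSize
  linarith

theorem allMoments_devSq : HasAllMoments (fun ω => ∑ j, ‖Y j ω - m‖ ^ 2) P := by
  have := hY.isProbabilityMeasure
  simp only [EuclideanSpace.real_norm_sq_eq, PiLp.sub_apply]
  exact .sum fun j => .sum fun a => (hY.allMoments_dev j a).pow 2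

theorem hasGaussianLaw_dev (j : Fin n) (a : ι) : HasGaussianLaw (fun ω => Y j ω a - m a) P :=
  (gaussianReal_sub_const ((measurePreserving_eval_multivariateGaussian (μ := m) hY.posSemidef
    (i := a)).fun_comp_hasLaw (hY.hasLaw j)) (m a)).hasGaussianLaw

theorem diag_le_trace (a : ι) : Sig a a ≤ Sig.trace :=
  Finset.single_le_sum (f := fun a => Sig a a) (fun _ _ => hY.posSemidef.diag_nonneg)
    (Finset.mem_univ a)

theorem integral_devSq_pow_four_le :
    ∫ ω, (∑ j, ‖Y j ω - m‖ ^ 2) ^ 4 ∂P ≤ devConst n ι * Sig.trace ^ 4 := by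
  have := hY.isProbabilityMeasure
  have e : ∀ ω, (∑ j, ‖Y j ω - m‖ ^ 2) ^ 4 ≤
      (n * Fintype.card ι : ℝ) ^ 3 * ∑ ja : Fin n × ι, (Y ja.1 ω ja.2 - m ja.2) ^ 8 := fun ω => by
    have h := pow_sum_le_card_mul_sum_pow (s := Finset.univ)
      (f := fun ja : Fin n × ι => (Y ja.1 ω ja.2 - m ja.2) ^ 2) (fun _ _ => by positivity) 3
    simp only [Finset.card_univ, Fintype.card_prod, Fintype.card_fin, ← pow_mul] at h
    simp only [EuclideanSpace.real_norm_sq_eq, PiLp.sub_apply]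
    rw [← Fintype.sum_prod_type']
    push_cast at h
    exact h
  have hm : ∀ ja : Fin n × ι, HasAllMoments (fun ω => (Y ja.1 ω ja.2 - m ja.2) ^ 8) P := fun ja =>
    (hY.allMoments_dev ja.1 ja.2).pow 8
  refine (integral_mono (hY.allMoments_devSq.pow 4).integrable
    ((HasAllMoments.sum hm).const_mul _).integrable e).trans ?_
  rw [integral_const_mul, integral_finsetSum _ fun ja _ => (hm ja).integrable]
  have h8 : ∀ ja : Fin n × ι, ∫ ω, (Y ja.1 ω ja.2 - m ja.2) ^ 8 ∂P ≤
      Sig.trace ^ 4 * ∫ x, x ^ 8 ∂gaussianReal 0 1 := fun ja => by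
    have h := integral_even_pow_of_hasGaussianLaw (hY.hasGaussianLaw_dev ja.1 ja.2)
      (hY.integral_dev _ _) 4
    simp only [pow_two, hY.integral_dev_mul_dev, if_true] at h
    rw [h]
    have h0 : 0 ≤ Sig ja.2 ja.2 := hY.posSemidef.diag_nonneg
    have h1 := hY.diag_le_trace ja.2
    have h2 : 0 ≤ ∫ x, x ^ 8 ∂gaussianReal 0 1 := integral_nonneg fun x => by positivity
    gcongr
  refine (mul_le_mul_of_nonneg_left (Finset.sum_le_sum fun ja _ => h8 ja) (by positivity)).trans ?_
  rw [Finset.sum_const, Finset.card_univ, Fintype.card_prod, Fintype.card_fin, nsmul_eq_mul, devConst]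
  push_cast
  apply le_of_eq
  ring

theorem allMoments_inner_mean_dev (hn : 3 ≤ n) :
    HasAllMoments (fun ω => ⟪sampleMean (fun j => Y j ω) - m, m⟫) P := by
  have := hY.isProbabilityMeasure
  simp only [PiLp.inner_apply, PiLp.sub_apply, RCLike.inner_apply, conj_trivial]
  exact .sum fun a => (hY.allMoments_mean_dev (by omega) a).const_mul _

theorem integral_inner_mean_dev_sq_le (hn : 3 ≤ n) :
    ∫ ω, ⟪sampleMean (fun j => Y j ω) - m, m⟫ ^ 2 ∂P ≤ m.ofLp ⬝ᵥ (Sig *ᵥ m.ofLp) := by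
  have hn0 : 0 < n := by omega
  have e : ∀ ω, ⟪sampleMean (fun j => Y j ω) - m, m⟫ ^ 2 = ∑ a, ∑ b, m a * m b *
      ((sampleMean (fun j => Y j ω) a - m a) * (sampleMean (fun j => Y j ω) b - m b)) := fun ω => by
    simp only [PiLp.inner_apply, PiLp.sub_apply, RCLike.inner_apply, conj_trivial]
    rw [pow_two, Finset.sum_mul_sum]
    exact Finset.sum_congr rfl fun a _ => Finset.sum_congr rfl fun b _ => by ring
  have hm : ∀ a b, HasAllMoments (fun ω => m a * m b *
      ((sampleMean (fun j => Y j ω) a - m a) * (sampleMean (fun j => Y j ω) b - m b))) P := fun a b =>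
    ((hY.allMoments_mean_dev hn0 a).mul (hY.allMoments_mean_dev hn0 b)).const_mul _
  simp only [e]
  rw [integral_finsetSum _ fun a _ => (HasAllMoments.sum fun b => hm a b).integrable]
  have e2 : ∀ a, ∫ ω, ∑ b, m a * m b * ((sampleMean (fun j => Y j ω) a - m a) *
      (sampleMean (fun j => Y j ω) b - m b)) ∂P = (n : ℝ)⁻¹ * (m a * ∑ b, Sig a b * m b) := fun a => by
    rw [integral_finsetSum _ fun b _ => (hm a b).integrable]
    simp only [integral_const_mul, hY.integral_mean_dev_mul_mean_dev hn0, Finset.mul_sum]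
    exact Finset.sum_congr rfl fun b _ => by ring
  simp only [e2, ← Finset.mul_sum]
  have h1 : (n : ℝ)⁻¹ ≤ 1 := inv_le_one_of_one_le₀ (by exact_mod_cast hn0)
  exact mul_le_of_le_one_left hY.quadForm_nonneg h1

/-- A centered statistic is noise if it is bounded by a quadratic expression in the sum of squared
deviations from `m`, up to a term that is linear in `m`. -/
theorem isNoise_of_bound (hn : 3 ≤ n) {f : Ω → ℝ} (hf : HasAllMoments f P)
    (h0 : ∫ ω, f ω ∂P = 0) (hb : ∀ ω, |f ω| ≤ 2 * (1 + (∑ j, ‖Y j ω - m‖ ^ 2) ^ 2 + Sig.trace ^ 2) +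
      |⟪sampleMean (fun j => Y j ω) - m, m⟫|) :
    IsNoise f (noiseConst n ι * momentSize m Sig) P := by
  refine ⟨hf, h0, ?_⟩
  have := hY.isProbabilityMeasure
  have e : ∀ ω, f ω ^ 2 ≤ (24 * (1 + Sig.trace ^ 4) + 24 * (∑ j, ‖Y j ω - m‖ ^ 2) ^ 4) +
      2 * ⟪sampleMean (fun j => Y j ω) - m, m⟫ ^ 2 := fun ω => by
    have h := hb ω
    set ζ := (∑ j, ‖Y j ω - m‖ ^ 2) ^ 2 with hζ
    set g := ⟪sampleMean (fun j => Y j ω) - m, m⟫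
    have e1 : f ω ^ 2 ≤ (2 * (1 + ζ + Sig.trace ^ 2) + |g|) ^ 2 := by
      rw [← sq_abs (f ω)]
      gcongr
    have e2 : (∑ j, ‖Y j ω - m‖ ^ 2) ^ 4 = ζ ^ 2 := by rw [hζ]; ring
    rw [e2, ← sq_abs g]
    nlinarith [sq_nonneg (2 * (1 + ζ + Sig.trace ^ 2) - |g|), sq_nonneg (ζ - 1),
      sq_nonneg (ζ - Sig.trace ^ 2), sq_nonneg (Sig.trace ^ 2 - 1)]
  have i1 := (HasAllMoments.const (P := P) (24 * (1 + Sig.trace ^ 4))).add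
    ((hY.allMoments_devSq.pow 4).const_mul 24)
  have i2 := ((hY.allMoments_inner_mean_dev hn).pow 2).const_mul 2
  refine (integral_mono (hf.pow 2).integrable (i1.add i2).integrable e).trans ?_
  rw [integral_add i1.integrable i2.integrable, integral_add (integrable_const _)
    ((hY.allMoments_devSq.pow 4).const_mul 24).integrable]
  have h1 := hY.integral_devSq_pow_four_le
  have h2 := hY.integral_inner_mean_dev_sq_le hn
  have h3 := devConst_nonneg (n := n) (ι := ι)
  have h4 := hY.quadForm_nonneg
  simp only [integral_const_mul, integral_const, probReal_univ, one_smul, noiseConst, momentSize]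
  have h5 : 0 ≤ Sig.trace ^ 4 := by positivity
  nlinarith [mul_nonneg h3 h4, mul_nonneg h3 h5, mul_nonneg h3 (sq_nonneg ‖m‖)]

theorem allMoments_trace_scatter (hn : 3 ≤ n) :
    HasAllMoments (fun ω => (sampleScatter (fun j => Y j ω)).trace) P :=
  .sum fun a => hY.allMoments_scatter (by omega) a a

theorem allMoments_norm_scatter_sq (hn : 3 ≤ n) :
    HasAllMoments (fun ω => ‖flat (sampleScatter (fun j => Y j ω))‖ ^ 2) P := by
  have := hY.isProbabilityMeasure
  simp only [EuclideanSpace.real_norm_sq_eq, flat_apply]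
  exact .sum fun ab => (hY.allMoments_scatter (by omega) ab.1 ab.2).pow 2

theorem allMoments_norm_mean_dev_sq (hn : 3 ≤ n) :
    HasAllMoments (fun ω => ‖sampleMean (fun j => Y j ω) - m‖ ^ 2) P := by
  have := hY.isProbabilityMeasure
  simp only [EuclideanSpace.real_norm_sq_eq, PiLp.sub_apply]
  exact .sum fun a => (hY.allMoments_mean_dev (by omega) a).pow 2

theorem integral_trace_scatter (hn : 3 ≤ n) :
    ∫ ω, (sampleScatter (fun j => Y j ω)).trace ∂P = (n - 1) * Sig.trace := by
  have hn0 : 0 < n := by omega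
  simp only [Matrix.trace, Matrix.diag_apply]
  rw [integral_finsetSum _ fun a _ => (hY.allMoments_scatter hn0 a a).integrable]
  simp only [hY.integral_scatter hn0, Finset.mul_sum]

theorem integral_norm_mean_dev_sq (hn : 3 ≤ n) :
    ∫ ω, ‖sampleMean (fun j => Y j ω) - m‖ ^ 2 ∂P = (n : ℝ)⁻¹ * Sig.trace := by
  have := hY.isProbabilityMeasure
  have hn0 : 0 < n := by omega
  simp only [EuclideanSpace.real_norm_sq_eq, PiLp.sub_apply]
  rw [integral_finsetSum _ fun a _ => ((hY.allMoments_mean_dev hn0 a).pow 2).integrable]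
  simp only [pow_two, hY.integral_mean_dev_mul_mean_dev hn0, Matrix.trace, Matrix.diag_apply,
    Finset.mul_sum]

theorem integral_norm_scatter_sq (hn : 3 ≤ n) :
    ∫ ω, ‖flat (sampleScatter (fun j => Y j ω))‖ ^ 2 ∂P =
      (n - 1) ^ 2 * ‖flat Sig‖ ^ 2 + (n - 1) * (Sig.trace ^ 2 + ‖flat Sig‖ ^ 2) := by
  have := hY.isProbabilityMeasure
  have hn0 : 0 < n := by omega
  rw [norm_flat_sq_eq_sum Sig]
  simp only [EuclideanSpace.real_norm_sq_eq, flat_apply]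
  rw [integral_finsetSum _ fun ab _ => ((hY.allMoments_scatter hn0 ab.1 ab.2).pow 2).integrable]
  have hs : ∀ a b, Sig b a = Sig a b := fun a b => by simpa using hY.posSemidef.1.apply a b
  simp only [pow_two (sampleScatter _ _ _), hY.integral_scatter_mul_scatter hn0]
  rw [Fintype.sum_prod_type]
  simp only [Finset.sum_add_distrib, ← Finset.mul_sum, hs]
  rw [pow_two Sig.trace, Matrix.trace, Finset.sum_mul_sum]
  simp only [Matrix.diag_apply]
  simp only [Finset.mul_sum]

theorem integral_trace_scatter_sq (hn : 3 ≤ n) :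
    ∫ ω, (sampleScatter (fun j => Y j ω)).trace ^ 2 ∂P =
      (n - 1) ^ 2 * Sig.trace ^ 2 + 2 * (n - 1) * ‖flat Sig‖ ^ 2 := by
  have hn0 : 0 < n := by omega
  have hm : ∀ a b, HasAllMoments (fun ω => sampleScatter (fun j => Y j ω) a a *
      sampleScatter (fun j => Y j ω) b b) P := fun a b =>
    (hY.allMoments_scatter hn0 a a).mul (hY.allMoments_scatter hn0 b b)
  have e : ∀ ω, (sampleScatter (fun j => Y j ω)).trace ^ 2 =
      ∑ a, ∑ b, sampleScatter (fun j => Y j ω) a a * sampleScatter (fun j => Y j ω) b b :=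
    fun ω => by
      simp only [pow_two, Matrix.trace, Matrix.diag_apply, Finset.sum_mul_sum]
  simp only [e]
  rw [integral_finsetSum _ fun a _ => (HasAllMoments.sum fun b => hm a b).integrable]
  have e2 : ∀ a, ∫ ω, ∑ b, sampleScatter (fun j => Y j ω) a a *
      sampleScatter (fun j => Y j ω) b b ∂P = (n - 1) ^ 2 * ∑ b, Sig a a * Sig b b +
        2 * (n - 1) * ∑ b, Sig a b * Sig a b := fun a => by
    rw [integral_finsetSum _ fun b _ => (hm a b).integrable]
    simp only [hY.integral_scatter_mul_scatter hn0, Finset.sum_add_distrib, ← Finset.mul_sum]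
    ring
  simp only [e2]
  simp only [Finset.sum_add_distrib, ← Finset.mul_sum, norm_flat_sq_eq_sum]
  rw [pow_two Sig.trace, Matrix.trace, Finset.sum_mul]
  simp only [Matrix.diag_apply, Finset.mul_sum]

/-- The Frobenius norm of a covariance matrix is at most its trace. This is obtained from the
corresponding inequality for the scatter matrix by taking expectations of the squares. -/
theorem norm_flat_le_trace (hn : 3 ≤ n) : ‖flat Sig‖ ≤ Sig.trace := by
  have := hY.isProbabilityMeasure
  have h : ∫ ω, ‖flat (sampleScatter (fun j => Y j ω))‖ ^ 2 ∂P ≤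
      ∫ ω, (sampleScatter (fun j => Y j ω)).trace ^ 2 ∂P :=
    integral_mono (hY.allMoments_norm_scatter_sq hn).integrable
      ((hY.allMoments_trace_scatter hn).pow 2).integrable fun ω => by
        have := norm_flat_sampleScatter_le (fun j => Y j ω)
        dsimp only
        gcongr
  rw [hY.integral_norm_scatter_sq hn, hY.integral_trace_scatter_sq hn] at h
  have hn' : (3 : ℝ) ≤ n := by exact_mod_cast hn
  refine abs_le_of_sq_le_sq' ?_ hY.posSemidef.trace_nonneg |>.2
  have h2 : 0 < ((n : ℝ) - 1) * (n - 2) := by apply mul_pos <;> linarith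
  refine le_of_mul_le_mul_left ?_ h2
  linarith

theorem mean_stat_noise (hn : 3 ≤ n) :
    IsNoise (fun ω => ‖sampleMean (fun j => Y j ω) - m‖ ^ 2 -
      meanVarEst n (sampleScatter (fun j => Y j ω))) (noiseConst n ι * momentSize m Sig) P := by
  have hn' : (3 : ℝ) ≤ n := by exact_mod_cast hn
  have hn1 : (n : ℝ) - 1 ≠ 0 := by linarith
  have hn2 : (n : ℝ) ≠ 0 := by linarith
  have i2 := (hY.allMoments_trace_scatter hn).const_mul (n * (n - 1) : ℝ)⁻¹
  simp only [meanVarEst, div_eq_inv_mul]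
  refine hY.isNoise_of_bound hn ((hY.allMoments_norm_mean_dev_sq hn).sub i2) ?_ fun ω => ?_
  · rw [integral_sub (hY.allMoments_norm_mean_dev_sq hn).integrable i2.integrable,
      integral_const_mul, hY.integral_trace_scatter hn, hY.integral_norm_mean_dev_sq hn]
    field_simp
    ring
  · have h1 := norm_sq_sampleMean_sub_le hn (fun j => Y j ω) m
    have h2 := trace_sampleScatter_le hn (fun j => Y j ω) m
    have h3 := trace_sampleScatter_nonneg (fun j => Y j ω)
    have h4 : (n * (n - 1) : ℝ)⁻¹ ≤ 1 := inv_le_one_of_one_le₀ (by nlinarith)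
    have h5 : 0 ≤ (n * (n - 1) : ℝ)⁻¹ := inv_nonneg.2 (by nlinarith)
    have h6 := mul_le_of_le_one_left h3 h4
    have h7 := mul_nonneg h5 h3
    have h8 := abs_nonneg ⟪sampleMean (fun j => Y j ω) - m, m⟫
    have h9 := sq_nonneg ‖sampleMean (fun j => Y j ω) - m‖
    rw [abs_le]
    constructor <;> nlinarith [sq_nonneg (∑ j, ‖Y j ω - m‖ ^ 2 - 1), sq_nonneg Sig.trace]

theorem inner_mean_stat_noise (hn : 3 ≤ n) :
    IsNoise (fun ω => ⟪sampleMean (fun j => Y j ω) - m, sampleMean (fun j => Y j ω)⟫ -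
      meanVarEst n (sampleScatter (fun j => Y j ω))) (noiseConst n ι * momentSize m Sig) P := by
  have h := hY.mean_stat_noise hn
  have hi := hY.allMoments_inner_mean_dev hn
  have e : ∀ ω, ⟪sampleMean (fun j => Y j ω) - m, sampleMean (fun j => Y j ω)⟫ -
      meanVarEst n (sampleScatter (fun j => Y j ω)) =
      (‖sampleMean (fun j => Y j ω) - m‖ ^ 2 - meanVarEst n (sampleScatter (fun j => Y j ω))) +
        ⟪sampleMean (fun j => Y j ω) - m, m⟫ := fun ω => by
    rw [← real_inner_self_eq_norm_sq, inner_sub_right]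
    ring
  simp only [e]
  refine hY.isNoise_of_bound hn (h.allMoments.add hi) ?_ fun ω => ?_
  · rw [integral_add h.allMoments.integrable hi.integrable, h.integral_eq_zero]
    have hm := hY.allMoments_mean_dev (show 0 < n by omega)
    simp only [PiLp.inner_apply, PiLp.sub_apply, RCLike.inner_apply, conj_trivial]
    rw [integral_finsetSum _ fun a _ => ((hm a).const_mul _).integrable]
    simp [integral_const_mul, hY.integral_mean_dev (show 0 < n by omega)]
  · refine (abs_add_le _ _).trans (add_le_add_left ?_ _)
    have h1 := norm_sq_sampleMean_sub_le hn (fun j => Y j ω) m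
    have h2 := trace_sampleScatter_le hn (fun j => Y j ω) m
    have h3 := trace_sampleScatter_nonneg (fun j => Y j ω)
    have hn' : (3 : ℝ) ≤ n := by exact_mod_cast hn
    have h4 : (n * (n - 1) : ℝ)⁻¹ ≤ 1 := inv_le_one_of_one_le₀ (by nlinarith)
    have h5 : 0 ≤ (n * (n - 1) : ℝ)⁻¹ := inv_nonneg.2 (by nlinarith)
    have h6 := mul_le_of_le_one_left h3 h4
    have h7 := mul_nonneg h5 h3
    have h9 := sq_nonneg ‖sampleMean (fun j => Y j ω) - m‖
    simp only [meanVarEst, div_eq_inv_mul]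
    rw [abs_le]
    constructor <;> nlinarith [sq_nonneg (∑ j, ‖Y j ω - m‖ ^ 2 - 1), sq_nonneg Sig.trace]

theorem mean_coord_noise (hn : 3 ≤ n) (a : ι) :
    IsNoise (fun ω => (sampleMean (fun j => Y j ω) - m) a) (noiseConst n ι * momentSize m Sig) P := by
  have hn0 : 0 < n := by omega
  refine hY.isNoise_of_bound hn (hY.allMoments_mean_dev hn0 a) (hY.integral_mean_dev hn0 a) fun ω => ?_
  have h1 := norm_sq_sampleMean_sub_le hn (fun j => Y j ω) m
  have h2 := PiLp.norm_apply_le (sampleMean (fun j => Y j ω) - m) a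
  rw [Real.norm_eq_abs] at h2
  have h8 := abs_nonneg ⟪sampleMean (fun j => Y j ω) - m, m⟫
  nlinarith [sq_nonneg (∑ j, ‖Y j ω - m‖ ^ 2 - 1), sq_nonneg Sig.trace,
    sq_nonneg (‖sampleMean (fun j => Y j ω) - m‖ - 1)]

theorem cov_coord_noise (hn : 3 ≤ n) (ab : ι × ι) :
    IsNoise (fun ω => (covEst n (sampleScatter (fun j => Y j ω)) - flat Sig) ab)
      (noiseConst n ι * momentSize m Sig) P := by
  have := hY.isProbabilityMeasure
  have hn0 : 0 < n := by omega
  have hn' : (3 : ℝ) ≤ n := by exact_mod_cast hn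
  have hn1 : (n : ℝ) - 1 ≠ 0 := by linarith
  have i1 := (hY.allMoments_scatter hn0 ab.1 ab.2).const_mul ((n : ℝ) - 1)⁻¹
  have e : ∀ ω, (covEst n (sampleScatter (fun j => Y j ω)) - flat Sig) ab =
      ((n : ℝ) - 1)⁻¹ * sampleScatter (fun j => Y j ω) ab.1 ab.2 - Sig ab.1 ab.2 := fun ω => by
    simp [covEst]
  have hall := i1.sub (.const (P := P) (Sig ab.1 ab.2))
  simp only [← e] at hall
  refine hY.isNoise_of_bound hn hall ?_ fun ω => ?_
  · simp only [e]
    rw [integral_sub i1.integrable (integrable_const _), integral_const_mul,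
      hY.integral_scatter hn0]
    simp [hn1]
  · have h1 := PiLp.norm_apply_le (covEst n (sampleScatter (fun j => Y j ω)) - flat Sig) ab
    rw [Real.norm_eq_abs] at h1
    have h2 := norm_sub_le (covEst n (sampleScatter (fun j => Y j ω))) (flat Sig)
    have h3 := norm_covEst_le hn (fun j => Y j ω) m
    have h4 := hY.norm_flat_le_trace hn
    have h8 := abs_nonneg ⟪sampleMean (fun j => Y j ω) - m, m⟫
    nlinarith [sq_nonneg (∑ j, ‖Y j ω - m‖ ^ 2 - 1), sq_nonneg (Sig.trace - 1)]

/-- As `t = covEst` is unbiased, `E ‖t‖² = E ‖t - Σ‖² + ‖Σ‖²`, and `covRiskEst` is unbiased for the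
first of these terms. -/
theorem cov_risk_noise (hn : 3 ≤ n) :
    IsNoise (fun ω => ‖covEst n (sampleScatter (fun j => Y j ω))‖ ^ 2 -
      covRiskEst n (sampleScatter (fun j => Y j ω)) - ‖flat Sig‖ ^ 2)
      (noiseConst n ι * momentSize m Sig) P := by
  have := hY.isProbabilityMeasure
  have hn' : (3 : ℝ) ≤ n := by exact_mod_cast hn
  have p1 : (0 : ℝ) < n - 1 := by linarith
  have p2 : (0 : ℝ) < n - 2 := by linarith
  have p3 : (0 : ℝ) < n + 1 := by linarith
  have e : ∀ ω, ‖covEst n (sampleScatter (fun j => Y j ω))‖ ^ 2 -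
      covRiskEst n (sampleScatter (fun j => Y j ω)) - ‖flat Sig‖ ^ 2 =
      (((n - 1 : ℝ) ^ 2)⁻¹ - (n - 3) / (n - 1) ^ 2 / ((n + 1) * (n - 2))) *
          ‖flat (sampleScatter (fun j => Y j ω))‖ ^ 2 -
        ((n - 1) * ((n + 1) * (n - 2)) : ℝ)⁻¹ * (sampleScatter (fun j => Y j ω)).trace ^ 2 -
        ‖flat Sig‖ ^ 2 := fun ω => by
    rw [covEst, covRiskEst, norm_smul, mul_pow, norm_inv, Real.norm_eq_abs, inv_pow, sq_abs]
    field_simp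
    ring
  have i1 := (hY.allMoments_norm_scatter_sq hn).const_mul
    (((n - 1 : ℝ) ^ 2)⁻¹ - (n - 3) / (n - 1) ^ 2 / ((n + 1) * (n - 2)))
  have i2 := ((hY.allMoments_trace_scatter hn).pow 2).const_mul ((n - 1) * ((n + 1) * (n - 2)) : ℝ)⁻¹
  have hall := (i1.sub i2).sub (.const (P := P) (‖flat Sig‖ ^ 2))
  simp only [← e] at hall
  refine hY.isNoise_of_bound hn hall ?_ fun ω => ?_
  · simp only [e]
    rw [integral_sub (i1.sub i2).integrable (integrable_const _),
      integral_sub i1.integrable i2.integrable, integral_const_mul, integral_const_mul,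
      hY.integral_norm_scatter_sq hn, hY.integral_trace_scatter_sq hn]
    simp only [integral_const, probReal_univ, one_smul]
    field_simp
    ring
  · have h1 := norm_covEst_le hn (fun j => Y j ω) m
    have h2 := hY.norm_flat_le_trace hn
    have h3 := trace_sampleScatter_le hn (fun j => Y j ω) m
    have h4 := norm_flat_sampleScatter_le (fun j => Y j ω)
    have h5 := trace_sampleScatter_nonneg (fun j => Y j ω)
    have h8 := abs_nonneg ⟪sampleMean (fun j => Y j ω) - m, m⟫
    set ζ := ∑ j, ‖Y j ω - m‖ ^ 2
    have r1 : ‖covEst n (sampleScatter (fun j => Y j ω))‖ ^ 2 ≤ ζ ^ 2 := by gcongr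
    have r2 : ‖flat Sig‖ ^ 2 ≤ Sig.trace ^ 2 := by gcongr
    have r3 : (sampleScatter (fun j => Y j ω)).trace ^ 2 ≤ ζ ^ 2 := by gcongr
    have r4 : ‖flat (sampleScatter (fun j => Y j ω))‖ ^ 2 ≤ ζ ^ 2 := by
      have := h4.trans h3
      gcongr
    have r5 : 0 ≤ covRiskEst n (sampleScatter (fun j => Y j ω)) := by
      have : (0 : ℝ) ≤ n - 3 := by linarith
      unfold covRiskEst
      positivity
    have r6 : covRiskEst n (sampleScatter (fun j => Y j ω)) ≤ ζ ^ 2 := by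
      rw [covRiskEst, div_le_iff₀ (by positivity)]
      have q1 : ((n : ℝ) - 3) / (n - 1) ^ 2 ≤ 1 := by
        rw [div_le_one (by positivity)]
        nlinarith
      have q2 : (sampleScatter (fun j => Y j ω)).trace ^ 2 / (n - 1 : ℝ) ≤ ζ ^ 2 :=
        (div_le_self (by positivity) (by linarith)).trans r3
      have q3 : ((n : ℝ) - 3) / (n - 1) ^ 2 * ‖flat (sampleScatter (fun j => Y j ω))‖ ^ 2 ≤ ζ ^ 2 :=
        (mul_le_of_le_one_left (by positivity) q1).trans r4
      have q4 : (2 : ℝ) ≤ (n + 1) * (n - 2) := by nlinarith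
      nlinarith [mul_le_mul_of_nonneg_left q4 (sq_nonneg ζ)]
    rw [abs_le]
    constructor <;> nlinarith [sq_nonneg ‖covEst n (sampleScatter (fun j => Y j ω))‖,
      sq_nonneg ‖flat Sig‖]

theorem cov_inner_noise (hn : 3 ≤ n) :
    IsNoise (fun ω => ⟪covEst n (sampleScatter (fun j => Y j ω)), flat Sig⟫ - ‖flat Sig‖ ^ 2)
      (noiseConst n ι * momentSize m Sig) P := by
  have := hY.isProbabilityMeasure
  have hc := hY.cov_coord_noise hn
  have e : ∀ ω, ⟪covEst n (sampleScatter (fun j => Y j ω)), flat Sig⟫ - ‖flat Sig‖ ^ 2 =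
      ∑ ab, flat Sig ab * (covEst n (sampleScatter (fun j => Y j ω)) - flat Sig) ab := fun ω => by
    rw [← real_inner_self_eq_norm_sq, ← inner_sub_left, PiLp.inner_apply]
    simp only [RCLike.inner_apply, conj_trivial]
  have hall := HasAllMoments.sum (s := Finset.univ) fun ab => (hc ab).allMoments.const_mul (flat Sig ab)
  simp only [← e] at hall
  refine hY.isNoise_of_bound hn hall ?_ fun ω => ?_
  · simp only [e]
    rw [integral_finsetSum _ fun ab _ => ((hc ab).allMoments.const_mul _).integrable]
    simp only [integral_const_mul, (hc _).integral_eq_zero]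
    simp
  · have h1 := norm_covEst_le hn (fun j => Y j ω) m
    have h2 := hY.norm_flat_le_trace hn
    have h3 := abs_real_inner_le_norm (covEst n (sampleScatter (fun j => Y j ω))) (flat Sig)
    have h8 := abs_nonneg ⟪sampleMean (fun j => Y j ω) - m, m⟫
    have h4 := mul_le_mul h1 h2 (norm_nonneg _) ((norm_nonneg _).trans h1)
    have r2 : ‖flat Sig‖ ^ 2 ≤ Sig.trace ^ 2 := by gcongr
    rw [abs_le] at h3 ⊢
    constructor <;> nlinarith [sq_nonneg (∑ j, ‖Y j ω - m‖ ^ 2 - Sig.trace), sq_nonneg ‖flat Sig‖]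

theorem cov_sq_noise (hn : 3 ≤ n) :
    IsNoise (fun ω => covSqEst n (sampleScatter (fun j => Y j ω)) - ‖flat Sig‖ ^ 2)
      (noiseConst n ι * momentSize m Sig) P := by
  have := hY.isProbabilityMeasure
  have hn' : (3 : ℝ) ≤ n := by exact_mod_cast hn
  have p1 : (0 : ℝ) < n - 1 := by linarith
  have p2 : (0 : ℝ) < n - 2 := by linarith
  have p3 : (0 : ℝ) < n + 1 := by linarith
  have e : ∀ ω, covSqEst n (sampleScatter (fun j => Y j ω)) - ‖flat Sig‖ ^ 2 =
      ((n + 1) * (n - 2) : ℝ)⁻¹ * ‖flat (sampleScatter (fun j => Y j ω))‖ ^ 2 -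
        ((n - 1) * ((n + 1) * (n - 2)) : ℝ)⁻¹ * (sampleScatter (fun j => Y j ω)).trace ^ 2 -
        ‖flat Sig‖ ^ 2 := fun ω => by
    rw [covSqEst]
    field_simp
  have i1 := (hY.allMoments_norm_scatter_sq hn).const_mul ((n + 1) * (n - 2) : ℝ)⁻¹
  have i2 := ((hY.allMoments_trace_scatter hn).pow 2).const_mul ((n - 1) * ((n + 1) * (n - 2)) : ℝ)⁻¹
  have hall := (i1.sub i2).sub (.const (P := P) (‖flat Sig‖ ^ 2))
  simp only [← e] at hall
  refine hY.isNoise_of_bound hn hall ?_ fun ω => ?_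
  · simp only [e]
    rw [integral_sub (i1.sub i2).integrable (integrable_const _),
      integral_sub i1.integrable i2.integrable, integral_const_mul, integral_const_mul,
      hY.integral_norm_scatter_sq hn, hY.integral_trace_scatter_sq hn]
    simp only [integral_const, probReal_univ, one_smul]
    field_simp
    ring
  · have h2 := hY.norm_flat_le_trace hn
    have h3 := trace_sampleScatter_le hn (fun j => Y j ω) m
    have h4 := norm_flat_sampleScatter_le (fun j => Y j ω)
    have h5 := trace_sampleScatter_nonneg (fun j => Y j ω)
    have h8 := abs_nonneg ⟪sampleMean (fun j => Y j ω) - m, m⟫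
    set ζ := ∑ j, ‖Y j ω - m‖ ^ 2
    have r2 : ‖flat Sig‖ ^ 2 ≤ Sig.trace ^ 2 := by gcongr
    have r3 : (sampleScatter (fun j => Y j ω)).trace ^ 2 ≤ ζ ^ 2 := by gcongr
    have r4 : ‖flat (sampleScatter (fun j => Y j ω))‖ ^ 2 ≤ ζ ^ 2 := by
      have := h4.trans h3
      gcongr
    have q2 : (sampleScatter (fun j => Y j ω)).trace ^ 2 / (n - 1 : ℝ) ≤ ζ ^ 2 :=
      (div_le_self (by positivity) (by linarith)).trans r3
    have q0 : 0 ≤ (sampleScatter (fun j => Y j ω)).trace ^ 2 / (n - 1 : ℝ) := by positivity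
    have q4 : (1 : ℝ) ≤ (n + 1) * (n - 2) := by nlinarith
    have r6 : |covSqEst n (sampleScatter (fun j => Y j ω))| ≤ ζ ^ 2 := by
      rw [covSqEst, abs_div, abs_of_pos (by positivity : (0 : ℝ) < (n + 1) * (n - 2))]
      refine (div_le_self (abs_nonneg _) q4).trans ?_
      rw [abs_le]
      constructor <;> nlinarith [sq_nonneg ‖flat (sampleScatter (fun j => Y j ω))‖]
    rw [abs_le] at r6 ⊢
    constructor <;> nlinarith [sq_nonneg ‖flat Sig‖]

theorem integral_norm_mean_sq_le (hn : 3 ≤ n) :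
    Integrable (fun ω => ‖sampleMean (fun j => Y j ω)‖ ^ 2) P ∧
    ∫ ω, ‖sampleMean (fun j => Y j ω)‖ ^ 2 ∂P ≤ noiseConst n ι * momentSize m Sig := by
  have := hY.isProbabilityMeasure
  have i0 : HasAllMoments (fun ω => ‖sampleMean (fun j => Y j ω)‖ ^ 2) P := by
    simp only [EuclideanSpace.real_norm_sq_eq, sampleMean_apply]
    exact .sum fun a => ((HasAllMoments.sum fun j => hY.allMoments_coord j a).const_mul _).pow 2
  have i1 := (hY.allMoments_devSq.pow 4).const_mul 2
  have e : ∀ ω, ‖sampleMean (fun j => Y j ω)‖ ^ 2 ≤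
      (2 * ‖m‖ ^ 2 + 4) + 2 * (∑ j, ‖Y j ω - m‖ ^ 2) ^ 4 := fun ω => by
    have h1 := norm_sq_sampleMean_sub_le hn (fun j => Y j ω) m
    have h2 := norm_add_le (sampleMean (fun j => Y j ω) - m) m
    rw [sub_add_cancel] at h2
    have h3 : ‖sampleMean (fun j => Y j ω)‖ ^ 2 ≤ (‖sampleMean (fun j => Y j ω) - m‖ + ‖m‖) ^ 2 := by
      gcongr
    nlinarith [sq_nonneg (‖sampleMean (fun j => Y j ω) - m‖ - ‖m‖),
      sq_nonneg ((∑ j, ‖Y j ω - m‖ ^ 2) ^ 2 - 1), sq_nonneg (∑ j, ‖Y j ω - m‖ ^ 2 - 1)]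
  refine ⟨i0.integrable, (integral_mono i0.integrable
    ((HasAllMoments.const (P := P) _).add i1).integrable e).trans ?_⟩
  rw [integral_add (integrable_const _) i1.integrable, integral_const_mul]
  have h1 := hY.integral_devSq_pow_four_le
  have h3 := devConst_nonneg (n := n) (ι := ι)
  have h4 := hY.one_add_trace_le
  have h6 := mul_le_mul_of_nonneg_left h4 (noiseConst_nonneg (n := n) (ι := ι))
  refine le_trans ?_ h6
  simp only [integral_const, probReal_univ, one_smul, noiseConst]
  have h5 : 0 ≤ Sig.trace ^ 4 := by positivity
  nlinarith [mul_nonneg h3 h5, mul_nonneg h3 (sq_nonneg ‖m‖)]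

theorem integral_norm_covEst_sq_le (hn : 3 ≤ n) :
    Integrable (fun ω => ‖covEst n (sampleScatter (fun j => Y j ω))‖ ^ 2) P ∧
    ∫ ω, ‖covEst n (sampleScatter (fun j => Y j ω))‖ ^ 2 ∂P ≤
      noiseConst n ι * momentSize m Sig := by
  have := hY.isProbabilityMeasure
  have i0 : HasAllMoments (fun ω => ‖covEst n (sampleScatter (fun j => Y j ω))‖ ^ 2) P := by
    simp only [covEst, norm_smul, mul_pow]
    exact (hY.allMoments_norm_scatter_sq hn).const_mul _
  have i1 := hY.allMoments_devSq.pow 4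
  have e : ∀ ω, ‖covEst n (sampleScatter (fun j => Y j ω))‖ ^ 2 ≤
      1 + (∑ j, ‖Y j ω - m‖ ^ 2) ^ 4 := fun ω => by
    have h1 := norm_covEst_le hn (fun j => Y j ω) m
    have h3 : ‖covEst n (sampleScatter (fun j => Y j ω))‖ ^ 2 ≤ (∑ j, ‖Y j ω - m‖ ^ 2) ^ 2 := by
      gcongr
    nlinarith [sq_nonneg ((∑ j, ‖Y j ω - m‖ ^ 2) ^ 2 - 1)]
  refine ⟨i0.integrable, (integral_mono i0.integrable
    ((HasAllMoments.const (P := P) _).add i1).integrable e).trans ?_⟩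
  rw [integral_add (integrable_const _) i1.integrable]
  have h1 := hY.integral_devSq_pow_four_le
  have h3 := devConst_nonneg (n := n) (ι := ι)
  have h4 := hY.one_add_trace_le
  have h6 := mul_le_mul_of_nonneg_left h4 (noiseConst_nonneg (n := n) (ι := ι))
  refine le_trans ?_ h6
  simp only [integral_const, probReal_univ, one_smul, noiseConst]
  have h5 : 0 ≤ Sig.trace ^ 4 := by positivity
  nlinarith [mul_nonneg h3 h5, mul_nonneg h3 (sq_nonneg ‖m‖), sq_nonneg ‖m‖]

end IsGaussianSample

end noise

/-! ### Averages over independent populations -/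

section averages

variable {Ω : Type*} [MeasurableSpace Ω] {P : Measure Ω}

theorem integral_avg {p : ℕ} {f : ℕ → Ω → ℝ} (h : ∀ i, Integrable (f i) P) :
    ∫ ω, avg p (fun i => f i ω) ∂P = avg p fun i => ∫ ω, f i ω ∂P := by
  simp only [avg, smul_eq_mul]
  rw [integral_const_mul, integral_finsetSum _ fun i _ => h i]

theorem integrable_avg {p : ℕ} {f : ℕ → Ω → ℝ} (h : ∀ i, Integrable (f i) P) :
    Integrable (fun ω => avg p (fun i => f i ω)) P := by
  simp only [avg, smul_eq_mul]
  exact (integrable_finsetSum _ fun i _ => h i).const_mul _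

/-- The average of `p` independent noise terms has a second moment of order `1 / p`. -/
theorem integral_avg_sq_le [IsProbabilityMeasure P] {p : ℕ} {f : ℕ → Ω → ℝ} {B : ℕ → ℝ}
    (h : ∀ i, IsNoise (f i) (B i) P) (hi : Pairwise fun i j => IndepFun (f i) (f j) P) :
    Integrable (fun ω => avg p (fun i => f i ω) ^ 2) P ∧
      ∫ ω, avg p (fun i => f i ω) ^ 2 ∂P ≤ (p : ℝ)⁻¹ * avg p B := by
  have hm : ∀ i, MemLp (f i) 2 P := fun i => (h i).allMoments.memLp_two
  have hs : HasAllMoments (fun ω => ∑ i ∈ Finset.range p, f i ω) P := .sum fun i => (h i).allMoments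
  have h0 : ∫ ω, ∑ i ∈ Finset.range p, f i ω ∂P = 0 := by
    rw [integral_finsetSum _ fun i _ => (h i).allMoments.integrable]
    simp [(h _).integral_eq_zero]
  have hv := IndepFun.variance_sum (s := Finset.range p) (X := f) (fun i _ => hm i)
    fun i _ j _ hij => hi hij
  have e : (∑ i ∈ Finset.range p, f i) = fun ω => ∑ i ∈ Finset.range p, f i ω := by
    ext ω; simp
  rw [e, variance_of_integral_eq_zero hs.integrable.aemeasurable h0] at hv
  have hv2 : ∀ i, Var[f i; P] = ∫ ω, f i ω ^ 2 ∂P := fun i =>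
    variance_of_integral_eq_zero (hm i).aemeasurable (h i).integral_eq_zero
  simp only [hv2] at hv
  simp only [avg, smul_eq_mul, mul_pow]
  refine ⟨((hs.pow 2).const_mul _).integrable, ?_⟩
  rw [integral_const_mul, hv, pow_two, mul_assoc]
  gcongr with i _
  exact (h i).integral_sq_le

/-- If each of the independent variables `A i` is, truncated at `K`, small in the mean unless it
has a good chance of reaching `K`, then the average of `A i` over `i < p` is small in the mean on
the event that none of them reaches `K`. Indeed, for different `i`, the events that `A i` is the only
variable that reaches `K` are disjoint. -/
theorem integral_avg_indicator_le [IsProbabilityMeasure P] {A : ℕ → Ω → ℝ} {η C K : ℝ}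
    (hη : 0 ≤ η) (hC : 0 ≤ C) (hA : ∀ i, Measurable (A i)) (hA0 : ∀ i, Integrable (A i) P)
    (hind : ∀ i (t : Finset ℕ), i ∉ t → IndepFun (A i) (fun ω (l : t) => A l ω) P)
    (hb : ∀ i, ∫ ω, {ω | A i ω < K}.indicator (A i) ω ∂P ≤ η + C * P.real {ω | K ≤ A i ω})
    {p : ℕ} (hp : 0 < p) :
    ∫ ω, {ω | ∀ i < p, A i ω < K}.indicator (fun ω => avg p fun i => A i ω) ω ∂P ≤
      η + C * (p : ℝ)⁻¹ := by
  -- the event that none of the other variables reaches `K`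
  let T : ℕ → Set Ω := fun i => {ω | ∀ l ∈ (Finset.range p).erase i, A l ω < K}
  have hTm : ∀ i, MeasurableSet (T i) := fun i => by
    have : T i = ⋂ l ∈ (Finset.range p).erase i, {ω | A l ω < K} := by ext; simp [T]
    rw [this]
    exact Finset.measurableSet_biInter _ fun l _ => measurableSet_lt (hA l) measurable_const
  let G : ∀ i, (((Finset.range p).erase i : Finset ℕ) → ℝ) → ℝ := fun i =>
    {z | ∀ l, z l < K}.indicator 1
  have hGm : ∀ i, Measurable (G i) := fun i => by
    refine measurable_one.indicator ?_
    have : {z : ((Finset.range p).erase i : Finset ℕ) → ℝ | ∀ l, z l < K} = ⋂ l, {z | z l < K} := by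
      ext; simp
    rw [this]
    exact MeasurableSet.iInter fun l => measurableSet_lt (measurable_pi_apply l) measurable_const
  have hG : ∀ i ω, G i (fun l => A l ω) = (T i).indicator 1 ω := fun i ω => by
    have e : (∀ l : ((Finset.range p).erase i : Finset ℕ), A l ω < K) ↔ ω ∈ T i :=
      ⟨fun h l hl => h ⟨l, hl⟩, fun h l => h l l.2⟩
    by_cases h : ω ∈ T i
    · have h' : (fun l : ((Finset.range p).erase i : Finset ℕ) => A l ω) ∈
          {z : ((Finset.range p).erase i : Finset ℕ) → ℝ | ∀ l, z l < K} := e.2 h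
      rw [Set.indicator_of_mem h]
      exact Set.indicator_of_mem h' _
    · have h' : (fun l : ((Finset.range p).erase i : Finset ℕ) => A l ω) ∉
          {z : ((Finset.range p).erase i : Finset ℕ) → ℝ | ∀ l, z l < K} := fun h' => h (e.1 h')
      rw [Set.indicator_of_notMem h]
      exact Set.indicator_of_notMem h' _
  have hI : ∀ i (g : ℝ → ℝ), Measurable g → ∫ ω, g (A i ω) * (T i).indicator 1 ω ∂P =
      (∫ ω, g (A i ω) ∂P) * P.real (T i) := fun i g hg => by
    have h1 := ((hind i _ (Finset.notMem_erase i (Finset.range p))).comp hg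
      (hGm i)).integral_fun_mul_eq_mul_integral (hg.comp (hA i)).aestronglyMeasurable
      ((hGm i).comp (measurable_pi_lambda _ fun l => hA l)).aestronglyMeasurable
    simp only [Function.comp_def, hG] at h1
    rw [h1, integral_indicator_one (hTm i)]
  have key : ∀ i, ∫ ω, {ω | A i ω < K}.indicator (A i) ω * (T i).indicator 1 ω ∂P ≤
      η + C * P.real ({ω | K ≤ A i ω} ∩ T i) := fun i => by
    have h1 := hI i ({x | x < K}.indicator id) (measurable_id.indicator measurableSet_Iio)
    have h2 := hI i ({x | K ≤ x}.indicator 1) (measurable_one.indicator measurableSet_Ici)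
    have e1 : ∀ ω, {x | x < K}.indicator id (A i ω) = {ω | A i ω < K}.indicator (A i) ω :=
      fun ω => by simp [Set.indicator_apply]
    have e2 : ∀ ω, ({x | K ≤ x}.indicator 1 (A i ω) : ℝ) = {ω | K ≤ A i ω}.indicator 1 ω :=
      fun ω => by simp [Set.indicator_apply]
    have e3 : ∀ ω, ({ω | K ≤ A i ω}.indicator 1 ω * (T i).indicator 1 ω : ℝ) =
        ({ω | K ≤ A i ω} ∩ T i).indicator 1 ω := fun ω => by
      rw [Set.inter_indicator_one, Pi.mul_apply]
    have hK : MeasurableSet {ω | K ≤ A i ω} := measurableSet_le measurable_const (hA i)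
    simp only [e1] at h1
    simp only [e2] at h2
    simp only [e3] at h2
    rw [integral_indicator_one hK, integral_indicator_one (hK.inter (hTm i))] at h2
    rw [h1, h2]
    have h3 := mul_le_mul_of_nonneg_right (hb i) (measureReal_nonneg (μ := P) (s := T i))
    have h4 : η * P.real (T i) ≤ η := mul_le_of_le_one_right hη measureReal_le_one
    linarith
  have split : ∀ ω, {ω | ∀ i < p, A i ω < K}.indicator (fun ω => avg p fun i => A i ω) ω =
      (p : ℝ)⁻¹ * ∑ i ∈ Finset.range p,
        {ω | A i ω < K}.indicator (A i) ω * (T i).indicator 1 ω := fun ω => by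
    by_cases h : ∀ i < p, A i ω < K
    · rw [Set.indicator_of_mem (show ω ∈ {ω | ∀ i < p, A i ω < K} from h), avg, smul_eq_mul]
      congr 1
      refine Finset.sum_congr rfl fun i hi => ?_
      have h1 : ω ∈ T i := fun l hl => h l (Finset.mem_range.1 (Finset.mem_of_mem_erase hl))
      have h2 : ω ∈ {ω | A i ω < K} := h i (Finset.mem_range.1 hi)
      rw [Set.indicator_of_mem h1, Set.indicator_of_mem h2]
      simp
    · rw [Set.indicator_of_notMem (show ω ∉ {ω | ∀ i < p, A i ω < K} from h)]
      refine (mul_eq_zero_of_right _ (Finset.sum_eq_zero fun i hi => ?_)).symm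
      by_cases h1 : ω ∈ T i
      · have h2 : ω ∉ {ω | A i ω < K} := fun h2 => h fun l hl => by
          rcases eq_or_ne l i with rfl | hli
          · exact h2
          · exact h1 l (Finset.mem_erase.2 ⟨hli, Finset.mem_range.2 hl⟩)
        rw [Set.indicator_of_notMem h2, zero_mul]
      · rw [Set.indicator_of_notMem h1, mul_zero]
  have hint : ∀ i, Integrable
      (fun ω => {ω | A i ω < K}.indicator (A i) ω * (T i).indicator 1 ω) P := fun i => by
    have e : (fun ω => {ω | A i ω < K}.indicator (A i) ω * (T i).indicator 1 ω) =
        (T i).indicator ({ω | A i ω < K}.indicator (A i)) := by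
      ext ω
      by_cases h1 : ω ∈ T i <;> simp [h1]
    rw [e]
    exact ((hA0 i).indicator (measurableSet_lt (hA i) measurable_const)).indicator (hTm i)
  have disj : ∑ i ∈ Finset.range p, P.real ({ω | K ≤ A i ω} ∩ T i) ≤ 1 := by
    refine (sum_measureReal_le_measureReal_univ (μ := P) (fun i _ =>
      ((measurableSet_le measurable_const (hA i)).inter (hTm i))) ?_).trans
      measureReal_le_one
    intro i hi j hj hij
    refine Set.disjoint_left.2 fun ω h1 h2 => ?_
    have h3 : A i ω < K := h2.2 i (Finset.mem_erase.2 ⟨hij, hi⟩)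
    exact absurd h3 (not_lt.2 h1.1)
  simp only [split]
  rw [integral_const_mul, integral_finsetSum _ fun i _ => hint i]
  calc (p : ℝ)⁻¹ * ∑ i ∈ Finset.range p,
        ∫ ω, {ω | A i ω < K}.indicator (A i) ω * (T i).indicator 1 ω ∂P
      ≤ (p : ℝ)⁻¹ * ∑ i ∈ Finset.range p, (η + C * P.real ({ω | K ≤ A i ω} ∩ T i)) := by
        gcongr with i _
        exact key i
    _ = η + (p : ℝ)⁻¹ * (C * ∑ i ∈ Finset.range p, P.real ({ω | K ≤ A i ω} ∩ T i)) := by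
        have hp' : (p : ℝ) ≠ 0 := by positivity
        rw [Finset.sum_add_distrib, ← Finset.mul_sum, Finset.sum_const, Finset.card_range,
          nsmul_eq_mul]
        field_simp
    _ ≤ η + (p : ℝ)⁻¹ * (C * 1) := by gcongr
    _ = η + C * (p : ℝ)⁻¹ := by ring

end averages

/-! ### The tail of the scatter matrix -/

section tail

variable {Ω : Type*} [MeasurableSpace Ω] {P : Measure Ω} {ι : Type*} [Fintype ι] {n : ℕ}

theorem gaussianReal_tail_pos (K : ℝ) {v : ℝ} (hv : 0 < v) :
    0 < (gaussianReal 0 1).real {x | K ≤ v * x ^ 2} := by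
  have h : Set.Ioi √(|K| / v) ⊆ {x : ℝ | K ≤ v * x ^ 2} := fun x hx => by
    have h1 : |K| / v < x ^ 2 := (Real.sqrt_lt' ((Real.sqrt_nonneg _).trans_lt hx)).1 hx
    rw [div_lt_iff₀ hv] at h1
    have := le_abs_self K
    change K ≤ v * x ^ 2
    linarith
  refine lt_of_lt_of_le ?_ (measureReal_mono h)
  rw [measureReal_def, ENNReal.toReal_pos_iff]
  refine ⟨pos_iff_ne_zero.2 fun h0 => ?_, measure_lt_top _ _⟩
  have := gaussianReal_absolutelyContinuous' 0 one_ne_zero h0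
  simp at this

theorem continuous_sampleMean :
    Continuous fun y : Fin n → EuclideanSpace ℝ ι => sampleMean y := by
  unfold sampleMean
  fun_prop

theorem continuous_flat_sampleScatter :
    Continuous fun y : Fin n → EuclideanSpace ℝ ι => flat (sampleScatter y) := by
  unfold flat
  simp only [sampleScatter_apply]
  refine (PiLp.continuous_toLp 2 _).comp (continuous_pi fun ab => ?_)
  have := continuous_sampleMean (n := n) (ι := ι)
  fun_prop

variable [DecidableEq ι]

/-- The norm of the scatter matrix, truncated at `K`, is small in the mean unless it has a good
chance of reaching `K`: either the trace of the covariance matrix is small, or one of the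
residuals is a normal variable whose variance is bounded away from zero. The constant does not
depend on the parameters. -/
theorem exists_scatter_tail_bound (hn : 3 ≤ n) (P : Measure Ω) {η : ℝ} (hη : 0 < η) (K : ℝ) :
    ∃ C : ℝ, 0 ≤ C ∧ ∀ (Y : Fin n → Ω → EuclideanSpace ℝ ι) (m : EuclideanSpace ℝ ι)
      (Sig : Matrix ι ι ℝ), (∀ j, Measurable (Y j)) → IsGaussianSample Y m Sig P →
      ∫ ω, {ω | ‖flat (sampleScatter fun j => Y j ω)‖ < K}.indicator
          (fun ω => ‖flat (sampleScatter fun j => Y j ω)‖) ω ∂P ≤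
        η + C * P.real {ω | K ≤ ‖flat (sampleScatter fun j => Y j ω)‖} := by
  have hn' : (3 : ℝ) ≤ n := by exact_mod_cast hn
  have hn0 : 0 < n := by omega
  rcases isEmpty_or_nonempty ι with hι | hι
  · refine ⟨0, le_rfl, fun Y m Sig _ _ => ?_⟩
    have e : ∀ ω, ‖flat (sampleScatter fun j => Y j ω)‖ = 0 := fun ω => by
      rw [Subsingleton.elim (flat _) (0 : EuclideanSpace ℝ (ι × ι)), norm_zero]
    simp only [e, Set.indicator_zero, integral_zero]
    linarith
  have hc : (0 : ℝ) < Fintype.card ι := by exact_mod_cast Fintype.card_pos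
  -- the lower bound for the variance of the residual
  set v₀ : ℝ := (1 - (n : ℝ)⁻¹) * (η / (n - 1) / Fintype.card ι) with hv₀
  have h1n : 0 < 1 - (n : ℝ)⁻¹ := by
    have : (n : ℝ)⁻¹ < 1 := inv_lt_one_of_one_lt₀ (by linarith)
    linarith
  have hv₀p : 0 < v₀ := by
    have : (0 : ℝ) < n - 1 := by linarith
    positivity
  set δ := (gaussianReal 0 1).real {x | K ≤ v₀ * x ^ 2}
  have hδ : 0 < δ := gaussianReal_tail_pos K hv₀p
  refine ⟨|K| / δ, by positivity, fun Y m Sig hYm hY => ?_⟩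
  have := hY.isProbabilityMeasure
  have hSm : Measurable fun ω => ‖flat (sampleScatter fun j => Y j ω)‖ :=
    (continuous_flat_sampleScatter (n := n) (ι := ι)).norm.measurable.comp
      (measurable_pi_lambda (fun ω j => Y j ω) hYm)
  have hset := measurableSet_lt hSm (measurable_const (a := K))
  have hSi : Integrable (fun ω => ‖flat (sampleScatter fun j => Y j ω)‖) P :=
    (hY.allMoments_trace_scatter hn).integrable.mono' hSm.aestronglyMeasurable
      (ae_of_all _ fun ω => by
        rw [norm_norm]; exact norm_flat_sampleScatter_le _)
  rcases le_or_gt ((n - 1) * Sig.trace) η with hs | hs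
  · calc _ ≤ ∫ ω, (sampleScatter fun j => Y j ω).trace ∂P := by
          refine integral_mono (hSi.indicator hset)
            (hY.allMoments_trace_scatter hn).integrable fun ω => ?_
          exact (Set.indicator_le_self' (fun _ _ => norm_nonneg _) ω).trans
            (norm_flat_sampleScatter_le _)
      _ ≤ η := by rwa [hY.integral_trace_scatter hn]
      _ ≤ _ := le_add_of_nonneg_right (by positivity)
  · obtain ⟨a, ha⟩ : ∃ a, η / (n - 1) / Fintype.card ι ≤ Sig a a := by
      by_contra! hlt
      have h1 : Sig.trace ≤ ∑ _a : ι, η / (n - 1) / Fintype.card ι :=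
        Finset.sum_le_sum fun a _ => (hlt a).le
      rw [Finset.sum_const, Finset.card_univ, nsmul_eq_mul, mul_div_cancel₀ _ hc.ne',
        le_div_iff₀ (by linarith)] at h1
      linarith
    let j : Fin n := ⟨0, hn0⟩
    let g : Ω → ℝ := fun ω => Y j ω a - sampleMean (fun j => Y j ω) a
    have hg : HasGaussianLaw g P := by
      have h := hY.hasGaussianLaw.map_fun ((EuclideanSpace.proj (𝕜 := ℝ) a).comp
        (ContinuousLinearMap.proj (R := ℝ) j) - (n : ℝ)⁻¹ • ∑ l,
          (EuclideanSpace.proj (𝕜 := ℝ) a).comp (ContinuousLinearMap.proj (R := ℝ) l))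
      refine h.congr (ae_of_all _ fun ω => ?_)
      simp [g, sampleMean_apply]
    have hg0 : ∫ ω, g ω ∂P = 0 := hY.integral_res hn0 j a
    have hgv : ∫ ω, g ω ^ 2 ∂P = (1 - (n : ℝ)⁻¹) * Sig a a := by
      simp only [g, pow_two, hY.integral_res_mul_res hn0, if_true]
    have hv : v₀ ≤ (1 - (n : ℝ)⁻¹) * Sig a a := by rw [hv₀]; gcongr
    have hlaw : HasLaw g ((gaussianReal 0 1).map fun x => √((1 - (n : ℝ)⁻¹) * Sig a a) * x) P := by
      refine ⟨hg.aemeasurable, ?_⟩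
      rw [hg.map_eq_gaussianReal, hg0, variance_of_integral_eq_zero hg.aemeasurable hg0, hgv,
        gaussianReal_map_const_mul, mul_zero, mul_one]
      congr 1
      ext
      rw [Real.coe_toNNReal _ (hv₀p.le.trans hv)]
      exact (Real.sq_sqrt (hv₀p.le.trans hv)).symm
    have hP : δ ≤ P.real {ω | K ≤ ‖flat (sampleScatter fun j => Y j ω)‖} := by
      have hm2 : MeasurableSet {x : ℝ | K ≤ x ^ 2} :=
        measurableSet_le measurable_const (by fun_prop)
      have h1 := hlaw.measureReal_eq hm2
      rw [map_measureReal_apply (by fun_prop) hm2] at h1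
      calc δ ≤ (gaussianReal 0 1).real
            ((fun x => √((1 - (n : ℝ)⁻¹) * Sig a a) * x) ⁻¹' {x | K ≤ x ^ 2}) := by
            refine measureReal_mono fun x hx => ?_
            change K ≤ (√((1 - (n : ℝ)⁻¹) * Sig a a) * x) ^ 2
            rw [mul_pow, Real.sq_sqrt (hv₀p.le.trans hv)]
            exact le_trans hx (by gcongr)
        _ = P.real {ω | K ≤ g ω ^ 2} := h1.symm
        _ ≤ _ := by
            refine measureReal_mono fun ω hω => ?_
            refine le_trans (show K ≤ g ω ^ 2 from hω) ?_
            have h2 := PiLp.norm_apply_le (flat (sampleScatter fun j => Y j ω)) (a, a)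
            rw [Real.norm_eq_abs, flat_apply, sampleScatter_apply] at h2
            refine le_trans ?_ ((le_abs_self _).trans h2)
            simp only [← pow_two]
            exact Finset.single_le_sum
              (f := fun j => (Y j ω a - sampleMean (fun j => Y j ω) a) ^ 2)
              (fun _ _ => sq_nonneg _) (Finset.mem_univ j)
    have hK : ∫ ω, {ω | ‖flat (sampleScatter fun j => Y j ω)‖ < K}.indicator
          (fun ω => ‖flat (sampleScatter fun j => Y j ω)‖) ω ∂P ≤ |K| := by
      calc _ ≤ ∫ _ω, |K| ∂P := by
            refine integral_mono (hSi.indicator hset) (integrable_const _) fun ω => ?_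
            refine Set.indicator_apply_le' (fun h => ?_) fun _ => abs_nonneg K
            exact (le_of_lt h).trans (le_abs_self K)
        _ = |K| := by simp
    have h2 : |K| ≤ |K| / δ * P.real {ω | K ≤ ‖flat (sampleScatter fun j => Y j ω)‖} := by
      rw [div_mul_eq_mul_div, le_div_iff₀ hδ]
      gcongr
    linarith

end tail

/-! ### Independent Gaussian samples -/

section array

variable {Ω : Type*} {ι : Type*} [Fintype ι]
  {n : ℕ}

theorem measurable_avg [MeasurableSpace Ω] {κ : Type*} [Fintype κ] {f : ℕ → Ω → EuclideanSpace ℝ κ}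
    (h : ∀ i, Measurable (f i)) (p : ℕ) : Measurable fun ω => avg p fun i => f i ω := by
  have : Measurable fun ω => ∑ i ∈ Finset.range p, f i ω := Finset.measurable_sum _ fun i _ => h i
  exact this.const_smul (p : ℝ)⁻¹

theorem norm_avg_sq_eq_sum {κ : Type*} [Fintype κ] (p : ℕ) (f : ℕ → EuclideanSpace ℝ κ) :
    ‖avg p f‖ ^ 2 = ∑ a, avg p (fun i => f i a) ^ 2 := by
  rw [EuclideanSpace.real_norm_sq_eq]
  simp [avg]

theorem continuous_trace_sampleScatter :
    Continuous fun y : Fin n → EuclideanSpace ℝ ι => (sampleScatter y).trace := by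
  simp only [trace_sampleScatter]
  have := continuous_sampleMean (n := n) (ι := ι)
  fun_prop

theorem continuous_meanVarEst :
    Continuous fun y : Fin n → EuclideanSpace ℝ ι => meanVarEst n (sampleScatter y) :=
  continuous_trace_sampleScatter.div_const _

theorem continuous_covEst :
    Continuous fun y : Fin n → EuclideanSpace ℝ ι => covEst n (sampleScatter y) := by
  have h := continuous_flat_sampleScatter (n := n) (ι := ι)
  unfold covEst
  fun_prop

theorem continuous_covRiskEst :
    Continuous fun y : Fin n → EuclideanSpace ℝ ι => covRiskEst n (sampleScatter y) := by
  have h1 := continuous_trace_sampleScatter (n := n) (ι := ι)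
  have h2 := continuous_flat_sampleScatter (n := n) (ι := ι)
  unfold covRiskEst
  fun_prop

theorem continuous_covSqEst :
    Continuous fun y : Fin n → EuclideanSpace ℝ ι => covSqEst n (sampleScatter y) := by
  have h1 := continuous_trace_sampleScatter (n := n) (ι := ι)
  have h2 := continuous_flat_sampleScatter (n := n) (ι := ι)
  unfold covSqEst
  fun_prop

/-- The average norm of the scatter matrices on the event that the norms of all of
them are smaller than `K`. -/
def truncScatter (Y : ℕ → Fin n → Ω → EuclideanSpace ℝ ι) (K : ℝ) (p : ℕ) (ω : Ω) : ℝ :=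
  {ω | ∀ i < p, ‖flat (sampleScatter fun j => Y i j ω)‖ < K}.indicator
    (fun ω => avg p fun i => ‖flat (sampleScatter fun j => Y i j ω)‖) ω

theorem truncScatter_nonneg (Y : ℕ → Fin n → Ω → EuclideanSpace ℝ ι) (K : ℝ) (p : ℕ) (ω : Ω) :
    0 ≤ truncScatter Y K p ω :=
  Set.indicator_nonneg (fun _ _ => avg_nonneg fun _ => norm_nonneg _) _

variable [MeasurableSpace Ω] {P : Measure Ω} [DecidableEq ι]

/-- A sequence of independent Gaussian samples of size `n`, with varying parameters. -/
structure IsGaussianArray (Y : ℕ → Fin n → Ω → EuclideanSpace ℝ ι) (m : ℕ → EuclideanSpace ℝ ι)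
    (Sig : ℕ → Matrix ι ι ℝ) (P : Measure Ω) : Prop where
  measurable : ∀ i j, Measurable (Y i j)
  sample : ∀ i, IsGaussianSample (Y i) (m i) (Sig i) P
  indep : iIndepFun (fun ij : ℕ × Fin n => Y ij.1 ij.2) P

/-- The noise in the risk estimate, see `noiseSq`, as a random variable. -/
def arrayNoise (Y : ℕ → Fin n → Ω → EuclideanSpace ℝ ι) (m : ℕ → EuclideanSpace ℝ ι)
    (Sig : ℕ → Matrix ι ι ℝ) (p : ℕ) (ω : Ω) : ℝ :=
  noiseSq (fun i => sampleMean fun j => Y i j ω) m (fun i => covEst n (sampleScatter fun j => Y i j ω))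
    (fun i => flat (Sig i)) (fun i => meanVarEst n (sampleScatter fun j => Y i j ω))
    (fun i => covRiskEst n (sampleScatter fun j => Y i j ω))
    (fun i => covSqEst n (sampleScatter fun j => Y i j ω)) p

namespace IsGaussianArray

variable {Y : ℕ → Fin n → Ω → EuclideanSpace ℝ ι} {m : ℕ → EuclideanSpace ℝ ι}
  {Sig : ℕ → Matrix ι ι ℝ} (hY : IsGaussianArray Y m Sig P)

include hY

theorem measurable_sample (i : ℕ) : Measurable fun ω j => Y i j ω :=
  measurable_pi_lambda _ (hY.measurable i)

theorem indepFun_sample {i : ℕ} {t : Finset ℕ} (hi : i ∉ t) :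
    IndepFun (fun ω j => Y i j ω) (fun ω (l : t) j => Y l j ω) P := by
  have hd : Disjoint (({i} : Finset ℕ) ×ˢ (Finset.univ : Finset (Fin n)))
      (t ×ˢ (Finset.univ : Finset (Fin n))) := by
    rw [Finset.disjoint_left]
    rintro ⟨l, j⟩ h1 h2
    simp only [Finset.mem_product, Finset.mem_singleton, Finset.mem_univ, and_true] at h1 h2
    exact hi (h1 ▸ h2)
  have h := hY.indep.indepFun_finset _ _ hd fun ij => hY.measurable ij.1 ij.2
  exact h.comp
    (φ := fun z (j : Fin n) => z ⟨(i, j), by simp⟩)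
    (ψ := fun z (l : t) (j : Fin n) => z ⟨(l, j), by simp⟩)
    (measurable_pi_lambda _ fun j => measurable_pi_apply _)
    (measurable_pi_lambda _ fun l => measurable_pi_lambda _ fun j => measurable_pi_apply _)

theorem indepFun_stat {φ : ℕ → (Fin n → EuclideanSpace ℝ ι) → ℝ} (hφ : ∀ i, Measurable (φ i))
    {i : ℕ} {t : Finset ℕ} (hi : i ∉ t) :
    IndepFun (fun ω => φ i fun j => Y i j ω) (fun ω (l : t) => φ l fun j => Y l j ω) P :=
  (hY.indepFun_sample hi).comp (φ := φ i)
    (ψ := fun (z : t → Fin n → EuclideanSpace ℝ ι) (l : t) => φ l (z l)) (hφ i)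
    (measurable_pi_lambda _ fun l => (hφ l).comp (measurable_pi_apply l))

theorem pairwise_indepFun_stat {φ : ℕ → (Fin n → EuclideanSpace ℝ ι) → ℝ}
    (hφ : ∀ i, Measurable (φ i)) :
    Pairwise fun i l => IndepFun (fun ω => φ i fun j => Y i j ω) (fun ω => φ l fun j => Y l j ω) P :=
  fun i l hil => (hY.indepFun_stat hφ (t := {l}) (by simpa using hil)).comp
    (φ := id) (ψ := fun z : ({l} : Finset ℕ) → ℝ => z ⟨l, by simp⟩) measurable_id
    (measurable_pi_apply (⟨l, by simp⟩ : ({l} : Finset ℕ)))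

theorem isProbabilityMeasure : IsProbabilityMeasure P := hY.indep.isProbabilityMeasure

theorem integral_avg_stat_sq_le {φ : ℕ → (Fin n → EuclideanSpace ℝ ι) → ℝ}
    (hφ : ∀ i, Measurable (φ i))
    (h : ∀ i, IsNoise (fun ω => φ i fun j => Y i j ω)
      (noiseConst n ι * momentSize (m i) (Sig i)) P) (p : ℕ) :
    Integrable (fun ω => avg p (fun i => φ i fun j => Y i j ω) ^ 2) P ∧
      ∫ ω, avg p (fun i => φ i fun j => Y i j ω) ^ 2 ∂P ≤
        (p : ℝ)⁻¹ * (noiseConst n ι * avg p fun i => momentSize (m i) (Sig i)) := by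
  have := hY.isProbabilityMeasure
  have h1 := integral_avg_sq_le (p := p) h (hY.pairwise_indepFun_stat hφ)
  rwa [avg_mul] at h1

theorem integral_arrayNoise_le (hn : 3 ≤ n) (p : ℕ) :
    Integrable (arrayNoise Y m Sig p) P ∧ ∫ ω, arrayNoise Y m Sig p ω ∂P ≤
      (5 + Fintype.card ι + Fintype.card (ι × ι)) *
        ((p : ℝ)⁻¹ * (noiseConst n ι * avg p fun i => momentSize (m i) (Sig i))) := by
  have c1 := continuous_sampleMean (n := n) (ι := ι)
  have c2 := continuous_covEst (n := n) (ι := ι)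
  have c3 := continuous_meanVarEst (n := n) (ι := ι)
  have c4 := continuous_covRiskEst (n := n) (ι := ι)
  have c5 := continuous_covSqEst (n := n) (ι := ι)
  obtain ⟨i1, b1⟩ := hY.integral_avg_stat_sq_le
    (φ := fun i y => ‖sampleMean y - m i‖ ^ 2 - meanVarEst n (sampleScatter y))
    (fun i => Continuous.measurable (by fun_prop)) (fun i => (hY.sample i).mean_stat_noise hn) p
  obtain ⟨i2, b2⟩ := hY.integral_avg_stat_sq_le
    (φ := fun i y => ⟪sampleMean y - m i, sampleMean y⟫ - meanVarEst n (sampleScatter y))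
    (fun i => Continuous.measurable (by fun_prop)) (fun i => (hY.sample i).inner_mean_stat_noise hn) p
  have h3 := fun a => hY.integral_avg_stat_sq_le (φ := fun i y => (sampleMean y - m i) a)
    (fun i => Continuous.measurable (by fun_prop)) (fun i => (hY.sample i).mean_coord_noise hn a) p
  have h4 := fun ab => hY.integral_avg_stat_sq_le
    (φ := fun i y => (covEst n (sampleScatter y) - flat (Sig i)) ab)
    (fun i => Continuous.measurable (by fun_prop)) (fun i => (hY.sample i).cov_coord_noise hn ab) p
  obtain ⟨i5, b5⟩ := hY.integral_avg_stat_sq_le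
    (φ := fun i y => ‖covEst n (sampleScatter y)‖ ^ 2 - covRiskEst n (sampleScatter y) -
      ‖flat (Sig i)‖ ^ 2)
    (fun i => Continuous.measurable (by fun_prop)) (fun i => (hY.sample i).cov_risk_noise hn) p
  obtain ⟨i6, b6⟩ := hY.integral_avg_stat_sq_le
    (φ := fun i y => ⟪covEst n (sampleScatter y), flat (Sig i)⟫ - ‖flat (Sig i)‖ ^ 2)
    (fun i => Continuous.measurable (by fun_prop)) (fun i => (hY.sample i).cov_inner_noise hn) p
  obtain ⟨i7, b7⟩ := hY.integral_avg_stat_sq_le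
    (φ := fun i y => covSqEst n (sampleScatter y) - ‖flat (Sig i)‖ ^ 2)
    (fun i => Continuous.measurable (by fun_prop)) (fun i => (hY.sample i).cov_sq_noise hn) p
  have i3 : Integrable (fun ω => ‖avg p fun i => (sampleMean fun j => Y i j ω) - m i‖ ^ 2) P := by
    simp only [norm_avg_sq_eq_sum]
    exact integrable_finsetSum _ fun a _ => (h3 a).1
  have i4 : Integrable (fun ω => ‖avg p fun i =>
      covEst n (sampleScatter fun j => Y i j ω) - flat (Sig i)‖ ^ 2) P := by
    simp only [norm_avg_sq_eq_sum]
    exact integrable_finsetSum _ fun ab _ => (h4 ab).1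
  have b3 : ∫ ω, ‖avg p fun i => (sampleMean fun j => Y i j ω) - m i‖ ^ 2 ∂P ≤ Fintype.card ι *
      ((p : ℝ)⁻¹ * (noiseConst n ι * avg p fun i => momentSize (m i) (Sig i))) := by
    simp only [norm_avg_sq_eq_sum]
    rw [integral_finsetSum _ fun a _ => (h3 a).1, ← nsmul_eq_mul, ← Finset.card_univ,
      ← Finset.sum_const]
    exact Finset.sum_le_sum fun a _ => (h3 a).2
  have b4 : ∫ ω, ‖avg p fun i => covEst n (sampleScatter fun j => Y i j ω) - flat (Sig i)‖ ^ 2 ∂P ≤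
      Fintype.card (ι × ι) *
        ((p : ℝ)⁻¹ * (noiseConst n ι * avg p fun i => momentSize (m i) (Sig i))) := by
    simp only [norm_avg_sq_eq_sum]
    rw [integral_finsetSum _ fun a _ => (h4 a).1, ← nsmul_eq_mul, ← Finset.card_univ,
      ← Finset.sum_const]
    exact Finset.sum_le_sum fun a _ => (h4 a).2
  have add : ∀ {f g : Ω → ℝ}, Integrable f P → Integrable g P →
      Integrable (fun ω => f ω + g ω) P := fun hf hg => hf.add hg
  have s2 := add i1 i2
  have s3 := add s2 i3
  have s4 := add s3 i4
  have s5 := add s4 i5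
  have s6 := add s5 i6
  unfold arrayNoise noiseSq
  refine ⟨add s6 i7, ?_⟩
  rw [integral_add s6 i7, integral_add s5 i6, integral_add s4 i5, integral_add s3 i4,
    integral_add s2 i3, integral_add i1 i2]
  linarith

theorem integral_norm_avg_mean_sq_le (hn : 3 ≤ n) (p : ℕ) :
    Integrable (fun ω => ‖avg p fun i => sampleMean fun j => Y i j ω‖ ^ 2) P ∧
    ∫ ω, ‖avg p fun i => sampleMean fun j => Y i j ω‖ ^ 2 ∂P ≤
      noiseConst n ι * avg p fun i => momentSize (m i) (Sig i) := by
  have h := fun i => (hY.sample i).integral_norm_mean_sq_le hn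
  have hm : AEStronglyMeasurable (fun ω => ‖avg p fun i => sampleMean fun j => Y i j ω‖ ^ 2) P := by
    have h1 : ∀ i, Measurable fun ω => sampleMean fun j => Y i j ω := fun i =>
      continuous_sampleMean.measurable.comp (hY.measurable_sample i)
    exact ((measurable_avg h1 p).norm.pow_const 2).aestronglyMeasurable
  have hi := integrable_avg (p := p) fun i => (h i).1
  have hint : Integrable (fun ω => ‖avg p fun i => sampleMean fun j => Y i j ω‖ ^ 2) P :=
    hi.mono' hm (ae_of_all _ fun ω => by
      rw [Real.norm_of_nonneg (by positivity)]; exact norm_avg_sq_le _ _)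
  refine ⟨hint, (integral_mono hint hi fun ω => norm_avg_sq_le _ _).trans ?_⟩
  rw [integral_avg fun i => (h i).1, ← avg_mul]
  exact avg_mono fun i => (h i).2

theorem integral_norm_avg_covEst_sq_le (hn : 3 ≤ n) (p : ℕ) :
    Integrable (fun ω => ‖avg p fun i => covEst n (sampleScatter fun j => Y i j ω)‖ ^ 2) P ∧
    ∫ ω, ‖avg p fun i => covEst n (sampleScatter fun j => Y i j ω)‖ ^ 2 ∂P ≤
      noiseConst n ι * avg p fun i => momentSize (m i) (Sig i) := by
  have h := fun i => (hY.sample i).integral_norm_covEst_sq_le hn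
  have hm : AEStronglyMeasurable
      (fun ω => ‖avg p fun i => covEst n (sampleScatter fun j => Y i j ω)‖ ^ 2) P := by
    have h1 : ∀ i, Measurable fun ω => covEst n (sampleScatter fun j => Y i j ω) := fun i =>
      continuous_covEst.measurable.comp (hY.measurable_sample i)
    exact ((measurable_avg h1 p).norm.pow_const 2).aestronglyMeasurable
  have hi := integrable_avg (p := p) fun i => (h i).1
  have hint : Integrable
      (fun ω => ‖avg p fun i => covEst n (sampleScatter fun j => Y i j ω)‖ ^ 2) P :=
    hi.mono' hm (ae_of_all _ fun ω => by
      rw [Real.norm_of_nonneg (by positivity)]; exact norm_avg_sq_le _ _)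
  refine ⟨hint, (integral_mono hint hi fun ω => norm_avg_sq_le _ _).trans ?_⟩
  rw [integral_avg fun i => (h i).1, ← avg_mul]
  exact avg_mono fun i => (h i).2

theorem measurable_norm_scatter (i : ℕ) :
    Measurable fun ω => ‖flat (sampleScatter fun j => Y i j ω)‖ :=
  (continuous_flat_sampleScatter (n := n) (ι := ι)).norm.measurable.comp (hY.measurable_sample i)

theorem integrable_norm_scatter (hn : 3 ≤ n) (i : ℕ) :
    Integrable (fun ω => ‖flat (sampleScatter fun j => Y i j ω)‖) P :=
  ((hY.sample i).allMoments_trace_scatter hn).integrable.mono'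
    (hY.measurable_norm_scatter i).aestronglyMeasurable
    (ae_of_all _ fun ω => by rw [norm_norm]; exact norm_flat_sampleScatter_le _)

theorem integrable_truncScatter (hn : 3 ≤ n) (K : ℝ) (p : ℕ) :
    Integrable (truncScatter Y K p) P := by
  refine (integrable_avg fun i => hY.integrable_norm_scatter hn i).indicator ?_
  have : {ω | ∀ i < p, ‖flat (sampleScatter fun j => Y i j ω)‖ < K} =
      ⋂ i ∈ Finset.range p, {ω | ‖flat (sampleScatter fun j => Y i j ω)‖ < K} := by ext; simp
  rw [this]
  exact Finset.measurableSet_biInter _ fun i _ =>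
    measurableSet_lt (hY.measurable_norm_scatter i) measurable_const

/-- The average scatter matrix is asymptotically negligible on the event that the scatter matrices
of all populations are smaller than `K`. -/
theorem tendsto_integral_truncScatter (hn : 3 ≤ n) (K : ℝ) :
    Tendsto (fun p : ℕ => ∫ ω, truncScatter Y K p ω ∂P) atTop (𝓝 0) := by
  have := hY.isProbabilityMeasure
  rw [Metric.tendsto_atTop]
  intro η hη
  obtain ⟨C, hC, h⟩ := exists_scatter_tail_bound (ι := ι) hn P (half_pos hη) K
  have hlim : Tendsto (fun p : ℕ => C * (p : ℝ)⁻¹) atTop (𝓝 0) := by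
    simpa using tendsto_inv_atTop_nhds_zero_nat.const_mul C
  obtain ⟨p₀, hp₀⟩ := (Metric.tendsto_atTop.1 hlim) (η / 2) (half_pos hη)
  refine ⟨max p₀ 1, fun p hp => ?_⟩
  have hp1 : 0 < p := lt_of_lt_of_le one_pos ((le_max_right _ _).trans hp)
  have h1 := integral_avg_indicator_le (half_pos hη).le hC hY.measurable_norm_scatter
    (hY.integrable_norm_scatter hn)
    (fun i t hi => hY.indepFun_stat (φ := fun _ y => ‖flat (sampleScatter y)‖)
      (fun _ => continuous_flat_sampleScatter.norm.measurable) hi)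
    (fun i => h (Y i) (m i) (Sig i) (hY.measurable i) (hY.sample i)) hp1
  have h2 := hp₀ p ((le_max_left _ _).trans hp)
  rw [Real.dist_eq, sub_zero] at h2 ⊢
  rw [abs_of_nonneg (integral_nonneg (truncScatter_nonneg Y K p))]
  have h3 := le_abs_self (C * (p : ℝ)⁻¹)
  change ∫ ω, truncScatter Y K p ω ∂P ≤ _ at h1
  linarith

end IsGaussianArray

end array

/-! ### The estimators in logarithmic coordinates -/

section estimators

variable {N n : ℕ}

theorem tilde_exp {A : Matrix (Fin N) (Fin N) ℝ} (hA : A.IsHermitian) :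
    tilde (NormedSpace.exp A) = symVec A := by
  rw [tilde, logm_exp hA]

theorem tilde_xbar (x : ℕ → Fin n → Matrix (Fin N) (Fin N) ℝ) (i : ℕ) :
    tilde (xbar x i) = sampleMean fun j => tilde (x i j) := by
  rw [xbar, tilde_exp (isHermitian_smul (isHermitian_sum fun j => isHermitian_logm _) _),
    symVec_smul, symVec_sum]
  rfl

theorem scatter_eq (x : ℕ → Fin n → Matrix (Fin N) (Fin N) ℝ) (i : ℕ) :
    scatter x i = sampleScatter fun j => tilde (x i j) := by
  simp only [scatter, tilde_xbar]
  rfl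

/-- The weight of the shrinkage target in the estimator of the mean. -/
def meanWeight (n : ℕ) (θ : Hyper N) : ℝ := θ.lam / (θ.lam + n)

/-- The weight that the estimator of the covariance matrix withdraws from the unbiased one. -/
def covWeight (n : ℕ) (θ : Hyper N) : ℝ := (θ.nu - q N - 1) / (θ.nu + n - q N - 2)

/-- The vector that the estimator of the covariance matrix adds to the reweighted unbiased one. -/
def covTarget (n : ℕ) (θ : Hyper N) : EuclideanSpace ℝ (Idx N × Idx N) :=
  (θ.nu + n - q N - 2)⁻¹ • flat θ.Psi

theorem cov_denom_pos (hn : 3 ≤ n) {θ : Hyper N} (hθ : θ ∈ admissible N) :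
    0 < θ.nu + n - q N - 2 := by
  have h := hθ.2.2.2
  have : (3 : ℝ) ≤ n := by exact_mod_cast hn
  linarith

theorem meanWeight_mem {θ : Hyper N} (hθ : θ ∈ admissible N) :
    meanWeight n θ ∈ Set.Icc (0 : ℝ) 1 := by
  have h := hθ.1
  have h2 : (0 : ℝ) ≤ n := by positivity
  exact ⟨by unfold meanWeight; positivity, div_le_one_of_le₀ (by linarith) (by positivity)⟩

theorem covWeight_mem (hn : 3 ≤ n) {θ : Hyper N} (hθ : θ ∈ admissible N) :
    covWeight n θ ∈ Set.Icc (0 : ℝ) 1 := by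
  have h := hθ.2.2.2
  have h2 := cov_denom_pos hn hθ
  have : (3 : ℝ) ≤ n := by exact_mod_cast hn
  exact ⟨div_nonneg (by linarith) h2.le, div_le_one_of_le₀ (by linarith) h2.le⟩

theorem loss_eq (hn : 3 ≤ n) (p : ℕ) (x : ℕ → Fin n → Matrix (Fin N) (Fin N) ℝ) {θ : Hyper N}
    (hθ : θ ∈ admissible N) (M : ℕ → Matrix (Fin N) (Fin N) ℝ)
    (Sig : ℕ → Matrix (Idx N) (Idx N) ℝ) :
    loss p (estM x θ) (estSig x θ) M Sig = avg p fun i =>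
      lossTerm (meanWeight n θ) (tilde θ.mu) (covWeight n θ) (covTarget n θ)
        (sampleMean fun j => tilde (x i j)) (tilde (M i))
        (covEst n (sampleScatter fun j => tilde (x i j))) (flat (Sig i)) := by
  have hn' : (3 : ℝ) ≤ n := by exact_mod_cast hn
  have hlam := hθ.1
  have hD := cov_denom_pos hn hθ
  have e1 : ∀ i, dLE (estM x θ i) (M i) ^ 2 =
      ‖(1 - meanWeight n θ) • (sampleMean fun j => tilde (x i j)) + meanWeight n θ • tilde θ.mu -
        tilde (M i)‖ ^ 2 := fun i => by
    have hH : ((θ.lam + n)⁻¹ • ((n : ℝ) • logm (xbar x i) + θ.lam • logm θ.mu)).IsHermitian :=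
      isHermitian_smul ((isHermitian_smul (isHermitian_logm _) _).add
        (isHermitian_smul (isHermitian_logm _) _)) _
    rw [dLE_eq, estM, tilde_exp hH, symVec_smul, symVec_add, symVec_smul, symVec_smul, ← tilde,
      ← tilde, tilde_xbar, smul_add, smul_smul, smul_smul]
    have h1 : (θ.lam + n)⁻¹ * n = 1 - meanWeight n θ := by
      unfold meanWeight; field_simp; ring
    have h2 : (θ.lam + n)⁻¹ * θ.lam = meanWeight n θ := by unfold meanWeight; field_simp
    rw [h1, h2]
  have e2 : ∀ i, frob (estSig x θ i - Sig i) ^ 2 =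
      ‖(1 - covWeight n θ) • covEst n (sampleScatter fun j => tilde (x i j)) + covTarget n θ -
        flat (Sig i)‖ ^ 2 := fun i => by
    rw [← norm_flat, flat_sub, estSig, flat_smul, flat_add, scatter_eq, covEst, covTarget,
      smul_smul, smul_add, add_comm (_ • flat θ.Psi)]
    have h1 : (1 - covWeight n θ) * ((n : ℝ) - 1)⁻¹ = (θ.nu + n - q N - 2)⁻¹ := by
      have : (n : ℝ) - 1 ≠ 0 := by linarith
      unfold covWeight
      field_simp
      ring
    rw [h1]
  simp only [loss, lossTerm, e1, e2, avg_add]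
  rfl

theorem sure_eq (hn : 3 ≤ n) (p : ℕ) (x : ℕ → Fin n → Matrix (Fin N) (Fin N) ℝ) {θ : Hyper N}
    (hθ : θ ∈ admissible N) :
    sure p x θ = avg p fun i =>
      sureTerm (meanWeight n θ) (tilde θ.mu) (covWeight n θ) (covTarget n θ)
        (sampleMean fun j => tilde (x i j)) (covEst n (sampleScatter fun j => tilde (x i j)))
        (meanVarEst n (sampleScatter fun j => tilde (x i j)))
        (covRiskEst n (sampleScatter fun j => tilde (x i j)))
        (covSqEst n (sampleScatter fun j => tilde (x i j))) := by
  have hn' : (3 : ℝ) ≤ n := by exact_mod_cast hn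
  have hlam := hθ.1
  have hD := cov_denom_pos hn hθ
  have z1 : (n : ℝ) - 1 ≠ 0 := by linarith
  have z2 : (n : ℝ) - 2 ≠ 0 := by linarith
  have z3 : (n : ℝ) ≠ 0 := by linarith
  rw [sure, avg, smul_eq_mul]
  congr 1
  refine Finset.sum_congr rfl fun i _ => ?_
  rw [dLE_eq, tilde_xbar, scatter_eq]
  set S := sampleScatter fun j => tilde (x i j)
  have hS : S.IsHermitian := isHermitian_sampleScatter _
  rw [sureTerm, covEst, covTarget, norm_smul, real_inner_smul_left, real_inner_smul_right, mul_pow,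
    norm_flat_sq hθ.2.2.1.1, inner_flat hθ.2.2.1.1, covRiskEst, covSqEst, norm_flat_sq hS,
    meanVarEst, Real.norm_eq_abs, sq_abs]
  congr 1
  · unfold meanWeight
    generalize S.trace = s1
    generalize ‖(sampleMean fun j => tilde (x i j)) - tilde θ.mu‖ ^ 2 = s2
    field_simp
    ring
  · have hDc : θ.nu + n - q N - 2 = (θ.nu - q N - 1) + (n - 1) := by ring
    unfold covWeight
    rw [hDc] at hD ⊢
    generalize θ.nu - q N - 1 = c at hD ⊢
    have h1b : 1 - c / (c + (n - 1)) = (n - 1) / (c + (n - 1)) := by field_simp; ring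
    rw [h1b]
    generalize S.trace = s1
    generalize (S ^ 2).trace = s2
    generalize (θ.Psi * S).trace = s3
    generalize (θ.Psi ^ 2).trace = s4
    have z4 : (n : ℝ) + 1 ≠ 0 := by linarith
    field_simp
    ring

theorem lossOf_nonneg {Ω : Type*} (p : ℕ) (X : ℕ → Fin n → Ω → Matrix (Fin N) (Fin N) ℝ)
    (θ : Ω → Hyper N)
    (M : ℕ → Matrix (Fin N) (Fin N) ℝ) (Sig : ℕ → Matrix (Idx N) (Idx N) ℝ)
    (ω : Ω) : 0 ≤ lossOf p X θ M Sig ω := by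
  unfold lossOf loss
  positivity

/-- The hyperparameters with the shrinkage targets `log μ` and `Ψ` multiplied by `r` and `s`. -/
def rescale (θ : Hyper N) (r s : ℝ) : Hyper N :=
  ⟨θ.lam, NormedSpace.exp (r • logm θ.mu), s • θ.Psi, θ.nu⟩

theorem rescale_mem {θ : Hyper N} (hθ : θ ∈ admissible N) (r : ℝ) {s : ℝ} (hs : 0 < s) :
    rescale θ r s ∈ admissible N :=
  ⟨hθ.1, posDef_exp (isHermitian_smul (isHermitian_logm _) _), hθ.2.2.1.smul hs, hθ.2.2.2⟩

theorem tilde_rescale (θ : Hyper N) (r s : ℝ) : tilde (rescale θ r s).mu = r • tilde θ.mu := by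
  rw [rescale, tilde_exp (isHermitian_smul (isHermitian_logm _) _), symVec_smul, tilde]

theorem covTarget_rescale (θ : Hyper N) (r s : ℝ) :
    covTarget n (rescale θ r s) = s • covTarget n θ := by
  simp only [covTarget, rescale, flat_smul]
  rw [smul_comm]

theorem sure_rescale (hn : 3 ≤ n) (p : ℕ) (x : ℕ → Fin n → Matrix (Fin N) (Fin N) ℝ) {θ : Hyper N}
    (hθ : θ ∈ admissible N) (r : ℝ) {s : ℝ} (hs : 0 < s) :
    sure p x (rescale θ r s) = avg p fun i =>
      sureTerm (meanWeight n θ) (r • tilde θ.mu) (covWeight n θ) (s • covTarget n θ)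
        (sampleMean fun j => tilde (x i j)) (covEst n (sampleScatter fun j => tilde (x i j)))
        (meanVarEst n (sampleScatter fun j => tilde (x i j)))
        (covRiskEst n (sampleScatter fun j => tilde (x i j)))
        (covSqEst n (sampleScatter fun j => tilde (x i j))) := by
  rw [sure_eq hn p x (rescale_mem hθ r hs), tilde_rescale, covTarget_rescale]
  rfl

theorem frob_smul {ι : Type*} [Fintype ι] (c : ℝ) (A : Matrix ι ι ℝ) :
    frob (c • A) = |c| * frob A := by
  rw [← norm_flat, flat_smul, norm_smul, norm_flat, Real.norm_eq_abs]

theorem frob_logm_rescale (θ : Hyper N) (r s : ℝ) :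
    frob (logm (rescale θ r s).mu) = |r| * frob (logm θ.mu) := by
  rw [frob_logm, frob_logm, tilde_rescale, norm_smul, Real.norm_eq_abs]

theorem rescale_mem_constrained {p : ℕ} {x : ℕ → Fin n → Matrix (Fin N) (Fin N) ℝ} {θ : Hyper N}
    (hθ : θ ∈ constrained p x) : rescale θ 0 (1 / 2) ∈ constrained p x := by
  refine ⟨rescale_mem hθ.1 0 (by norm_num), ?_, ?_⟩
  · refine le_trans ?_ hθ.2.1
    rw [rescale, frob_smul, abs_of_nonneg (by norm_num)]
    linarith [frob_nonneg θ.Psi]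
  · rw [frob_logm_rescale, abs_zero, zero_mul]
    exact Real.iSup_nonneg fun i => frob_nonneg _

theorem norm_avg_le_iSup {V : Type*} [NormedAddCommGroup V] [InnerProductSpace ℝ V] {p : ℕ}
    (hp : 0 < p) (f : ℕ → V) : ‖avg p f‖ ≤ ⨆ i : Fin p, ‖f i‖ := by
  refine (norm_avg_le p f).trans ?_
  have h := Finset.sum_le_card_nsmul (Finset.range p) (fun i => ‖f i‖) (⨆ i : Fin p, ‖f i‖)
    fun i hi => le_ciSup (f := fun i : Fin p => ‖f i‖) (Set.finite_range _).bddAbove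
      ⟨i, Finset.mem_range.1 hi⟩
  rw [Finset.card_range] at h
  have hp' : (0 : ℝ) < p := by exact_mod_cast hp
  rw [avg, smul_eq_mul, inv_mul_le_iff₀ hp', ← nsmul_eq_mul]
  exact h

/-- Every admissible hyperparameter can be moved into the constrained set at a small cost: by
contracting the shrinkage targets. Contracting `log μ` towards the ball of radius
`max ‖log X̄ᵢ‖`, which contains the average of the `log X̄ᵢ`, costs nothing; contracting `Ψ` is
needed only if all scatter matrices are smaller than `Ψ`, which happens rarely. -/
theorem exists_constrained_sure_le {Ω : Type*} (hn : 3 ≤ n) {p : ℕ} (hp : 0 < p)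
    (X : ℕ → Fin n → Ω → Matrix (Fin N) (Fin N) ℝ) (ω : Ω)
    (hne : (constrained p fun i j => X i j ω).Nonempty) {θ : Hyper N} (hθ : θ ∈ admissible N) :
    ∃ θ' ∈ constrained p (fun i j => X i j ω), sure p (fun i j => X i j ω) θ' ≤
      sure p (fun i j => X i j ω) θ + 2 * ‖covTarget n θ‖ *
        truncScatter (fun i j ω => tilde (X i j ω)) (frob θ.Psi) p ω := by
  obtain ⟨θ₀, h₀⟩ := hne
  set x := fun i j => X i j ω with hx
  set R := ⨆ i : Fin p, frob (logm (xbar x i)) with hR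
  set R' := ⨆ i : Fin p, frob (scatter x i) with hR'
  have hR0 : 0 ≤ R := Real.iSup_nonneg fun i => frob_nonneg _
  have hR'0 : 0 ≤ R' := Real.iSup_nonneg fun i => frob_nonneg _
  obtain ⟨r, hr, hrR, hrle⟩ : ∃ r ∈ Set.Icc (0 : ℝ) 1, (r = 1 ∨ r * ‖tilde θ.mu‖ = R) ∧
      r * ‖tilde θ.mu‖ ≤ R := by
    rcases le_or_gt ‖tilde θ.mu‖ R with h | h
    · exact ⟨1, by simp, Or.inl rfl, by simpa using h⟩
    · have hu : 0 < ‖tilde θ.mu‖ := hR0.trans_lt h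
      have e : R / ‖tilde θ.mu‖ * ‖tilde θ.mu‖ = R := div_mul_cancel₀ _ hu.ne'
      exact ⟨R / ‖tilde θ.mu‖, ⟨by positivity, (div_le_one hu).2 h.le⟩, Or.inr e, e.le⟩
  obtain ⟨s, hs0, hs1, hsR, hsle⟩ : ∃ s : ℝ, 0 < s ∧ s ≤ 1 ∧ (s = 1 ∨ R' < frob θ.Psi) ∧
      s * frob θ.Psi ≤ R' := by
    rcases le_or_gt (frob θ.Psi) R' with h | h
    · exact ⟨1, one_pos, le_rfl, Or.inl rfl, by simpa using h⟩
    · have hu : 0 < frob θ.Psi := hR'0.trans_lt h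
      have e : R' / frob θ.Psi * frob θ.Psi = R' := div_mul_cancel₀ _ hu.ne'
      refine ⟨R' / frob θ.Psi, div_pos ?_ hu, (div_le_one hu).2 h.le, Or.inr h, e.le⟩
      -- `R'` is positive, since it bounds the norm of a positive definite matrix
      refine lt_of_le_of_ne hR'0 fun h0 => ?_
      have h1 : flat θ₀.Psi = 0 := by
        rw [← norm_le_zero_iff, norm_flat, h0]
        exact h₀.2.1
      obtain ⟨a⟩ : Nonempty (Idx N) := by
        by_contra hem
        rw [not_nonempty_iff] at hem
        have : flat θ.Psi = 0 := by ext ab; exact hem.elim ab.1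
        rw [← norm_flat, this, norm_zero] at hu
        exact hu.false
      have h2 : θ₀.Psi a a = 0 := by rw [← flat_apply θ₀.Psi (a, a), h1]; rfl
      exact (h₀.1.2.2.1.diag_pos (i := a)).ne' h2
  refine ⟨rescale θ r s, ⟨rescale_mem hθ r hs0, ?_, ?_⟩, ?_⟩
  · rw [rescale, frob_smul, abs_of_pos hs0]
    exact hsle
  · rw [frob_logm_rescale, abs_of_nonneg hr.1, frob_logm]
    exact hrle
  have hy : ‖avg p fun i => sampleMean fun j => tilde (x i j)‖ ≤ R := by
    refine (norm_avg_le_iSup hp _).trans_eq ?_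
    simp only [hR, frob_logm, tilde_xbar]
  have key := sure_contract_le (fun i => sampleMean fun j => tilde (x i j))
    (fun i => covEst n (sampleScatter fun j => tilde (x i j)))
    (fun i => meanVarEst n (sampleScatter fun j => tilde (x i j)))
    (fun i => covRiskEst n (sampleScatter fun j => tilde (x i j)))
    (fun i => covSqEst n (sampleScatter fun j => tilde (x i j))) hp (meanWeight n θ)
    (tilde θ.mu) (covTarget n θ) (covWeight_mem hn hθ) hr ⟨hs0.le, hs1⟩ hy hrR
  rw [sure_rescale hn p x hθ r hs0, sure_eq hn p x hθ]
  refine key.trans (add_le_add_right ?_ _)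
  rcases hsR with rfl | h
  · rw [sub_self, mul_zero, zero_mul]
    exact mul_nonneg (by positivity) (truncScatter_nonneg _ _ _ _)
  have hmem : ω ∈ {ω | ∀ i < p, ‖flat (sampleScatter fun j => tilde (X i j ω))‖ < frob θ.Psi} := by
    intro i hi
    refine lt_of_le_of_lt ?_ h
    rw [norm_flat, ← scatter_eq x i]
    exact le_ciSup (f := fun i : Fin p => frob (scatter x i)) (Set.finite_range _).bddAbove ⟨i, hi⟩
  have ht : ‖avg p fun i => covEst n (sampleScatter fun j => tilde (x i j))‖ ≤
      truncScatter (fun i j ω => tilde (X i j ω)) (frob θ.Psi) p ω := by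
    rw [truncScatter, Set.indicator_of_mem hmem]
    refine (norm_avg_le _ _).trans (avg_mono fun i => ?_)
    have hn' : (3 : ℝ) ≤ n := by exact_mod_cast hn
    rw [covEst, norm_smul, Real.norm_of_nonneg (inv_nonneg.2 (by linarith))]
    exact mul_le_of_le_one_left (norm_nonneg _) (inv_le_one_of_one_le₀ (by linarith))
  have h1 := mul_le_mul_of_nonneg_left ht (norm_nonneg (covTarget n θ))
  have h2 : 0 ≤ ‖covTarget n θ‖ * ‖avg p fun i => covEst n (sampleScatter fun j => tilde (x i j))‖ := by
    positivity
  nlinarith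

/-- A bound for the excess of the loss of a near-minimizer of `SURE` over that of `θ`. It consists of
the cost of moving `θ` into the constrained set, the tolerance `ε`, and twice the bound of
`abs_loss_sub_sure_le`: for `θ`, and for the near-minimizer with `target_bound` inserted. -/
def excess {Ω : Type*} (X : ℕ → Fin n → Ω → Matrix (Fin N) (Fin N) ℝ)
    (M : ℕ → Matrix (Fin N) (Fin N) ℝ) (Sig : ℕ → Matrix (Idx N) (Idx N) ℝ) (θ : Hyper N)
    (ε : ℝ) (h : ℝ) (p : ℕ) (ω : Ω) : ℝ :=
  2 * ‖covTarget n θ‖ * truncScatter (fun i j ω => tilde (X i j ω)) (frob θ.Psi) p ω + ε +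
    2 * h * arrayNoise (fun i j ω => tilde (X i j ω)) (fun i => tilde (M i)) Sig p ω +
    h⁻¹ * (8 + ‖meanWeight n θ • tilde θ.mu‖ ^ 2 + ‖covTarget n θ‖ ^ 2 +
      4 * ‖avg p fun i => sampleMean fun j => tilde (X i j ω)‖ ^ 2 +
      2 * ‖avg p fun i => covEst n (sampleScatter fun j => tilde (X i j ω))‖ ^ 2 + 2 * ε)

theorem loss_le_of_isSureMin {Ω : Type*} (hn : 3 ≤ n) {p : ℕ} (hp : 0 < p)
    (X : ℕ → Fin n → Ω → Matrix (Fin N) (Fin N) ℝ) (ω : Ω)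
    (M : ℕ → Matrix (Fin N) (Fin N) ℝ) (Sig : ℕ → Matrix (Idx N) (Idx N) ℝ)
    {ε : ℝ} {θhat : Hyper N}
    (hmin : IsSureMin p (fun i j => X i j ω) (admissible N) ε θhat ∨
      IsSureMin p (fun i j => X i j ω) (constrained p fun i j => X i j ω) ε θhat)
    {θ : Hyper N} (hθ : θ ∈ admissible N) {h : ℝ} (hh : 0 < h) :
    loss p (estM (fun i j => X i j ω) θhat) (estSig (fun i j => X i j ω) θhat) M Sig ≤
      loss p (estM (fun i j => X i j ω) θ) (estSig (fun i j => X i j ω) θ) M Sig +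
        excess X M Sig θ ε h p ω := by
  have hT := mul_nonneg (by positivity : 0 ≤ 2 * ‖covTarget n θ‖)
    (truncScatter_nonneg (fun i j ω => tilde (X i j ω)) (frob θ.Psi) p ω)
  obtain ⟨hadm, hscale, hcomp⟩ : θhat ∈ admissible N ∧
      sure p (fun i j => X i j ω) θhat ≤
        sure p (fun i j => X i j ω) (rescale θhat 0 (1 / 2)) + ε ∧
      sure p (fun i j => X i j ω) θhat ≤ sure p (fun i j => X i j ω) θ +
        2 * ‖covTarget n θ‖ * truncScatter (fun i j ω => tilde (X i j ω)) (frob θ.Psi) p ω + ε := by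
    rcases hmin with hmin | hmin
    · refine ⟨hmin.1, hmin.2 _ (rescale_mem hmin.1 0 (by norm_num)), ?_⟩
      linarith [hmin.2 θ hθ]
    · refine ⟨hmin.1.1, hmin.2 _ (rescale_mem_constrained hmin.1), ?_⟩
      obtain ⟨θ', h1, h2⟩ := exists_constrained_sure_le hn hp X ω ⟨_, hmin.1⟩ hθ
      linarith [hmin.2 θ' h1]
  rw [sure_rescale hn p _ hadm 0 (by norm_num), sure_eq hn p _ hadm] at hscale
  rw [sure_eq hn p _ hadm, sure_eq hn p _ hθ] at hcomp
  rw [loss_eq hn p _ hadm, loss_eq hn p _ hθ]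
  have htar := target_bound _ _ _ _ _ hp (meanWeight_mem hadm) (covWeight_mem hn hadm) hscale
  have b := fun {θ : Hyper N} (hθ : θ ∈ admissible N) => abs_loss_sub_sure_le
    (p := p) (fun i => sampleMean fun j => tilde (X i j ω)) (fun i => tilde (M i))
    (fun i => covEst n (sampleScatter fun j => tilde (X i j ω)))
    (fun i => flat (Sig i)) (fun i => meanVarEst n (sampleScatter fun j => tilde (X i j ω)))
    (fun i => covRiskEst n (sampleScatter fun j => tilde (X i j ω)))
    (fun i => covSqEst n (sampleScatter fun j => tilde (X i j ω)))
    (tilde θ.mu) (covTarget n θ) hh (meanWeight_mem (n := n) hθ) (covWeight_mem hn hθ)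
  have b1 := (abs_le.1 (b hadm)).2
  have b2 := (abs_le.1 (b hθ)).1
  have b3 := mul_le_mul_of_nonneg_left htar (inv_nonneg.2 hh.le)
  rw [excess, arrayNoise]
  linarith

end estimators

/-! ### The excess risk -/

section risk

variable {Ω : Type*} [MeasurableSpace Ω] {P : Measure Ω} {N n : ℕ}
  {M : ℕ → Matrix (Fin N) (Fin N) ℝ} {Sig : ℕ → Matrix (Idx N) (Idx N) ℝ}
  {X : ℕ → Fin n → Ω → Matrix (Fin N) (Fin N) ℝ}

theorem measurable_tilde_comp {X : Ω → Matrix (Fin N) (Fin N) ℝ} (hX : Measurable X)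
    (hpos : ∀ ω, (X ω).PosDef) : Measurable fun ω => tilde (X ω) := by
  simp only [← tildeM_of_posDef (hpos _)]
  exact measurable_tildeM.comp hX

theorem isGaussianArray_tilde (hSig : ∀ i, (Sig i).PosDef)
    (hX : ∀ i j, IsLogNormal (X i j) (M i) (Sig i) P)
    (hind : iIndepFun (fun ij : ℕ × Fin n => X ij.1 ij.2) P) :
    IsGaussianArray (fun i j ω => tilde (X i j ω)) (fun i => tilde (M i)) Sig P := by
  have hcomp : iIndepFun (fun (ij : ℕ × Fin n) ω => tilde (X ij.1 ij.2 ω)) P := by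
    have h := hind.comp (fun _ => tildeM) fun _ => measurable_tildeM
    have e : (fun (ij : ℕ × Fin n) => tildeM ∘ X ij.1 ij.2) =
        fun (ij : ℕ × Fin n) ω => tilde (X ij.1 ij.2 ω) := by
      ext1 ij
      ext1 ω
      exact tildeM_of_posDef ((hX ij.1 ij.2).posDef ω)
    rwa [e] at h
  exact
    { measurable := fun i j => measurable_tilde_comp (hX i j).measurable (hX i j).posDef
      sample := fun i =>
        { posSemidef := (hSig i).posSemidef
          hasLaw := fun j => (hX i j).hasLaw
          indep := hcomp.precomp (g := fun j : Fin n => (i, j)) (Prod.mk_right_injective i) }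
      indep := hcomp }

theorem measurable_flat {κ : Type*} [Fintype κ] : Measurable (flat (ι := κ)) := by
  have : Continuous (flat (ι := κ)) := by
    unfold flat
    fun_prop
  exact this.measurable

theorem aestronglyMeasurable_lossOf (hn : 3 ≤ n)
    (hY : IsGaussianArray (fun i j ω => tilde (X i j ω)) (fun i => tilde (M i)) Sig P) (p : ℕ)
    {θ : Ω → Hyper N} (hθ : MeasurableHyper θ) (hadm : ∀ᵐ ω ∂P, θ ω ∈ admissible N) :
    AEStronglyMeasurable (lossOf p X θ M Sig) P := by
  obtain ⟨h1, h2, h3, h4⟩ := hθ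
  have ha : Measurable fun ω => meanWeight n (θ ω) := by unfold meanWeight; fun_prop
  have hb : Measurable fun ω => covWeight n (θ ω) := by unfold covWeight; fun_prop
  have hg : Measurable fun ω => covTarget n (θ ω) := by
    have := measurable_flat.comp h3
    have h5 : Measurable fun ω => ((θ ω).nu + n - q N - 2)⁻¹ := by fun_prop
    exact h5.smul this
  have hu : Measurable fun ω => tildeM (θ ω).mu := measurable_tildeM.comp h2
  have hy : ∀ i, Measurable fun ω => sampleMean fun j => tilde (X i j ω) := fun i =>
    continuous_sampleMean.measurable.comp (hY.measurable_sample i)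
  have ht : ∀ i, Measurable fun ω => covEst n (sampleScatter fun j => tilde (X i j ω)) := fun i =>
    continuous_covEst.measurable.comp (hY.measurable_sample i)
  have hm : Measurable fun ω => avg p fun i =>
      lossTerm (meanWeight n (θ ω)) (tildeM (θ ω).mu) (covWeight n (θ ω)) (covTarget n (θ ω))
        (sampleMean fun j => tilde (X i j ω)) (tilde (M i))
        (covEst n (sampleScatter fun j => tilde (X i j ω))) (flat (Sig i)) := by
    have ha' : Measurable fun ω => 1 - meanWeight n (θ ω) := measurable_const.sub ha
    have hb' : Measurable fun ω => 1 - covWeight n (θ ω) := measurable_const.sub hb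
    refine (Finset.measurable_fun_sum _ fun i _ => ?_).const_smul (p : ℝ)⁻¹
    exact ((((ha'.smul (hy i)).add (ha.smul hu)).sub_const _).norm.pow_const 2).add
      ((((hb'.smul (ht i)).add hg).sub_const _).norm.pow_const 2)
  refine hm.aestronglyMeasurable.congr ?_
  filter_upwards [hadm] with ω hω
  rw [lossOf, loss_eq hn p _ hω, tildeM_of_posDef hω.2.1]

theorem integrable_lossOf_const (hn : 3 ≤ n)
    (hY : IsGaussianArray (fun i j ω => tilde (X i j ω)) (fun i => tilde (M i)) Sig P) (p : ℕ)
    {θ : Hyper N} (hθ : θ ∈ admissible N) : Integrable (lossOf p X (fun _ => θ) M Sig) P := by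
  have := hY.isProbabilityMeasure
  have hm : AEStronglyMeasurable (lossOf p X (fun _ => θ) M Sig) P :=
    aestronglyMeasurable_lossOf hn hY p
      ⟨measurable_const, measurable_const, measurable_const, measurable_const⟩ (ae_of_all _ fun _ => hθ)
  have hi := integrable_avg (p := p) fun i =>
    ((((hY.sample i).integral_norm_mean_sq_le hn).1.const_mul 2).add
      (integrable_const (2 * ‖meanWeight n θ • tilde θ.mu - tilde (M i)‖ ^ 2))).add
    ((((hY.sample i).integral_norm_covEst_sq_le hn).1.const_mul 2).add
      (integrable_const (2 * ‖covTarget n θ - flat (Sig i)‖ ^ 2)))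
  refine hi.mono' hm (ae_of_all _ fun ω => ?_)
  rw [Real.norm_of_nonneg (lossOf_nonneg _ _ _ _ _ _), lossOf, loss_eq hn p _ hθ]
  exact avg_mono fun i => lossTerm_le (meanWeight_mem hθ) (covWeight_mem hn hθ) _ _ _ _ _ _

/-- The expected `excess` for `h = √p`, which balances the two terms in which `h` occurs. -/
theorem integral_excess_le (hn : 3 ≤ n)
    (hY : IsGaussianArray (fun i j ω => tilde (X i j ω)) (fun i => tilde (M i)) Sig P)
    (θ : Hyper N) (ε : ℝ) {p : ℕ} (hp : 0 < p) :
    Integrable (excess X M Sig θ ε (√p) p) P ∧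
    ∫ ω, excess X M Sig θ ε (√p) p ω ∂P ≤
      2 * ‖covTarget n θ‖ *
        ∫ ω, truncScatter (fun i j ω => tilde (X i j ω)) (frob θ.Psi) p ω ∂P + ε +
      (√p)⁻¹ * (2 * (5 + Fintype.card (Idx N) + Fintype.card (Idx N × Idx N) + 3) *
        (noiseConst n (Idx N) * avg p fun i => momentSize (tilde (M i)) (Sig i)) +
        (8 + ‖meanWeight n θ • tilde θ.mu‖ ^ 2 + ‖covTarget n θ‖ ^ 2 + 2 * ε)) := by
  have := hY.isProbabilityMeasure
  have i1 := (hY.integrable_truncScatter hn (frob θ.Psi) p).const_mul (2 * ‖covTarget n θ‖)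
  obtain ⟨i2, b2⟩ := hY.integral_arrayNoise_le hn p
  obtain ⟨i3, b3⟩ := hY.integral_norm_avg_mean_sq_le hn p
  obtain ⟨i4, b4⟩ := hY.integral_norm_avg_covEst_sq_le hn p
  set A := noiseConst n (Idx N) * avg p fun i => momentSize (tilde (M i)) (Sig i)
  set c := 8 + ‖meanWeight n θ • tilde θ.mu‖ ^ 2 + ‖covTarget n θ‖ ^ 2 + 2 * ε with hc
  have i2' := i2.const_mul (2 * √p)
  have i3' := i3.const_mul ((√p)⁻¹ * 4)
  have i4' := i4.const_mul ((√p)⁻¹ * 2)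
  have add : ∀ {f g : Ω → ℝ}, Integrable f P → Integrable g P →
      Integrable (fun ω => f ω + g ω) P := fun hf hg => hf.add hg
  have s2 := add i1 i2'
  have s3 := add s2 i3'
  have s4 := add s3 i4'
  have e : excess X M Sig θ ε (√p) p = fun ω =>
      2 * ‖covTarget n θ‖ * truncScatter (fun i j ω => tilde (X i j ω)) (frob θ.Psi) p ω +
      2 * √p * arrayNoise (fun i j ω => tilde (X i j ω)) (fun i => tilde (M i)) Sig p ω +
      (√p)⁻¹ * 4 * ‖avg p fun i => sampleMean fun j => tilde (X i j ω)‖ ^ 2 +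
      (√p)⁻¹ * 2 * ‖avg p fun i => covEst n (sampleScatter fun j => tilde (X i j ω))‖ ^ 2 +
      (ε + (√p)⁻¹ * c) := by
    ext ω
    rw [excess, hc]
    ring
  rw [e]
  refine ⟨add s4 (integrable_const _), ?_⟩
  rw [integral_add s4 (integrable_const _), integral_add s3 i4', integral_add s2 i3',
    integral_add i1 i2', integral_const_mul, integral_const_mul, integral_const_mul,
    integral_const_mul, integral_const, probReal_univ, one_smul]
  have hp' : (0 : ℝ) < √p := by positivity
  have b2' := mul_le_mul_of_nonneg_left b2 (by positivity : 0 ≤ 2 * √(p : ℝ))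
  have b3' := mul_le_mul_of_nonneg_left b3 (by positivity : 0 ≤ (√(p : ℝ))⁻¹ * 4)
  have b4' := mul_le_mul_of_nonneg_left b4 (by positivity : 0 ≤ (√(p : ℝ))⁻¹ * 2)
  have e2 : √(p : ℝ) * (p : ℝ)⁻¹ = (√(p : ℝ))⁻¹ := by
    nth_rewrite 2 [← Real.mul_self_sqrt (Nat.cast_nonneg (α := ℝ) p)]
    field_simp
  have e3 : ∀ z : ℝ, 2 * √(p : ℝ) * (z * ((p : ℝ)⁻¹ * A)) = (√(p : ℝ))⁻¹ * (2 * z * A) := fun z => by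
    rw [← e2]; ring
  rw [e3] at b2'
  linarith

theorem exists_bound_of_limsup_lt_top {f : ℕ → ℝ}
    (h : limsup (fun p => (f p : EReal)) atTop < ⊤) : ∃ B : ℝ, ∀ᶠ p in atTop, f p ≤ B := by
  obtain ⟨B, hB, -⟩ := EReal.lt_iff_exists_real_btwn.1 h
  refine ⟨B, ?_⟩
  filter_upwards [eventually_lt_of_limsup_lt hB] with p hp
  exact (EReal.coe_lt_coe_iff.1 hp).le

theorem sq_le_one_add_rpow {x δ : ℝ} (hx : 0 ≤ x) (hδ : 0 < δ) : x ^ 2 ≤ 1 + x ^ (2 + δ) := by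
  rcases le_total x 1 with h | h
  · have h1 : 0 ≤ x ^ (2 + δ) := Real.rpow_nonneg hx _
    nlinarith
  · have h1 : x ^ (2 : ℝ) ≤ x ^ (2 + δ) := Real.rpow_le_rpow_of_exponent_le h (by linarith)
    rw [Real.rpow_two] at h1
    linarith

theorem exists_momentSize_bound
    (h1 : limsup (fun p : ℕ =>
      (((p : ℝ)⁻¹ * ∑ i ∈ Finset.range p, (Sig i).trace ^ 4 : ℝ) : EReal)) atTop < ⊤)
    (h2 : limsup (fun p : ℕ =>
      (((p : ℝ)⁻¹ * ∑ i ∈ Finset.range p,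
        (tilde (M i)).ofLp ⬝ᵥ (Sig i *ᵥ (tilde (M i)).ofLp) : ℝ) : EReal)) atTop < ⊤)
    (h3 : ∃ δ : ℝ, 0 < δ ∧ limsup (fun p : ℕ =>
      (((p : ℝ)⁻¹ * ∑ i ∈ Finset.range p, frob (logm (M i)) ^ (2 + δ) : ℝ) : EReal)) atTop < ⊤) :
    ∃ B : ℝ, ∀ᶠ p in atTop, avg p (fun i => momentSize (tilde (M i)) (Sig i)) ≤ B := by
  obtain ⟨δ, hδ, h3⟩ := h3
  obtain ⟨B1, hB1⟩ := exists_bound_of_limsup_lt_top h1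
  obtain ⟨B2, hB2⟩ := exists_bound_of_limsup_lt_top h2
  obtain ⟨B3, hB3⟩ := exists_bound_of_limsup_lt_top h3
  refine ⟨1 + B1 + B2 + (1 + B3), ?_⟩
  filter_upwards [hB1, hB2, hB3, eventually_gt_atTop 0] with p k1 k2 k3 hp
  have h : avg p (fun i => ‖tilde (M i)‖ ^ 2) ≤ avg p (fun i => 1 + frob (logm (M i)) ^ (2 + δ)) :=
    avg_mono fun i => by rw [frob_logm]; exact sq_le_one_add_rpow (norm_nonneg _) hδ
  rw [avg_add, avg_const hp] at h
  simp only [momentSize, avg_add, avg_const hp]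
  simp only [avg, smul_eq_mul] at h ⊢
  linarith

/-- Besides bounding the excess risk, the bound for the excess loss yields the integrability of the
loss with random hyperparameters. -/
theorem risk_sub_le {ε : ℝ} (hn : 3 ≤ n)
    (hY : IsGaussianArray (fun i j ω => tilde (X i j ω)) (fun i => tilde (M i)) Sig P)
    {p : ℕ} (hp : 0 < p) {θhat : Ω → Hyper N} (hmeas : MeasurableHyper θhat)
    (hmin : ∀ᵐ ω ∂P, IsSureMin p (fun i j => X i j ω) (admissible N) ε (θhat ω) ∨
      IsSureMin p (fun i j => X i j ω) (constrained p fun i j => X i j ω) ε (θhat ω))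
    {θ : Hyper N} (hθ : θ ∈ admissible N) :
    Integrable (lossOf p X θhat M Sig) P ∧
      risk P p X θhat M Sig - risk P p X (fun _ => θ) M Sig ≤
        ∫ ω, excess X M Sig θ ε (√p) p ω ∂P := by
  have hL := integrable_lossOf_const hn hY p hθ
  have hE := (integral_excess_le hn hY θ ε hp).1
  have hle : ∀ᵐ ω ∂P, lossOf p X θhat M Sig ω ≤
      lossOf p X (fun _ => θ) M Sig ω + excess X M Sig θ ε (√p) p ω := by
    filter_upwards [hmin] with ω hω
    exact loss_le_of_isSureMin hn hp X ω M Sig hω hθ (by positivity)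
  have hadm : ∀ᵐ ω ∂P, θhat ω ∈ admissible N := by
    filter_upwards [hmin] with ω hω
    exact hω.elim (fun h => h.1) fun h => h.1.1
  have hint : Integrable (lossOf p X θhat M Sig) P := by
    refine (hL.add hE).mono' (aestronglyMeasurable_lossOf hn hY p hmeas hadm) ?_
    filter_upwards [hle] with ω hω
    rwa [Real.norm_of_nonneg (lossOf_nonneg _ _ _ _ _ _)]
  refine ⟨hint, ?_⟩
  have h := integral_mono_ae hint (hL.add hE) hle
  simp only [Pi.add_apply] at h
  rw [integral_add hL hE] at h
  unfold risk
  linarith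

end risk

end LogNormalSure

end

open LogNormalSure in
theorem theorem6 {Ω : Type*} [MeasurableSpace Ω] (P : Measure Ω) [IsProbabilityMeasure P]
    (N n : ℕ) (hn : 3 ≤ n)
    -- the true parameters
    (M : ℕ → Matrix (Fin N) (Fin N) ℝ) (hM : ∀ i, (M i).PosDef)
    (Sig : ℕ → Matrix (Idx N) (Idx N) ℝ) (hSig : ∀ i, (Sig i).PosDef)
    -- the data: independent with distributions `LN(Mᵢ, Σᵢ)`
    (X : ℕ → Fin n → Ω → Matrix (Fin N) (Fin N) ℝ)
    (hX : ∀ i j, IsLogNormal (X i j) (M i) (Sig i) P)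
    (hind : iIndepFun (fun ij : ℕ × Fin n => X ij.1 ij.2) P)
    -- assumptions (i), (ii), (iii)
    (h1 : limsup (fun p : ℕ =>
      (((p : ℝ)⁻¹ * ∑ i ∈ Finset.range p, (Sig i).trace ^ 4 : ℝ) : EReal)) atTop < ⊤)
    (h2 : limsup (fun p : ℕ =>
      (((p : ℝ)⁻¹ * ∑ i ∈ Finset.range p,
        (tilde (M i)).ofLp ⬝ᵥ (Sig i *ᵥ (tilde (M i)).ofLp) : ℝ) : EReal)) atTop < ⊤)
    (h3 : ∃ δ : ℝ, 0 < δ ∧ limsup (fun p : ℕ =>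
      (((p : ℝ)⁻¹ * ∑ i ∈ Finset.range p, frob (logm (M i)) ^ (2 + δ) : ℝ) : EReal)) atTop < ⊤)
    -- the hyperparameters that minimize `SURE` up to `ε p → 0`, either over the whole class or
    -- over the constrained set
    (θhat : ℕ → Ω → Hyper N) (hmeas : ∀ p, MeasurableHyper (θhat p))
    (ε : ℕ → ℝ) (hε : Tendsto ε atTop (𝓝 0))
    (hmin : (∀ p, 0 < p → ∀ᵐ ω ∂P,
        IsSureMin p (fun i j => X i j ω) (admissible N) (ε p) (θhat p ω)) ∨
      (∀ p, 0 < p → ∀ᵐ ω ∂P,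
        IsSureMin p (fun i j => X i j ω) (constrained p (fun i j => X i j ω)) (ε p) (θhat p ω)))
    -- the fixed competitor
    (θ : Hyper N) (hθ : θ ∈ admissible N) :
    (∀ p, 0 < p → Integrable (lossOf p X (θhat p) M Sig) P ∧
      Integrable (lossOf p X (fun _ => θ) M Sig) P) ∧
    limsup (fun p : ℕ =>
      ((risk P p X (θhat p) M Sig - risk P p X (fun _ => θ) M Sig : ℝ) : EReal)) atTop ≤ 0 := by
  have hY := isGaussianArray_tilde hSig hX hind
  have hmin' : ∀ p, 0 < p → ∀ᵐ ω ∂P,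
      IsSureMin p (fun i j => X i j ω) (admissible N) (ε p) (θhat p ω) ∨
      IsSureMin p (fun i j => X i j ω) (constrained p fun i j => X i j ω) (ε p) (θhat p ω) := by
    intro p hp
    rcases hmin with h | h
    · exact (h p hp).mono fun ω hω => Or.inl hω
    · exact (h p hp).mono fun ω hω => Or.inr hω
  refine ⟨fun p hp => ⟨(risk_sub_le hn hY hp (hmeas p) (hmin' p hp) hθ).1,
    integrable_lossOf_const hn hY p hθ⟩, ?_⟩
  obtain ⟨B, hB⟩ := exists_momentSize_bound h1 h2 h3
  set C : ℝ := 2 * (5 + Fintype.card (Idx N) + Fintype.card (Idx N × Idx N) + 3) with hC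
  set c : ℝ := 8 + ‖meanWeight n θ • tilde θ.mu‖ ^ 2 + ‖covTarget n θ‖ ^ 2 with hc
  let b : ℕ → ℝ := fun p => 2 * ‖covTarget n θ‖ *
      ∫ ω, truncScatter (fun i j ω => tilde (X i j ω)) (frob θ.Psi) p ω ∂P + ε p +
      (√p)⁻¹ * (C * (noiseConst n (Idx N) * B) + (c + 2 * ε p))
  have hb : Tendsto b atTop (𝓝 0) := by
    have t1 := (hY.tendsto_integral_truncScatter hn (frob θ.Psi)).const_mul (2 * ‖covTarget n θ‖)
    have t2 : Tendsto (fun p : ℕ => (√(p : ℝ))⁻¹) atTop (𝓝 0) :=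
      tendsto_inv_atTop_zero.comp (Real.tendsto_sqrt_atTop.comp tendsto_natCast_atTop_atTop)
    have t3 := t2.mul ((tendsto_const_nhds (x := C * (noiseConst n (Idx N) * B))).add
      ((tendsto_const_nhds (x := c)).add (hε.const_mul 2)))
    simpa [b] using (t1.add hε).add t3
  have hle : ∀ᶠ p : ℕ in atTop,
      risk P p X (θhat p) M Sig - risk P p X (fun _ => θ) M Sig ≤ b p := by
    filter_upwards [hB, eventually_gt_atTop 0] with p hBp hp
    refine (risk_sub_le hn hY hp (hmeas p) (hmin' p hp) hθ).2.trans
      ((integral_excess_le hn hY θ (ε p) hp).2.trans ?_)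
    have hN := noiseConst_nonneg (n := n) (ι := Idx N)
    simp only [b]
    gcongr
  have hlim : limsup (fun p => (b p : EReal)) atTop = 0 :=
    ((continuous_coe_real_ereal.tendsto 0).comp hb).limsup_eq
  rw [← hlim]
  exact limsup_le_limsup (hle.mono fun p hp => EReal.coe_le_coe_iff.2 hp)
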